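/- **Setting.** Fix $q>2$ and write $\sigma(z)=(\max\{0,z\})^q$, $\ell(z)=\log(1+e^{-z})$. Let $\mathbf v\in\mathbb R^d\setminus\{0\}$. The data are $\mathbf x_i=[y_i\mathbf v,\boldsymbol\xi_i]$, $i\in[n]$, with Rademacher labels $y_i\in\{\pm1\}$ and $\boldsymbol\xi_i\sim\mathcal N(0,\sigma_\xi^2(\mathbf I-\mathbf v\mathbf v^\top/\|\mathbf v\|_2^2))$. The network is $f(\mathbf W,\mathbf x)=F_{+1}-F_{-1}$, $F_j(\mathbf W_j,\mathbf x)=\frac1m\sum_{r=1}^m[\sigma(\langle\mathbf w_{j,r},\mathbf x_1\rangle)+\sigma(\langle\mathbf w_{j,r},\mathbf x_2\rangle)]$, and $L_D(\mathbf W)=\frac1n\sum_i\ell(y_if(\mathbf W,\mathbf x_i))$. Noisy gradient descent is $$\mathbf w_{j,r}^{(t+1)}=\mathbf w_{j,r}^{(t)}-\eta\big(\nabla_{\mathbf w_{j,r}}L_D(\mathbf W^{(t)})+\mathbf z_{t+1}\big),\qquad \mathbf z_t\sim\mathcal N(0,\sigma_z^2\mathbf I_d),\quad \mathbf w^{(0)}_{j,r}\sim\mathcal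 N(0,\sigma_0^2\mathbf I_d),$$ all draws being independent. Write $\|\boldsymbol\xi\|_2:=\sigma_\xi\sqrt d$, $\mathrm{SNR}:=\|\mathbf v\|_2/\|\boldsymbol\xi\|_2$, $\mu:=\max\{1,\|\mathbf v\|_2,\|\boldsymbol\xi\|_2\}$. For privacy parameters $\varepsilon>0$, $\delta\in(0,1)$ and $T$ iterations, $$\sigma_z=S\,\frac{\|\mathbf v\|_2+\|\boldsymbol\xi\|_2}{nm}\cdot\frac{\sqrt{2T\log(1.25/\delta)}}{\varepsilon},\qquad 0\le S\le\widetilde O(1).$$ The coefficients $\Gamma_{j,r}^{(t)}\ge0$, $\Phi_{j,r,i}^{(t)}$ are those of the decomposition $$\mathbf w_{j,r}^{(t)}=\mathbf w_{j,r}^{(0)}+j\,\Gamma_{j,r}^{(t)}\frac{\mathbf v}{\|\mathbf v\|_2^2}+\sum_{i=1}^n\Phi_{j,r,i}^{(t)}\frac{\boldsymbol\xi_i}{\|\boldsymbol\xi_i\|_2^2}-\eta\sum_{s=1}^t\mathbf z_s .$$ Let $\kappa>0$ be a constant. $\widetilde O,\widetilde\Omega$ hide factors $C\Lambda^K$, where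 $\Lambda$ is the logarithm of the sum of $3,d,n,m,\delta^{-1}$ and of the numbers $\|\mathbf v\|_2,\sigma_\xi,\sigma_0,\eta,\varepsilon,\kappa$ and their inverses. The constants $C,K$ depend only on $q$, on $\kappa$, on the factor hidden in $S\le\widetilde O(1)$ and on the degree of the polynomial below. **Conditions of data noise memorization.** - $d\ge\widetilde\Omega(m^{2\vee[4/(q-2)]}n^{4\vee[(2q-2)/(q-2)]})$ and $n,m\ge\Omega(\operatorname{polylog}(d))$; - $\eta\le\widetilde O(\min\{\|\mathbf v\|_2^{-2},\|\boldsymbol\xi\|_2^{-2}\})$; - $\widetilde O(\max\{\varepsilon^{-1/q}\|\boldsymbol\xi\|_2^{-1},(n/\sqrt d)\|\mathbf v\|_2^{-1}\})\le\sigma_0\le\widetilde O(\min\{(n\varepsilon)^{-1/q}\|\mathbf v\|_2^{-1},\|\boldsymbol\xi\|_2^{-1}\})$; - $\min\{\mathrm{SNR}^{-1}\varepsilon,\ \mathrm{SNR}^{-q}n^{-1}\}\ge\widetilde\Omega(1)$. Let $$T_1=\left\lceil c\cdot\frac{\log(10/(\sigma_0\sigma_\xi\sqrt d))\,4mn}{0.15^{q-2}\,\eta\,q\,\sigma_0^{q-2}(\sigma_\xi\sqrt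 d)^q}\right\rceil$$ with a suitable $c>0$ that depends only on $q$. Let $T_1\le T\le T_p^*:=\min\big\{T^*,\ \eta^{-1}\cdot4\log(T^*)\,mn\varepsilon\sigma_0\,\mu^{-1}(\|\mathbf v\|_2+\|\boldsymbol\xi\|_2)^{-1}\big\}$, where $T^*=\eta^{-1}\big(2+\kappa^{-1}+\|\mathbf v\|_2^{-1}+d^{-1}\sigma_\xi^{-2}+\sigma_0^{-1}+n+m+d\big)^k$ and $k$ is any fixed degree. **Corollary.** Under these conditions, with probability at least $1-1/d$, the coefficients $\Gamma,\Phi$ exist and are unique, for every $i\in[n]$ there are $j,r$ with $\Phi_{j,r,i}^{(T_1)}\ge2$, and the following holds. 1. If $n^{1/q}\varepsilon\ge m$, then $|\Gamma_{j,r}^{(t)}|\le\sigma_0\|\mathbf v\|_2$ for all $t\in[T_1,T]$, $j\in\{\pm1\}$, $r\in[m]$. 2. Let $\mathbf W^*$ have the filters $\mathbf w_{j,r}^*=\mathbf w_{j,r}^{(0)}+2qm\log(2q/\kappa)\sum_{i=1}^n\mathbb 1(j=y_i)\frac{\boldsymbol\xi_i}{\|\boldsymbol\xi_i\|_2}$ and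 let $\|\mathbf W\|_F^2=\|\mathbf W_{+1}\|_F^2+\|\mathbf W_{-1}\|_F^2$. Then for every $t\in[T_1,T]$ $$\sum_{s=T_1}^tL_D(\mathbf W^{(s)})\le\frac{\|\mathbf W^{(T_1)}-\mathbf W^*\|_F^2}{(2q-1)\eta}+\frac{(t-T_1+1)\kappa}{2q-1}+(t-T_1+1)\,\frac{\eta d\sigma_z^2+\widetilde O(\sigma_zm^2n^{1/2}\|\boldsymbol\xi\|_2^{-1})}{2q-1}.$$ -/

import Mathlib

open MeasureTheory ProbabilityTheory

noncomputable section

namespace PrivateCNN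

/-! ### The network and the loss -/

/-- The ambient space `ℝ^d` with its Euclidean norm. -/
abbrev Vec (d : ℕ) : Type := EuclideanSpace ℝ (Fin d)

/-- The two signs are indexed by `Bool`: `true` stands for `+1` and `false` for `-1`. -/
def sgn (b : Bool) : ℝ := if b then 1 else -1

/-- Polynomial ReLU `σ(z) = (max {0, z})^q`. -/
def act (q z : ℝ) : ℝ := (max 0 z) ^ q

/-- All filters `w_{j,r}`, `j ∈ {±1}`, `r ∈ [m]`. -/
abbrev Weights (d m : ℕ) : Type := Bool → Fin m → Vec d

/-- `F_j(W_j, x) = (1/m) ∑_r [σ(⟨w_{j,r}, x₁⟩) + σ(⟨w_{j,r}, x₂⟩)]`. -/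
def branch {d m : ℕ} (q : ℝ) (w : Fin m → Vec d) (x : Vec d × Vec d) : ℝ :=
  (1 / (m : ℝ)) * ∑ r, (act q (inner ℝ (w r) x.1) + act q (inner ℝ (w r) x.2))

/-- `f(W, x) = F_{+1}(W_{+1}, x) - F_{-1}(W_{-1}, x)`. -/
def net {d m : ℕ} (q : ℝ) (W : Weights d m) (x : Vec d × Vec d) : ℝ :=
  branch q (W true) x - branch q (W false) x

/-- Logistic loss `ℓ(z) = log (1 + exp (-z))`. -/
def logistic (z : ℝ) : ℝ := Real.log (1 + Real.exp (-z))

/-- Empirical risk `L_D(W)` of the data set `x_i = [y_i v, ξ_i]`, with labels `y_i`. -/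
def empRisk {d n m : ℕ} (q : ℝ) (v : Vec d) (y : Fin n → Bool) (ξ : Fin n → Vec d)
    (W : Weights d m) : ℝ :=
  (1 / (n : ℝ)) * ∑ i, logistic (sgn (y i) * net q W (sgn (y i) • v, ξ i))

/-- The partial gradient `∇_{w_{j,r}} L(W)`. -/
def partialGrad {d m : ℕ} (L : Weights d m → ℝ) (W : Weights d m) (j : Bool) (r : Fin m) :
    Vec d :=
  gradient (fun w : Vec d => L (Function.update W j (Function.update (W j) r w))) (W j r)

/-- Noisy gradient descent with step size `η`, from `W₀`.  The step from iterate `t` to iterate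
`t + 1` adds the vector `z (t + 1)` to every partial gradient, so that the noise that has
entered iterate `t` is `z 1, …, z t`. -/
def noisyGD {d m : ℕ} (η : ℝ) (L : Weights d m → ℝ) (W₀ : Weights d m) (z : ℕ → Vec d) :
    ℕ → Weights d m
  | 0 => W₀
  | t + 1 => fun j r =>
      noisyGD η L W₀ z t j r - η • (partialGrad L (noisyGD η L W₀ z t) j r + z (t + 1))

/-- `‖W - W'‖_F²`, with `‖W‖_F² = ‖W_{+1}‖_F² + ‖W_{-1}‖_F²`. -/
def frobDistSq {d m : ℕ} (W W' : Weights d m) : ℝ := ∑ j, ∑ r, ‖W j r - W' j r‖ ^ 2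

/-- Signal-noise decomposition of the trajectory `W`: coefficients `Γ j r t ≥ 0` and
`Φ j r i t` with
`w_{j,r}^{(t)} = w_{j,r}^{(0)} + j Γ v/‖v‖² + ∑_i Φ ξ_i/‖ξ_i‖² - η ∑_{s=1}^t z_s`. -/
structure IsDecomposition {d n m : ℕ} (v : Vec d) (ξ : Fin n → Vec d) (η : ℝ) (z : ℕ → Vec d)
    (W : ℕ → Weights d m) (Γ : Bool → Fin m → ℕ → ℝ) (Φ : Bool → Fin m → Fin n → ℕ → ℝ) :
    Prop where
  nonneg : ∀ j r t, 0 ≤ Γ j r t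
  eq : ∀ j r t, W t j r = W 0 j r + (sgn j * Γ j r t * (‖v‖ ^ 2)⁻¹) • v
    + ∑ i, (Φ j r i t * (‖ξ i‖ ^ 2)⁻¹) • ξ i - η • ∑ s ∈ Finset.Icc 1 t, z s

/-- The reference point
`w*_{j,r} = w_{j,r}^{(0)} + 2 q m log (2q/κ) ∑_i 1(j = y_i) ξ_i/‖ξ_i‖`. -/
def refWeights {d n m : ℕ} (q κ : ℝ) (y : Fin n → Bool) (ξ : Fin n → Vec d)
    (W₀ : Weights d m) : Weights d m := fun j r =>
  W₀ j r + (2 * q * m * Real.log (2 * q / κ)) • ∑ i, if j = y i then ‖ξ i‖⁻¹ • ξ i else 0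

/-! ### The parameters of the problem -/

/-- The parameters: dimension `d`, sample size `n`, width `m`, number of iterations `T`, signal
`v`, standard deviations `σξ` of the data noise and `σ₀` of the initialization, step size `η`,
privacy parameters `(ε, δ)`, and the constant `sens` in the `ℓ₂`-sensitivity
`sens (‖v‖ + ‖ξ‖)/(n m)` of one gradient step. -/
structure Setup where
  d : ℕ
  n : ℕ
  m : ℕ
  T : ℕ
  v : Vec d
  σξ : ℝ
  σ₀ : ℝ
  η : ℝ
  ε : ℝ
  δ : ℝ
  sens : ℝ
  n_pos : 0 < n
  m_pos : 0 < m
  v_ne : v ≠ 0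
  σξ_pos : 0 < σξ
  σ₀_pos : 0 < σ₀
  η_pos : 0 < η
  ε_pos : 0 < ε
  δ_pos : 0 < δ
  δ_lt : δ < 1
  sens_nonneg : 0 ≤ sens

namespace Setup

variable (P : Setup)

/-- The size `‖ξ‖ = σ_ξ √d` of the data noise. -/
def ξnorm : ℝ := P.σξ * √(P.d : ℝ)

/-- `SNR = ‖v‖ / ‖ξ‖`. -/
def snr : ℝ := ‖P.v‖ / P.ξnorm

/-- `μ = max {1, ‖v‖, ‖ξ‖}`. -/
def μ : ℝ := max 1 (max ‖P.v‖ P.ξnorm)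

/-- The logarithm of the size of all parameters.  The notations `Õ` and `Ω̃` hide factors
`C * (P.logSize κ) ^ K`. -/
def logSize (κ : ℝ) : ℝ :=
  Real.log (3 + P.d + P.n + P.m + (‖P.v‖ + ‖P.v‖⁻¹) + (P.σξ + P.σξ⁻¹) + (P.σ₀ + P.σ₀⁻¹)
    + (P.η + P.η⁻¹) + (P.ε + P.ε⁻¹) + P.δ⁻¹ + (κ + κ⁻¹))

/-- `T* = η⁻¹ poly(κ⁻¹, ‖v‖⁻¹, d⁻¹ σ_ξ⁻², σ₀⁻¹, n, m, d)`, with a polynomial of degree `k`. -/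
def Tstar (κ : ℝ) (k : ℕ) : ℝ :=
  P.η⁻¹ * (2 + κ⁻¹ + ‖P.v‖⁻¹ + (P.d * P.σξ ^ 2)⁻¹ + P.σ₀⁻¹ + P.n + P.m + P.d) ^ k

/-- The maximum permissible number of iterations
`T_p* = min {T*, η⁻¹ C m n ε σ₀ μ⁻¹ (‖v‖ + ‖ξ‖)⁻¹}`, with `C = 4 log T*`. -/
def TpStar (κ : ℝ) (k : ℕ) : ℝ :=
  min (P.Tstar κ k)
    (P.η⁻¹ * (4 * Real.log (P.Tstar κ k) * P.m * P.n * P.ε * P.σ₀ / (P.μ * (‖P.v‖ + P.ξnorm))))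

/-- The standard deviation of the private noise: the Gaussian mechanism with sensitivity
`sens (‖v‖ + ‖ξ‖)/(n m)`, composed over `T` iterations. -/
def σz : ℝ :=
  P.sens * (‖P.v‖ + P.ξnorm) / (P.n * P.m) * √(2 * P.T * Real.log (1.25 / P.δ)) / P.ε

/-- The length of the first stage,
`T₁ = c log (10/(σ₀ ‖ξ‖)) 4 m n / (0.15^{q-2} η q σ₀^{q-2} ‖ξ‖^q)`, rounded up. -/
def T₁ (q c : ℝ) : ℕ :=
  ⌈c * (Real.log (10 / (P.σ₀ * P.ξnorm)) * (4 * P.m * P.n) /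
    ((0.15 : ℝ) ^ (q - 2) * P.η * q * P.σ₀ ^ (q - 2) * P.ξnorm ^ q))⌉₊

/-- The conditions of data noise memorization, with `h = C * (P.logSize κ) ^ K` as the factor
hidden in `Õ` and `Ω̃`, and `C * (log d) ^ K` as the polylogarithm in `n, m = Ω(polylog d)`. -/
structure NoiseMemorization (q κ C : ℝ) (K : ℕ) : Prop where
  dim : C * P.logSize κ ^ K * ((P.m : ℝ) ^ max 2 (4 / (q - 2))
    * (P.n : ℝ) ^ max 4 ((2 * q - 2) / (q - 2))) ≤ P.d
  samples : C * Real.log P.d ^ K ≤ P.n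
  width : C * Real.log P.d ^ K ≤ P.m
  step : C * P.logSize κ ^ K * P.η ≤ min (‖P.v‖ ^ 2)⁻¹ (P.ξnorm ^ 2)⁻¹
  init_lower : C * P.logSize κ ^ K
    * max (P.ε ^ (-1 / q) * P.ξnorm⁻¹) (P.n / √(P.d : ℝ) * ‖P.v‖⁻¹) ≤ P.σ₀
  init_upper : C * P.logSize κ ^ K * P.σ₀
    ≤ min ((P.n * P.ε) ^ (-1 / q) * ‖P.v‖⁻¹) P.ξnorm⁻¹
  snr_cond : C * P.logSize κ ^ K ≤ min (P.snr⁻¹ * P.ε) ((P.snr ^ q)⁻¹ * (P.n : ℝ)⁻¹)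

/-! ### The randomness -/

/-- Labels `y_i`, data noises `ξ_i`, initial filters `w_{j,r}^{(0)}`, private noises `z_t`. -/
abbrev Sample : Type :=
  (Fin P.n → Bool) × (Fin P.n → Vec P.d) × Weights P.d P.m × (ℕ → Vec P.d)

/-- The Gaussian law `N(0, s² I)` on `ℝ^d`. -/
abbrev isoGaussian (s : ℝ) : Measure (Vec P.d) :=
  multivariateGaussian 0 (s ^ 2 • (1 : Matrix (Fin P.d) (Fin P.d) ℝ))

/-- `H = I - v vᵀ / ‖v‖²`. -/
def H : Matrix (Fin P.d) (Fin P.d) ℝ :=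
  1 - (‖P.v‖ ^ 2)⁻¹ • Matrix.of (fun a b => P.v a * P.v b)

/-- The joint law: all labels are Rademacher, all `ξ_i ∼ N(0, σ_ξ² H)`, all initial filters
`∼ N(0, σ₀² I)`, all `z_t ∼ N(0, σ_z² I)`, and everything is independent. -/
def law : Measure P.Sample :=
  (Measure.pi fun _ : Fin P.n => (PMF.uniformOfFintype Bool).toMeasure).prod
    ((Measure.pi fun _ : Fin P.n => multivariateGaussian 0 (P.σξ ^ 2 • P.H)).prod
      ((Measure.pi fun _ : Bool => Measure.pi fun _ : Fin P.m => P.isoGaussian P.σ₀).prod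
        (Measure.infinitePi fun _ : ℕ => P.isoGaussian P.σz)))

/-- The empirical risk of the random data set. -/
def risk (q : ℝ) (ω : P.Sample) (W : Weights P.d P.m) : ℝ := empRisk q P.v ω.1 ω.2.1 W

/-- The iterates `W^{(t)}` of noisy gradient descent on the random data set. -/
def iter (q : ℝ) (ω : P.Sample) : ℕ → Weights P.d P.m :=
  noisyGD P.η (P.risk q ω) ω.2.2.1 ω.2.2.2

end Setup

end PrivateCNN

end

open MeasureTheory ProbabilityTheory

/-!
# Data noise memorization under private gradient descent

The loss derivatives of logistic regression decay exponentially in the margin, so it is enough to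
follow the coefficients of the signal-noise decomposition.  By `traj_eq` and `dynamics` they obey a
closed scalar recursion: `Φ j r i` grows for `j = y i` at a rate governed by the inner product of
the filter with `ξ_i`, shrinks for `j ≠ y i`, and `Γ j r` grows at a rate governed by the inner
product with `v`.  `Regime` collects the inequalities under which this recursion memorizes the
data noise.

*Invariants* (`Regime.inv`).  The coefficients that memorize a sample are measured by their
normalized `ℓ_q` norm over the filters, because this norm determines the margin up to constants.
Once it exceeds a threshold `θ` of logarithmic size, the loss derivative is below `1 / T`, and
the norm can grow by at most `1` during the whole run.  The coefficients of the wrong sign stay in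
`[-1, 0]`, because the update vanishes when the inner product is negative.

*First stage* (`Regime.exists_two_le`, `Regime.G_le_size`).  A fixed fraction of the filters starts
with an inner product of order `σ₀ ‖ξ‖` with a given data noise.  One of them receives little
interference from the other samples (`Regime.Inv.exists_seed`) and grows geometrically, while the
loss derivative is bounded below as long as the sample is not fitted.  The first half of the
`T₁` steps brings one coefficient to the size `2`, and the second half brings the norm to any
constant level `G`.  As the norm is monotone, all margins stay large from then on
(`Regime.le_margin`).  With `G = level q κ` every later loss is at most `κ / (2 q - 1)`
(`Setup.logistic_le_of_level`), and this alone gives the bound for the cumulative loss, because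
the other terms of the bound are nonnegative.

*Signal* (`Regime.Γ_le_sum`, `Regime.sum_g_le`).  The signal coefficients are controlled by the sum
of the loss derivatives.  Up to `T₁` it is at most `T₁`; afterwards each step increases
the potential `∑_r (Φ j r i)²` by a multiple of the loss derivative, and the potential is bounded.
The total is multiplied by the signal rate, which is smaller than the noise rate by the factor
`n * SNR ^ q`.

*Probability* (`Setup.law_not_typical_le`).  On a typical sample the data noises have norm of order
`‖ξ‖`, are nearly orthogonal to each other and orthogonal to `v`, the initial filters have Gaussian
size, enough of them are seeds for every data noise, and the accumulated private noise at time `t`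
has size `√t σ_z`.  These facts come from sub-Gaussian tails, Hoeffding's inequality and a union
bound.

*Parameters* (`Setup.Calibrated`, `Setup.NoiseMemorization.calibrated`).  All polylogarithmic
quantities are bounded by a single number `Z`, and the hidden factor of the conditions is a large
power of `Z`.  The permissible number of iterations keeps the accumulated private noise of the
whole run below `Z ^ 3 * σ₀` (`Setup.Calibrated.η_mul_σz_mul_sqrt_le`), and up to `T₁` the
lower bound on `σ₀` in terms of `ε` makes it negligible against `σ₀`
(`Setup.Calibrated.η_mul_σz_mul_sqrt_T₁_le`).
-/

noncomputable section

namespace PrivateCNN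

/-! ### The normalized `ℓ_q` norm of the coefficients of one sample -/

/-- The normalized `ℓ_q` norm `(m⁻¹ ∑_r |x_r|^q)^{1/q}`. -/
def powMean {m : ℕ} (q : ℝ) (x : Fin m → ℝ) : ℝ := (1 / (m : ℝ) * ∑ r, |x r| ^ q) ^ (1 / q)

section PowMean

variable {m : ℕ} {q : ℝ}

lemma powMean_nonneg (x : Fin m → ℝ) : 0 ≤ powMean q x := by
  unfold powMean; positivity

lemma powMean_rpow (hq : 0 < q) (x : Fin m → ℝ) :
    powMean q x ^ q = 1 / (m : ℝ) * ∑ r, |x r| ^ q := by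
  unfold powMean
  rw [← Real.rpow_mul (by positivity), one_div_mul_cancel hq.ne', Real.rpow_one]

lemma powMean_add_le (hq : 1 ≤ q) (x y : Fin m → ℝ) :
    powMean q (fun r => x r + y r) ≤ powMean q x + powMean q y := by
  unfold powMean
  have hs : ∀ f : Fin m → ℝ, 0 ≤ ∑ r, |f r| ^ q := fun f => by positivity
  rw [Real.mul_rpow (by positivity) (hs _), Real.mul_rpow (by positivity) (hs _),
    Real.mul_rpow (by positivity) (hs _), ← mul_add]
  exact mul_le_mul_of_nonneg_left (Real.Lp_add_le _ _ _ hq) (by positivity)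

lemma powMean_mono (hq : 0 < q) {x y : Fin m → ℝ} (h : ∀ r, |x r| ≤ |y r|) :
    powMean q x ≤ powMean q y := by
  unfold powMean
  refine Real.rpow_le_rpow (by positivity) ?_ (by positivity)
  exact mul_le_mul_of_nonneg_left (Finset.sum_le_sum fun r _ =>
    Real.rpow_le_rpow (abs_nonneg _) (h r) hq.le) (by positivity)

lemma powMean_le_of_forall_le (hm : 0 < m) (hq : 0 < q) {x : Fin m → ℝ} {c : ℝ}
    (h : ∀ r, |x r| ≤ c) : powMean q x ≤ c := by
  have hc : 0 ≤ c := (abs_nonneg _).trans (h ⟨0, hm⟩)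
  have hm' : (0 : ℝ) < m := by exact_mod_cast hm
  rw [← Real.rpow_le_rpow_iff (powMean_nonneg x) hc hq, powMean_rpow hq]
  calc 1 / (m : ℝ) * ∑ r, |x r| ^ q ≤ 1 / (m : ℝ) * ∑ _r : Fin m, c ^ q := by
        exact mul_le_mul_of_nonneg_left (Finset.sum_le_sum fun r _ =>
          Real.rpow_le_rpow (abs_nonneg _) (h r) hq.le) (by positivity)
    _ = c ^ q := by simp; field_simp

/-- Changing every entry by at most `c` changes the mean by at most `c`, whatever the number of
entries: this is the reason for the normalization. -/
lemma powMean_le_add_of_abs_sub_le (hm : 0 < m) (hq : 1 ≤ q) {x y : Fin m → ℝ} {c : ℝ}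
    (h : ∀ r, |x r - y r| ≤ c) : powMean q x ≤ powMean q y + c := by
  have h1 := powMean_add_le hq y (fun r => x r - y r)
  have h2 : powMean q (fun r => x r - y r) ≤ c := powMean_le_of_forall_le hm (by linarith) h
  simp only [add_sub_cancel] at h1
  linarith

lemma abs_le_rpow_mul_powMean (hm : 0 < m) (hq : 0 < q) (x : Fin m → ℝ) (r : Fin m) :
    |x r| ≤ (m : ℝ) ^ (1 / q) * powMean q x := by
  have hm' : (0 : ℝ) < m := by exact_mod_cast hm
  rw [← Real.rpow_le_rpow_iff (abs_nonneg _) (by have := powMean_nonneg (q := q) x; positivity) hq,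
    Real.mul_rpow (by positivity) (powMean_nonneg x), powMean_rpow hq, ← Real.rpow_mul hm'.le,
    one_div_mul_cancel hq.ne', Real.rpow_one, ← mul_assoc, mul_one_div_cancel hm'.ne', one_mul]
  exact Finset.single_le_sum (f := fun r => |x r| ^ q) (fun i _ => by positivity)
    (Finset.mem_univ r)

lemma natCast_rpow_le_self (hm : 0 < m) {s : ℝ} (hs : s ≤ 1) : (m : ℝ) ^ s ≤ m := by
  conv_rhs => rw [← Real.rpow_one (m : ℝ)]
  exact Real.rpow_le_rpow_of_exponent_le (by exact_mod_cast hm) hs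

lemma abs_le_mul_powMean (hm : 0 < m) (hq : 1 ≤ q) (x : Fin m → ℝ) (r : Fin m) :
    |x r| ≤ m * powMean q x := by
  refine (abs_le_rpow_mul_powMean hm (by linarith) x r).trans ?_
  refine mul_le_mul_of_nonneg_right (natCast_rpow_le_self hm ?_) (powMean_nonneg x)
  rw [div_le_one (by linarith)]; exact hq

lemma sum_abs_le_mul_powMean (hm : 0 < m) (hq : 1 ≤ q) (x : Fin m → ℝ) :
    ∑ r, |x r| ≤ m * powMean q x := by
  have hm' : (0 : ℝ) < m := by exact_mod_cast hm
  have h := Real.arith_mean_le_rpow_mean Finset.univ (fun _ : Fin m => 1 / (m : ℝ))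
    (fun r => |x r|) (fun _ _ => by positivity) (by simp; field_simp) (fun _ _ => abs_nonneg _) hq
  rw [← Finset.mul_sum, ← Finset.mul_sum] at h
  have h2 : 1 / (m : ℝ) * ∑ r, |x r| ≤ powMean q x := h
  calc ∑ r, |x r| = m * (1 / (m : ℝ) * ∑ r, |x r|) := by field_simp
    _ ≤ _ := mul_le_mul_of_nonneg_left h2 hm'.le

lemma act_nonneg (x : ℝ) : 0 ≤ act q x := Real.rpow_nonneg (le_max_left _ _) _

lemma act_le (hq : 0 ≤ q) {x c : ℝ} (hc : 0 ≤ c) (h : x ≤ c) : act q x ≤ c ^ q :=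
  Real.rpow_le_rpow (le_max_left _ _) (max_le hc h) hq

lemma avg_le (hm : 0 < m) {f : Fin m → ℝ} {c : ℝ} (h : ∀ r, f r ≤ c) :
    1 / (m : ℝ) * ∑ r, f r ≤ c := by
  have hm' : (0 : ℝ) < m := by exact_mod_cast hm
  calc 1 / (m : ℝ) * ∑ r, f r ≤ 1 / (m : ℝ) * ∑ _r : Fin m, c :=
        mul_le_mul_of_nonneg_left (Finset.sum_le_sum fun r _ => h r) (by positivity)
    _ = c := by simp; field_simp

/-- The output of the filters on one patch is a power of the normalized `ℓ_q` norm. -/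
lemma avg_act_eq (hq : 0 < q) (x : Fin m → ℝ) :
    1 / (m : ℝ) * ∑ r, act q (x r) = powMean q (fun r => max 0 (x r)) ^ q := by
  rw [powMean_rpow hq]
  simp only [act, abs_of_nonneg (le_max_left (0 : ℝ) _)]

end PowMean

/-! ### The dynamics of the coefficients -/

/-- The scalar dynamics of noisy gradient descent on `n` samples with `m` filters per sign.
`Γ` and `Φ` are the coefficients of the signal and of the data noises, `s` and `u` the inner
products of the filters with `v` and with the `ξ_i`, and `g i t` is `-ℓ'` at the margin of
sample `i`.  The static data are the labels `y`, the squared norms `sq i = ‖ξ_i‖²`, the ratios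
`corr i' i = ⟨ξ_{i'}, ξ_i⟩ / ‖ξ_{i'}‖²`, the initial inner products `u₀` and `s₀`, and the
contributions `νξ`, `νv` of the accumulated private noise. -/
structure Dynamics (n m : ℕ) (q η V : ℝ) where
  y : Fin n → Bool
  sq : Fin n → ℝ
  corr : Fin n → Fin n → ℝ
  u₀ : Bool → Fin m → Fin n → ℝ
  s₀ : Bool → Fin m → ℝ
  νξ : Fin n → ℕ → ℝ
  νv : ℕ → ℝ
  Φ : Bool → Fin m → Fin n → ℕ → ℝ
  Γ : Bool → Fin m → ℕ → ℝ
  u : Bool → Fin m → Fin n → ℕ → ℝ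
  s : Bool → Fin m → ℕ → ℝ
  margin : Fin n → ℕ → ℝ
  g : Fin n → ℕ → ℝ
  Φ_zero : ∀ j r i, Φ j r i 0 = 0
  Φ_succ : ∀ j r i t, Φ j r i (t + 1) = Φ j r i t
    + sgn j * sgn (y i) * (η / (n * m) * g i t * (q * (max 0 (u j r i t)) ^ (q - 1)) * sq i)
  Γ_zero : ∀ j r, Γ j r 0 = 0
  Γ_succ : ∀ j r t, Γ j r (t + 1) = Γ j r t
    + η / (n * m) * (∑ i, g i t * (q * (max 0 (sgn (y i) * s j r t)) ^ (q - 1))) * V ^ 2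
  u_eq : ∀ j r i t, u j r i t = u₀ j r i + ∑ i', Φ j r i' t * corr i' i - νξ i t
  s_eq : ∀ j r t, s j r t = s₀ j r + sgn j * Γ j r t - νv t
  margin_eq : ∀ i t, margin i t =
    1 / (m : ℝ) * ∑ r, (act q (sgn (y i) * s (y i) r t) + act q (u (y i) r i t))
    - 1 / (m : ℝ) * ∑ r, (act q (sgn (y i) * s (!y i) r t) + act q (u (!y i) r i t))
  g_eq : ∀ i t, g i t = (1 + Real.exp (margin i t))⁻¹

/-- The regime of noise memorization for the scalar dynamics.  The squared data noises lie in
`[lo, hi]`, the correlations are at most `τ`, a fraction `c₂` of the filters of each sign starts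
with inner product at least `α` with a given data noise, and the accumulated private noise is
negligible against `α` up to time `T₁`.  The coefficients of a sample are bounded through the
threshold `θ` for their normalized `ℓ_q` norm, `Γm` is the bound for the signal coefficients,
`ω` bounds the initial fluctuations together with the private noise, `B` those along the signal,
and `G` is the size of the normalized `ℓ_q` norm that is reached at time `T₁`.  The condition
`horizon` says that the loss derivative at the threshold `θ` is below `1 / T`, `interference` that
the cross terms, averaged over the filters, are small against `α`.  The growth conditions
`growth_early` and `growth_late` ensure that every sample has a coefficient of size `2` at time
`t₁` and that the level `G` is reached in the remaining `T₁ - t₁` steps. -/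
structure Regime {n m : ℕ} {q η V : ℝ} (D : Dynamics n m q η V) where
  lo : ℝ
  hi : ℝ
  τ : ℝ
  α : ℝ
  c₂ : ℝ
  ω : ℝ
  B : ℝ
  θ : ℝ
  Γm : ℝ
  G : ℝ
  T : ℕ
  T₁ : ℕ
  t₁ : ℕ
  n_pos : 0 < n
  m_pos : 0 < m
  two_lt : 2 < q
  η_pos : 0 < η
  lo_pos : 0 < lo
  τ_nonneg : 0 ≤ τ
  α_pos : 0 < α
  B_nonneg : 0 ≤ B
  two_le_θ : 2 ≤ θ
  two_le_G : 2 ≤ G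
  t₁_le : t₁ ≤ T₁
  T₁_pos : 0 < T₁
  T₁_le : T₁ ≤ T
  lo_le : ∀ i, lo ≤ D.sq i
  le_hi : ∀ i, D.sq i ≤ hi
  corr_self : ∀ i, D.corr i i = 1
  corr_le : ∀ i' i, i' ≠ i → |D.corr i' i| ≤ τ
  u₀_le : ∀ j r i, |D.u₀ j r i| ≤ ω
  s₀_le : ∀ j r, |D.s₀ j r| ≤ B
  νξ_le : ∀ i t, t ≤ T → |D.νξ i t| ≤ ω
  νv_le : ∀ t, t ≤ T → |D.νv t| ≤ B
  νξ_le_early : ∀ i t, t ≤ T₁ → |D.νξ i t| ≤ α / 4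
  seeds : ∀ i, c₂ * m ≤ ((Finset.univ.filter fun r => α ≤ D.u₀ (D.y i) r i).card : ℝ)
  Γm_le : Γm ≤ B
  fluct : 2 * ω + n * (m * (θ + 3)) * τ ≤ 1 / 4
  step : η * q * hi * (θ + 3) ^ (q - 1) / n ≤ 1 / 4
  horizon : T * Real.exp (2 - θ) ≤ 1
  interference : n * (θ + 3) * τ * 4 < α * c₂
  signal : (3 * B) ^ q ≤ 1 / 2
  signal_growth : η * V ^ 2 / (n * m) * (q * (3 * B) ^ (q - 1))
    * (n * (T₁ + n * m * ((θ + 2) ^ q + 1) / (2 * η * q * lo))) ≤ Γm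
  growth_early : 3 ≤ α / 2 * (1 + η * lo * q * (Real.exp (-(3 ^ q + 1)) / 2)
    * (α / 2) ^ (q - 2) / (n * m)) ^ t₁
  growth_late : m * G < 2 * (1 + η * lo * q * (Real.exp (-((G + 1) ^ q + 1)) / 2)
    / (2 * (n * m))) ^ (T₁ - t₁)

namespace Dynamics

variable {n m : ℕ} {q η V : ℝ} (D : Dynamics n m q η V)

lemma sgn_mul_self (b : Bool) : sgn b * sgn b = 1 := by cases b <;> simp [sgn]

lemma sgn_mul_of_ne {b c : Bool} (h : b ≠ c) : sgn b * sgn c = -1 := by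
  cases b <;> cases c <;> simp_all [sgn]

lemma g_pos (i t) : 0 < D.g i t := by rw [D.g_eq]; positivity

lemma g_le_one (i t) : D.g i t ≤ 1 := by
  rw [D.g_eq]
  exact inv_le_one_of_one_le₀ (by linarith [Real.exp_pos (D.margin i t)])

lemma g_le_exp (i t) : D.g i t ≤ Real.exp (-D.margin i t) := by
  rw [D.g_eq, Real.exp_neg]
  exact inv_anti₀ (Real.exp_pos _) (by linarith)

lemma le_g {M : ℝ} (hM : 0 ≤ M) {i t} (h : D.margin i t ≤ M) : Real.exp (-M) / 2 ≤ D.g i t := by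
  have h1 : (1 : ℝ) ≤ Real.exp M := Real.one_le_exp hM
  have h2 : Real.exp (D.margin i t) ≤ Real.exp M := Real.exp_le_exp.mpr h
  have h3 : Real.exp (-M) / 2 = (Real.exp M * 2)⁻¹ := by
    rw [Real.exp_neg, mul_inv, div_eq_mul_inv]
  rw [D.g_eq, h3]
  exact inv_anti₀ (by positivity) (by linarith)

end Dynamics
end PrivateCNN

/-! ### Invariants of the scalar dynamics -/

namespace PrivateCNN

namespace Dynamics

variable {n m : ℕ} {q η V : ℝ} {D : Dynamics n m q η V}

/-- The increment of the noise coefficient `Φ j r i`, up to its sign. -/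
def incr (D : Dynamics n m q η V) (j : Bool) (r : Fin m) (i : Fin n) (t : ℕ) : ℝ :=
  η / (n * m) * D.g i t * (q * (max 0 (D.u j r i t)) ^ (q - 1)) * D.sq i

/-- The normalized `ℓ_q` norm of the coefficients that memorize sample `i`. -/
def size (D : Dynamics n m q η V) (i : Fin n) (t : ℕ) : ℝ :=
  powMean q fun r => D.Φ (D.y i) r i t

lemma Φ_succ_of_eq {j i} (h : j = D.y i) (r t) :
    D.Φ j r i (t + 1) = D.Φ j r i t + D.incr j r i t := by
  rw [D.Φ_succ, h, sgn_mul_self, one_mul]; rfl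

lemma Φ_succ_of_ne {j i} (h : j ≠ D.y i) (r t) :
    D.Φ j r i (t + 1) = D.Φ j r i t - D.incr j r i t := by
  rw [D.Φ_succ, sgn_mul_of_ne h, neg_one_mul, sub_eq_add_neg]; rfl

end Dynamics

namespace Regime

open PrivateCNN.Dynamics

variable {n m : ℕ} {q η V : ℝ} {D : Dynamics n m q η V} (R : Regime D)
include R

lemma n_pos' : (0 : ℝ) < n := by exact_mod_cast R.n_pos
lemma m_pos' : (0 : ℝ) < m := by exact_mod_cast R.m_pos
lemma T_pos' : (0 : ℝ) < R.T := by exact_mod_cast R.T₁_pos.trans_le R.T₁_le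

lemma sq_pos (i) : 0 < D.sq i := R.lo_pos.trans_le (R.lo_le i)

lemma hi_pos : 0 < R.hi :=
  (R.sq_pos ⟨0, R.n_pos⟩).trans_le (R.le_hi _)

lemma incr_nonneg (j r i t) : 0 ≤ D.incr j r i t := by
  have h1 := R.n_pos'; have h2 := R.m_pos'; have h3 := R.η_pos
  have h4 := D.g_pos i t; have h5 := R.sq_pos i; have h6 := R.two_lt
  have : 0 ≤ q := by linarith
  unfold Dynamics.incr
  have : 0 ≤ (max 0 (D.u j r i t)) ^ (q - 1) := Real.rpow_nonneg (le_max_left _ _) _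
  positivity

lemma incr_le {c : ℝ} (hc : 0 ≤ c) {j r i t} (hu : D.u j r i t ≤ c) :
    D.incr j r i t ≤ η * q * R.hi / (n * m) * c ^ (q - 1) * D.g i t := by
  have h1 := R.n_pos'; have h2 := R.m_pos'; have h3 := R.η_pos
  have h4 := D.g_pos i t; have h5 := R.sq_pos i; have h6 := R.two_lt
  have hq : 0 < q := by linarith
  have hpow : (max 0 (D.u j r i t)) ^ (q - 1) ≤ c ^ (q - 1) :=
    Real.rpow_le_rpow (le_max_left _ _) (max_le hc hu) (by linarith)
  have hpos : 0 ≤ c ^ (q - 1) := Real.rpow_nonneg hc _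
  unfold Dynamics.incr
  calc η / (n * m) * D.g i t * (q * (max 0 (D.u j r i t)) ^ (q - 1)) * D.sq i
      ≤ η / (n * m) * D.g i t * (q * c ^ (q - 1)) * R.hi := by
        have := R.le_hi i
        gcongr
    _ = _ := by ring

lemma le_incr {c : ℝ} (hc : 0 ≤ c) {gm : ℝ} {j r i t} (hu : c ≤ D.u j r i t)
    (hg : gm ≤ D.g i t) :
    η * R.lo * q * gm * c ^ (q - 1) / (n * m) ≤ D.incr j r i t := by
  have h1 := R.n_pos'; have h2 := R.m_pos'; have h3 := R.η_pos
  have h5 := R.lo_pos; have h6 := R.two_lt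
  have hq : 0 < q := by linarith
  have hpow : c ^ (q - 1) ≤ (max 0 (D.u j r i t)) ^ (q - 1) :=
    Real.rpow_le_rpow hc (hu.trans (le_max_right _ _)) (by linarith)
  have hpos : 0 ≤ c ^ (q - 1) := Real.rpow_nonneg hc _
  unfold Dynamics.incr
  calc η * R.lo * q * gm * c ^ (q - 1) / (n * m)
      = η / (n * m) * gm * (q * c ^ (q - 1)) * R.lo := by ring
    _ ≤ _ := by
        have := R.lo_le i
        have hg' := D.g_pos i t
        have : 0 ≤ max 0 (D.u j r i t) ^ (q - 1) := hpos.trans hpow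
        gcongr

lemma Φ_mono {j i} (h : j = D.y i) (r) : Monotone (D.Φ j r i) := by
  refine monotone_nat_of_le_succ fun t => ?_
  rw [Φ_succ_of_eq h]; linarith [R.incr_nonneg j r i t]

lemma Φ_nonneg {j i} (h : j = D.y i) (r t) : 0 ≤ D.Φ j r i t := by
  have := R.Φ_mono h r (Nat.zero_le t); rwa [D.Φ_zero] at this

lemma Φ_anti {j i} (h : j ≠ D.y i) (r) : Antitone (D.Φ j r i) := by
  refine antitone_nat_of_succ_le fun t => ?_
  rw [Φ_succ_of_ne h]; linarith [R.incr_nonneg j r i t]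

lemma Φ_nonpos {j i} (h : j ≠ D.y i) (r t) : D.Φ j r i t ≤ 0 := by
  have := R.Φ_anti h r (Nat.zero_le t); rwa [D.Φ_zero] at this

lemma abs_Φ_mono (j r i) : Monotone fun t => |D.Φ j r i t| := by
  intro a b hab
  by_cases h : j = D.y i
  · simp only [abs_of_nonneg (R.Φ_nonneg h r _)]; exact R.Φ_mono h r hab
  · simp only [abs_of_nonpos (R.Φ_nonpos h r _)]; exact neg_le_neg (R.Φ_anti h r hab)

lemma size_mono (i) : Monotone (D.size i) := fun _ _ hab =>
  powMean_mono (by linarith [R.two_lt]) fun r => R.abs_Φ_mono _ r i hab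

lemma Γ_mono (j r) : Monotone (D.Γ j r) := by
  refine monotone_nat_of_le_succ fun t => ?_
  rw [D.Γ_succ]
  have h1 := R.n_pos'; have h2 := R.m_pos'; have h3 := R.η_pos
  have h6 := R.two_lt
  have hq : 0 ≤ q := by linarith
  have : 0 ≤ ∑ i, D.g i t * (q * (max 0 (sgn (D.y i) * D.s j r t)) ^ (q - 1)) :=
    Finset.sum_nonneg fun i _ => mul_nonneg (D.g_pos i t).le
      (mul_nonneg hq (Real.rpow_nonneg (le_max_left _ _) _))
  have : 0 ≤ η / (n * m) * (∑ i, D.g i t * (q * (max 0 (sgn (D.y i) * D.s j r t)) ^ (q - 1)))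
    * V ^ 2 := by positivity
  linarith

lemma Γ_nonneg (j r t) : 0 ≤ D.Γ j r t := by
  have := R.Γ_mono j r (Nat.zero_le t); rwa [D.Γ_zero] at this

/-- The bounds that persist along the trajectory. -/
structure Inv (t : ℕ) : Prop where
  size_le : ∀ i, D.size i t ≤ R.θ + 1 + t / R.T
  wrong : ∀ j r i, j ≠ D.y i → |D.Φ j r i t| ≤ 1
  signal : ∀ j r, D.Γ j r t ≤ R.Γm

section Consequences

variable {R} {t : ℕ}

lemma Inv.size_le' (h : R.Inv t) (ht : t ≤ R.T) (i) : D.size i t ≤ R.θ + 2 := by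
  have h1 := h.size_le i
  have : (t : ℝ) / R.T ≤ 1 := by
    rw [div_le_one R.T_pos']; exact_mod_cast ht
  linarith

lemma Inv.abs_Φ_le (h : R.Inv t) (ht : t ≤ R.T) (j r i) : |D.Φ j r i t| ≤ m * (R.θ + 3) := by
  have hm : (1 : ℝ) ≤ m := by exact_mod_cast R.m_pos
  have hθ := R.two_le_θ
  by_cases hj : j = D.y i
  · subst hj
    refine (abs_le_mul_powMean (q := q) R.m_pos (by linarith [R.two_lt])
      (fun r => D.Φ (D.y i) r i t) r).trans ?_
    refine mul_le_mul_of_nonneg_left (le_trans (h.size_le' ht i) ?_) (by linarith)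
    linarith
  · refine (h.wrong j r i hj).trans ?_
    nlinarith

lemma sum_abs_Φ_le (h : R.Inv t) (ht : t ≤ R.T) (j i) :
    ∑ r, |D.Φ j r i t| ≤ m * (R.θ + 3) := by
  have hm : (1 : ℝ) ≤ m := by exact_mod_cast R.m_pos
  have hθ := R.two_le_θ
  by_cases hj : j = D.y i
  · subst hj
    refine (sum_abs_le_mul_powMean (q := q) R.m_pos (by linarith [R.two_lt])
      (fun r => D.Φ (D.y i) r i t)).trans ?_
    refine mul_le_mul_of_nonneg_left (le_trans (h.size_le' ht i) ?_) (by linarith)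
    linarith
  · calc ∑ r, |D.Φ j r i t| ≤ ∑ _r : Fin m, (1 : ℝ) :=
          Finset.sum_le_sum fun r _ => h.wrong j r i hj
      _ = m := by simp
      _ ≤ _ := by nlinarith

omit R in
/-- The contribution of the other data noises to the inner product of a filter with `ξ_i`. -/
lemma abs_cross_le (R : Regime D) (t : ℕ) (j r i) :
    |∑ i', D.Φ j r i' t * D.corr i' i - D.Φ j r i t| ≤ (∑ i', |D.Φ j r i' t|) * R.τ := by
  have h1 : ∑ i', D.Φ j r i' t * D.corr i' i - D.Φ j r i t
      = ∑ i' ∈ Finset.univ.erase i, D.Φ j r i' t * D.corr i' i := by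
    rw [← Finset.add_sum_erase _ _ (Finset.mem_univ i), R.corr_self]; ring
  rw [h1, Finset.sum_mul]
  refine (Finset.abs_sum_le_sum_abs _ _).trans ?_
  refine (Finset.sum_le_sum (g := fun i' => |D.Φ j r i' t| * R.τ) fun i' hi' => ?_).trans
    (Finset.sum_le_sum_of_subset_of_nonneg (Finset.subset_univ _) fun i' _ _ =>
      mul_nonneg (abs_nonneg _) R.τ_nonneg)
  rw [abs_mul]
  exact mul_le_mul_of_nonneg_left (R.corr_le _ _ (Finset.ne_of_mem_erase hi')) (abs_nonneg _)

/-- The inner product with a data noise is the corresponding coefficient, up to a small error. -/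
lemma Inv.abs_u_sub_le (h : R.Inv t) (ht : t ≤ R.T) (j r i) :
    |D.u j r i t - D.Φ j r i t| ≤ 1 / 4 := by
  have h1 := R.abs_cross_le t j r i
  have h2 : (∑ i', |D.Φ j r i' t|) * R.τ ≤ n * (m * (R.θ + 3)) * R.τ := by
    refine mul_le_mul_of_nonneg_right ?_ R.τ_nonneg
    calc ∑ i', |D.Φ j r i' t| ≤ ∑ _i' : Fin n, (m * (R.θ + 3)) :=
          Finset.sum_le_sum fun i' _ => h.abs_Φ_le ht j r i'
      _ = _ := by simp
  have h3 := R.u₀_le j r i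
  have h4 := R.νξ_le i t ht
  have h5 := R.fluct
  rw [D.u_eq]
  rw [abs_le] at *
  constructor <;> linarith [h1.1, h1.2, h3.1, h3.2, h4.1, h4.2]

lemma Inv.abs_s_le (h : R.Inv t) (ht : t ≤ R.T) (j r) : |D.s j r t| ≤ 3 * R.B := by
  have h1 := R.s₀_le j r
  have h2 := R.νv_le t ht
  have h3 := h.signal j r
  have h4 := R.Γm_le
  have h5 := R.Γ_nonneg j r t
  rw [D.s_eq]
  rw [abs_le] at *
  cases j <;> simp only [sgn] <;> constructor <;> simp <;> linarith [h1.1, h1.2, h2.1, h2.2]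

lemma Inv.act_signal_le (h : R.Inv t) (ht : t ≤ R.T) (i j r) :
    act q (sgn (D.y i) * D.s j r t) ≤ 1 / 2 := by
  refine (act_le (by linarith [R.two_lt]) (by linarith [R.B_nonneg]) ?_).trans R.signal
  have := h.abs_s_le ht j r
  rw [abs_le] at this
  cases D.y i <;> simp [sgn] <;> linarith [this.1, this.2]

lemma Inv.abs_pos_sub_le (h : R.Inv t) (ht : t ≤ R.T) (i r) :
    |max 0 (D.u (D.y i) r i t) - D.Φ (D.y i) r i t| ≤ 1 / 4 := by
  have h1 := h.abs_u_sub_le ht (D.y i) r i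
  have h2 := R.Φ_nonneg rfl r t (i := i)
  rw [abs_le] at *
  rcases max_cases 0 (D.u (D.y i) r i t) with h3 | h3 <;> rw [h3.1] <;> constructor <;>
    linarith [h1.1, h1.2]

/-- A large normalized `ℓ_q` norm forces a large margin: the signal and the filters of the wrong
sign contribute at most `1`. -/
lemma Inv.le_margin (h : R.Inv t) (ht : t ≤ R.T) {i} {c : ℝ} (hc : 1 / 4 ≤ c)
    (hs : c ≤ D.size i t) : (c - 1 / 4) ^ q - 1 ≤ D.margin i t := by
  have hq : 0 < q := by linarith [R.two_lt]
  have h1 : D.size i t ≤ powMean q (fun r => max 0 (D.u (D.y i) r i t)) + 1 / 4 :=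
    powMean_le_add_of_abs_sub_le R.m_pos (by linarith [R.two_lt]) fun r => by
      rw [abs_sub_comm]; exact h.abs_pos_sub_le ht i r
  have h2 : (c - 1 / 4) ^ q ≤ 1 / (m : ℝ) * ∑ r, act q (D.u (D.y i) r i t) := by
    rw [avg_act_eq hq]
    exact Real.rpow_le_rpow (by linarith) (by linarith) hq.le
  have h3 : 1 / (m : ℝ) * ∑ r, (act q (sgn (D.y i) * D.s (!D.y i) r t)
      + act q (D.u (!D.y i) r i t)) ≤ 1 := by
    refine avg_le R.m_pos fun r => ?_
    have h4 := h.act_signal_le ht i (!D.y i) r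
    have hne : (!D.y i) ≠ D.y i := by cases D.y i <;> simp
    have h5 := h.abs_u_sub_le ht (!D.y i) r i
    have h6 := R.Φ_nonpos hne r t
    have h7 : act q (D.u (!D.y i) r i t) ≤ (1 / 4 : ℝ) ^ q :=
      act_le hq.le (by norm_num) (by rw [abs_le] at h5; linarith [h5.2])
    have h8 : (1 / 4 : ℝ) ^ q ≤ (1 / 4 : ℝ) ^ (1 : ℝ) :=
      Real.rpow_le_rpow_of_exponent_ge (by norm_num) (by norm_num) (by linarith [R.two_lt])
    rw [Real.rpow_one] at h8
    linarith
  have h4 : 1 / (m : ℝ) * ∑ r, act q (D.u (D.y i) r i t) ≤ 1 / (m : ℝ) * ∑ r,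
      (act q (sgn (D.y i) * D.s (D.y i) r t) + act q (D.u (D.y i) r i t)) :=
    mul_le_mul_of_nonneg_left (Finset.sum_le_sum fun r _ => by
      linarith [act_nonneg (q := q) (sgn (D.y i) * D.s (D.y i) r t)]) (by positivity)
  rw [D.margin_eq]
  linarith

lemma Inv.margin_le (h : R.Inv t) (ht : t ≤ R.T) {i} {c : ℝ} (hs : D.size i t ≤ c) :
    D.margin i t ≤ (c + 1) ^ q + 1 := by
  have hq : 0 < q := by linarith [R.two_lt]
  have h1 : powMean q (fun r => max 0 (D.u (D.y i) r i t)) ≤ D.size i t + 1 / 4 :=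
    powMean_le_add_of_abs_sub_le R.m_pos (by linarith [R.two_lt]) fun r =>
      h.abs_pos_sub_le ht i r
  have h2 : 1 / (m : ℝ) * ∑ r, act q (D.u (D.y i) r i t) ≤ (c + 1) ^ q := by
    rw [avg_act_eq hq]
    exact Real.rpow_le_rpow (powMean_nonneg _) (by linarith) hq.le
  have h3 : 1 / (m : ℝ) * ∑ r, act q (sgn (D.y i) * D.s (D.y i) r t) ≤ 1 / 2 :=
    avg_le R.m_pos fun r => h.act_signal_le ht i _ r
  have h4 : 0 ≤ 1 / (m : ℝ) * ∑ r, (act q (sgn (D.y i) * D.s (!D.y i) r t)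
      + act q (D.u (!D.y i) r i t)) :=
    mul_nonneg (by positivity) (Finset.sum_nonneg fun r _ => add_nonneg (act_nonneg _)
      (act_nonneg _))
  rw [D.margin_eq, Finset.sum_add_distrib, mul_add]
  linarith

/-- One step increases the size of a sample by at most a fraction of `g`. -/
lemma Inv.size_succ_le (h : R.Inv t) (ht : t ≤ R.T) (i) :
    D.size i (t + 1) ≤ D.size i t + D.g i t / 4 := by
  have hq : 0 < q := by linarith [R.two_lt]
  have hn := R.n_pos'; have hm := R.m_pos'; have hη := R.η_pos; have hhi := R.hi_pos
  have hm1 : (1 : ℝ) ≤ m := by exact_mod_cast R.m_pos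
  have hθ := R.two_le_θ
  refine powMean_le_add_of_abs_sub_le R.m_pos (by linarith [R.two_lt]) fun r => ?_
  rw [Φ_succ_of_eq rfl, add_sub_cancel_left, abs_of_nonneg (R.incr_nonneg _ _ _ _)]
  -- a single coefficient may exceed the mean by `m ^ (1 / q)`; since `(q - 1) / q ≤ 1`, this loss
  -- is compensated by the factor `1 / m` of the gradient
  set M : ℝ := (m : ℝ) ^ (1 / q) with hM
  have hM1 : 1 ≤ M := Real.one_le_rpow hm1 (by positivity)
  have hu : D.u (D.y i) r i t ≤ M * (R.θ + 3) := by
    have h1 := abs_le_rpow_mul_powMean R.m_pos hq (fun r => D.Φ (D.y i) r i t) r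
    have h2 := h.size_le' ht i
    have h3 := h.abs_u_sub_le ht (D.y i) r i
    have h4 := le_abs_self (D.Φ (D.y i) r i t)
    rw [abs_le] at h3
    have h5 : M * D.size i t ≤ M * (R.θ + 2) := mul_le_mul_of_nonneg_left h2 (by linarith)
    have h6 : |D.Φ (D.y i) r i t| ≤ M * D.size i t := h1
    linarith [h3.2]
  refine (R.incr_le (by positivity) hu).trans ?_
  have hMq : M ^ (q - 1) ≤ m := by
    rw [hM, ← Real.rpow_mul hm.le]
    refine natCast_rpow_le_self R.m_pos ?_
    rw [one_div, inv_mul_le_iff₀ hq]; linarith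
  rw [Real.mul_rpow (by linarith) (by linarith)]
  have hpos : 0 ≤ (R.θ + 3) ^ (q - 1) := Real.rpow_nonneg (by linarith) _
  have hg := (D.g_pos i t).le
  calc η * q * R.hi / (n * m) * (M ^ (q - 1) * (R.θ + 3) ^ (q - 1)) * D.g i t
      ≤ η * q * R.hi / (n * m) * (m * (R.θ + 3) ^ (q - 1)) * D.g i t := by gcongr
    _ = η * q * R.hi * (R.θ + 3) ^ (q - 1) / n * D.g i t := by field_simp
    _ ≤ 1 / 4 * D.g i t := mul_le_mul_of_nonneg_right R.step hg
    _ = _ := by ring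

/-- Above the threshold `θ` the size grows by at most `1 / T` in a step. -/
lemma Inv.size_le_succ (h : R.Inv t) (ht : t < R.T) (i) :
    D.size i (t + 1) ≤ R.θ + 1 + ((t + 1 : ℕ) : ℝ) / R.T := by
  have h1 := h.size_succ_le ht.le i
  have h2 := D.g_le_one i t
  have hT := R.T_pos'
  have hθ := R.two_le_θ
  rcases le_or_gt (D.size i t) R.θ with h3 | h3
  · have : (0 : ℝ) ≤ ((t + 1 : ℕ) : ℝ) / R.T := by positivity
    linarith
  · have h4 := h.le_margin ht.le (c := R.θ) (by linarith) h3.le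
    have h5 : R.θ - 1 / 4 ≤ (R.θ - 1 / 4) ^ q := by
      conv_lhs => rw [← Real.rpow_one (R.θ - 1 / 4)]
      exact Real.rpow_le_rpow_of_exponent_le (by linarith) (by linarith [R.two_lt])
    have h6 : D.g i t ≤ Real.exp (2 - R.θ) :=
      (D.g_le_exp i t).trans (Real.exp_le_exp.mpr (by linarith))
    have h7 : D.g i t ≤ 1 / R.T := by
      rw [le_div_iff₀ hT]
      nlinarith [R.horizon]
    have h8 := h.size_le i
    have h9 := D.g_pos i t
    push_cast
    rw [add_div]
    linarith

/-- A coefficient of the wrong sign moves only while the inner product is positive.  Then it is at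
least `-1 / 4`, and a step is at most `1 / 4`, so that it never drops below `-1`. -/
lemma Inv.wrong_succ (h : R.Inv t) (ht : t ≤ R.T) {j i} (hj : j ≠ D.y i) (r) :
    |D.Φ j r i (t + 1)| ≤ 1 := by
  have hn := R.n_pos'; have hm := R.m_pos'; have hη := R.η_pos; have hhi := R.hi_pos
  have hm1 : (1 : ℝ) ≤ m := by exact_mod_cast R.m_pos
  have hq : 0 < q := by linarith [R.two_lt]
  have h0 := R.Φ_nonpos hj r (t + 1)
  have h1 := h.abs_u_sub_le ht j r i
  have h2 := R.Φ_nonpos hj r t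
  have h3 := h.wrong j r i hj
  rw [abs_le] at h1 h3
  rw [abs_of_nonpos h0, Φ_succ_of_ne hj]
  have h4 : D.incr j r i t ≤ η * q * R.hi / (n * m) * (1 : ℝ) ^ (q - 1) * D.g i t :=
    R.incr_le zero_le_one (by linarith [h1.2])
  have h5 : D.incr j r i t ≤ 1 / 4 := by
    refine h4.trans ?_
    rw [Real.one_rpow, mul_one]
    have h6 : (1 : ℝ) ≤ (R.θ + 3) ^ (q - 1) :=
      Real.one_le_rpow (by linarith [R.two_le_θ]) (by linarith [R.two_lt])
    have hg := D.g_le_one i t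
    have hg' := (D.g_pos i t).le
    calc η * q * R.hi / (n * m) * D.g i t ≤ η * q * R.hi / (n * 1) * 1 := by gcongr
      _ = η * q * R.hi * 1 / n := by ring
      _ ≤ η * q * R.hi * (R.θ + 3) ^ (q - 1) / n := by gcongr
      _ ≤ _ := R.step
  rcases le_or_gt (D.u j r i t) 0 with hu | hu
  · have : D.incr j r i t = 0 := by
      unfold Dynamics.incr
      rw [max_eq_left hu, Real.zero_rpow (by linarith [R.two_lt])]; ring
    rw [this]; linarith [h3.1]
  · linarith [h1.2]

end Consequences

end Regime
end PrivateCNN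

/-! ### Growth, saturation and summability of the loss derivatives -/

namespace PrivateCNN

namespace Regime

open PrivateCNN.Dynamics

variable {n m : ℕ} {q η V : ℝ} {D : Dynamics n m q η V} {R : Regime D}

/-- Every sample has a filter that starts with a large inner product and receives little
interference from the other samples up to time `T₁`.  The interference is small only on average
over the filters, so it has to be played off against the number of good initial filters. -/
lemma Inv.exists_seed (h : R.Inv R.T₁) (i : Fin n) :
    ∃ r, R.α ≤ D.u₀ (D.y i) r i ∧ (∑ i', |D.Φ (D.y i) r i' R.T₁|) * R.τ ≤ R.α / 4 := by
  by_contra! hcon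
  set S := Finset.univ.filter fun r => R.α ≤ D.u₀ (D.y i) r i with hS
  have h1 : (S.card : ℝ) * (R.α / 4) ≤ ∑ r ∈ S, (∑ i', |D.Φ (D.y i) r i' R.T₁|) * R.τ := by
    rw [← nsmul_eq_mul]
    refine Finset.card_nsmul_le_sum _ _ _ fun r hr => ?_
    exact (hcon r (by simpa [hS] using hr)).le
  have h2 : ∑ r ∈ S, (∑ i', |D.Φ (D.y i) r i' R.T₁|) * R.τ
      ≤ ∑ r, (∑ i', |D.Φ (D.y i) r i' R.T₁|) * R.τ :=
    Finset.sum_le_sum_of_subset_of_nonneg (Finset.subset_univ _) fun r _ _ =>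
      mul_nonneg (Finset.sum_nonneg fun _ _ => abs_nonneg _) R.τ_nonneg
  have h3 : ∑ r, (∑ i', |D.Φ (D.y i) r i' R.T₁|) * R.τ ≤ n * (m * (R.θ + 3)) * R.τ := by
    rw [← Finset.sum_mul, Finset.sum_comm]
    refine mul_le_mul_of_nonneg_right ?_ R.τ_nonneg
    calc ∑ i', ∑ r, |D.Φ (D.y i) r i' R.T₁| ≤ ∑ _i' : Fin n, (m * (R.θ + 3)) :=
          Finset.sum_le_sum fun i' _ => sum_abs_Φ_le h R.T₁_le (D.y i) i'
      _ = _ := by simp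
  have h4 := R.seeds i
  have h5 := mul_le_mul_of_nonneg_right h4 (show 0 ≤ R.α / 4 by linarith [R.α_pos])
  have h6 := mul_lt_mul_of_pos_right R.interference R.m_pos'
  nlinarith

/-- At time `t₁` every sample has a coefficient of size at least `2`.  Otherwise the loss derivative
stays bounded below, and the quantity `α / 2 + Φ` of a seed grows geometrically. -/
lemma exists_two_le (hInv : ∀ s ≤ R.T₁, R.Inv s) (i : Fin n) :
    ∃ r, 2 ≤ D.Φ (D.y i) r i R.t₁ := by
  by_contra! hcon
  have hn := R.n_pos'; have hm := R.m_pos'; have hη := R.η_pos; have hlo := R.lo_pos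
  have hα := R.α_pos; have h2q := R.two_lt
  have hq : 0 < q := by linarith
  obtain ⟨r, hr1, hr2⟩ := (hInv _ le_rfl).exists_seed i
  have hα1 : R.α / 2 ≤ 1 := by
    have h1 := R.u₀_le (D.y i) r i
    have h2 := R.fluct
    have h3 : 0 ≤ (n : ℝ) * (m * (R.θ + 3)) * R.τ := by
      have := R.two_le_θ; have := R.τ_nonneg; positivity
    rw [abs_le] at h1
    linarith [h1.2]
  set gm : ℝ := Real.exp (-(3 ^ q + 1)) / 2 with hgm
  have hgm0 : 0 < gm := by positivity
  have hg : ∀ s ≤ R.t₁, gm ≤ D.g i s := by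
    intro s hs
    -- by monotonicity no coefficient has reached `2` before `t₁`, so the sample is not fitted
    have hsize : D.size i s ≤ 2 := powMean_le_of_forall_le R.m_pos hq fun r' => by
      rw [abs_of_nonneg (R.Φ_nonneg rfl r' s)]
      exact (R.Φ_mono rfl r' hs).trans (hcon r').le
    have hmar := (hInv s (hs.trans R.t₁_le)).margin_le ((hs.trans R.t₁_le).trans R.T₁_le) hsize
    norm_num at hmar
    exact D.le_g (by positivity) hmar
  have hu : ∀ s ≤ R.t₁, R.α / 2 + D.Φ (D.y i) r i s ≤ D.u (D.y i) r i s := by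
    intro s hs
    have h1 := R.abs_cross_le s (D.y i) r i
    have h2 : (∑ i', |D.Φ (D.y i) r i' s|) * R.τ ≤ (∑ i', |D.Φ (D.y i) r i' R.T₁|) * R.τ :=
      mul_le_mul_of_nonneg_right (Finset.sum_le_sum fun i' _ =>
        R.abs_Φ_mono (D.y i) r i' (hs.trans R.t₁_le)) R.τ_nonneg
    have h3 := R.νξ_le_early i s (hs.trans R.t₁_le)
    rw [abs_le] at h1 h3
    rw [D.u_eq]
    linarith [h1.1, h3.2]
  set lam : ℝ := η * R.lo * q * gm * (R.α / 2) ^ (q - 2) / (n * m) with hlam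
  have hlam0 : 0 ≤ lam := by
    have : 0 ≤ (R.α / 2) ^ (q - 2) := by positivity
    positivity
  have key : ∀ s ≤ R.t₁, R.α / 2 * (1 + lam) ^ s ≤ R.α / 2 + D.Φ (D.y i) r i s := by
    intro s
    induction s with
    | zero => intro _; simp [D.Φ_zero]
    | succ s ih =>
      intro hs
      have hs' : s ≤ R.t₁ := by omega
      have ih := ih hs'
      set x := R.α / 2 + D.Φ (D.y i) r i s with hx
      have hΦ0 := R.Φ_nonneg rfl r s (i := i)
      have hx0 : 0 < x := by linarith
      have h1 : η * R.lo * q * gm * x ^ (q - 1) / (n * m) ≤ D.incr (D.y i) r i s :=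
        R.le_incr hx0.le (hu s hs') (hg s hs')
      have h2 : x ^ (q - 1) = x ^ (q - 2) * x := by
        rw [← Real.rpow_add_one hx0.ne']; congr 1; ring
      have h3 : (R.α / 2) ^ (q - 2) ≤ x ^ (q - 2) :=
        Real.rpow_le_rpow (by linarith) (by linarith) (by linarith)
      have h4 : lam * x ≤ η * R.lo * q * gm * x ^ (q - 1) / (n * m) := by
        rw [h2, hlam]
        calc η * R.lo * q * gm * (R.α / 2) ^ (q - 2) / (n * m) * x
            = η * R.lo * q * gm * ((R.α / 2) ^ (q - 2) * x) / (n * m) := by ring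
          _ ≤ _ := by gcongr
      rw [Φ_succ_of_eq rfl, pow_succ]
      have h5 : R.α / 2 * (1 + lam) ^ s * (1 + lam) ≤ x * (1 + lam) :=
        mul_le_mul_of_nonneg_right ih (by linarith)
      linarith
  have h1 := key R.t₁ le_rfl
  have h2 := R.growth_early
  have h3 := hcon r
  linarith

/-- At time `T₁` the coefficients of every sample have reached the size `G`.  Otherwise the
coefficient that is at least `2` at time `t₁` grows geometrically beyond `m * G`. -/
lemma G_le_size (hInv : ∀ s ≤ R.T₁, R.Inv s) (i : Fin n) : R.G ≤ D.size i R.T₁ := by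
  by_contra! hcon
  have hn := R.n_pos'; have hm := R.m_pos'; have hη := R.η_pos; have hlo := R.lo_pos
  have h2q := R.two_lt
  have hG := R.two_le_G
  have hq : 0 < q := by linarith
  obtain ⟨r, hr⟩ := exists_two_le hInv i
  set gm : ℝ := Real.exp (-((R.G + 1) ^ q + 1)) / 2 with hgm
  have hgm0 : 0 < gm := by positivity
  have hg : ∀ s ≤ R.T₁, gm ≤ D.g i s := by
    intro s hs
    have hsize : D.size i s ≤ R.G := (R.size_mono i hs).trans hcon.le
    have hmar := (hInv s hs).margin_le (hs.trans R.T₁_le) hsize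
    exact D.le_g (by positivity) hmar
  set lam : ℝ := η * R.lo * q * gm / (2 * (n * m)) with hlam
  have hlam0 : 0 ≤ lam := by positivity
  have key : ∀ k, R.t₁ + k ≤ R.T₁ → 2 * (1 + lam) ^ k ≤ D.Φ (D.y i) r i (R.t₁ + k) := by
    intro k
    induction k with
    | zero => intro _; simpa using hr
    | succ k ih =>
      intro hs
      have hs' : R.t₁ + k ≤ R.T₁ := by omega
      have ih := ih hs'
      have hΦ2 : 2 ≤ D.Φ (D.y i) r i (R.t₁ + k) :=
        hr.trans (R.Φ_mono rfl r (Nat.le_add_right _ _))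
      rw [← add_assoc, Φ_succ_of_eq rfl]
      set x := D.Φ (D.y i) r i (R.t₁ + k) with hx
      have hu := (hInv _ hs').abs_u_sub_le (hs'.trans R.T₁_le) (D.y i) r i
      rw [abs_le] at hu
      have h1 : η * R.lo * q * gm * (x / 2) ^ (q - 1) / (n * m) ≤ D.incr (D.y i) r i (R.t₁ + k) :=
        R.le_incr (by linarith) (by linarith [hu.1]) (hg _ hs')
      have h2 : x / 2 ≤ (x / 2) ^ (q - 1) := by
        conv_lhs => rw [← Real.rpow_one (x / 2)]
        exact Real.rpow_le_rpow_of_exponent_le (by linarith) (by linarith)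
      have h4 : lam * x ≤ η * R.lo * q * gm * (x / 2) ^ (q - 1) / (n * m) := by
        rw [hlam]
        calc η * R.lo * q * gm / (2 * (n * m)) * x
            = η * R.lo * q * gm * (x / 2) / (n * m) := by field_simp
          _ ≤ _ := by gcongr
      rw [pow_succ]
      have h5 : 2 * (1 + lam) ^ k * (1 + lam) ≤ x * (1 + lam) :=
        mul_le_mul_of_nonneg_right ih (by linarith)
      linarith
  have h1 := key (R.T₁ - R.t₁) (by have := R.t₁_le; omega)
  rw [Nat.add_sub_cancel' R.t₁_le] at h1
  have h2 := R.growth_late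
  have h3 := abs_le_mul_powMean (q := q) R.m_pos (by linarith) (fun r => D.Φ (D.y i) r i R.T₁) r
  have h4 : (m : ℝ) * D.size i R.T₁ ≤ m * R.G := mul_le_mul_of_nonneg_left hcon.le hm.le
  have h5 := le_abs_self (D.Φ (D.y i) r i R.T₁)
  have h6 : |D.Φ (D.y i) r i R.T₁| ≤ m * D.size i R.T₁ := h3
  linarith

/-- After time `T₁` the loss derivatives of a sample are summable, with the bound given by the
growth of the potential `∑_r Φ_r²`. -/
lemma sum_g_le {t : ℕ} (hInv : ∀ s < t, R.Inv s) (ht : t ≤ R.T) {i : Fin n}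
    (hsize : D.size i t ≤ R.θ + 2) :
    ∑ s ∈ Finset.Ico R.T₁ t, D.g i s ≤ n * m * ((R.θ + 2) ^ q + 1) / (2 * η * q * R.lo) := by
  have hn := R.n_pos'; have hm := R.m_pos'; have hη := R.η_pos; have hlo := R.lo_pos
  have h2q := R.two_lt
  have hθ := R.two_le_θ
  have hq : 0 < q := by linarith
  rcases le_or_gt t R.T₁ with htT | htT
  · rw [Finset.Ico_eq_empty (by omega), Finset.sum_empty]
    have : 0 ≤ (R.θ + 2) ^ q := by positivity
    positivity
  have hG : R.G ≤ D.size i R.T₁ := G_le_size (fun s hs => hInv s (by omega)) i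
  -- a step adds at least `2 * Φ * incr` to the potential, which is a multiple of the loss derivative
  -- because the mean of `(Φ - 1 / 4)₊ ^ q` over the filters is at least `1`
  have key : ∀ t', R.T₁ ≤ t' → t' ≤ t →
      2 * η * q * R.lo / n * ∑ s ∈ Finset.Ico R.T₁ t', D.g i s
        ≤ ∑ r, D.Φ (D.y i) r i t' ^ 2 := by
    intro t' ht'
    induction t', ht' using Nat.le_induction with
    | base => intro _; simp; positivity
    | succ s hs ih =>
      intro hst
      have ih := ih (by omega)
      have hI := hInv s (by omega)
      have hsT : s ≤ R.T := by omega
      rw [Finset.sum_Ico_succ_top hs, mul_add]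
      have hstep : ∀ r, D.Φ (D.y i) r i s ^ 2 + 2 * η * q * R.lo / (n * m) * D.g i s
          * |max 0 (D.Φ (D.y i) r i s - 1 / 4)| ^ q ≤ D.Φ (D.y i) r i (s + 1) ^ 2 := by
        intro r
        rw [Φ_succ_of_eq rfl, abs_of_nonneg (le_max_left _ _)]
        set x := D.Φ (D.y i) r i s with hx
        have hx0 : 0 ≤ x := R.Φ_nonneg rfl r s
        have hinc := R.incr_nonneg (D.y i) r i s
        have hg := D.g_pos i s
        rcases le_or_gt x (1 / 4) with hx4 | hx4
        · rw [max_eq_left (by linarith), Real.zero_rpow hq.ne', mul_zero, add_zero]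
          exact pow_le_pow_left₀ hx0 (by linarith) 2
        · rw [max_eq_right (by linarith)]
          have hu := hI.abs_u_sub_le hsT (D.y i) r i
          rw [abs_le] at hu
          have h1 : η * R.lo * q * D.g i s * (x - 1 / 4) ^ (q - 1) / (n * m)
              ≤ D.incr (D.y i) r i s :=
            R.le_incr (by linarith) (by linarith [hu.1]) le_rfl
          have h2 : (x - 1 / 4) ^ q = (x - 1 / 4) ^ (q - 1) * (x - 1 / 4) := by
            rw [← Real.rpow_add_one (by linarith : x - 1 / 4 ≠ 0)]; congr 1; ring
          have h3 : 0 ≤ (x - 1 / 4) ^ (q - 1) := Real.rpow_nonneg (by linarith) _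
          have h4 : 2 * η * q * R.lo / (n * m) * D.g i s * (x - 1 / 4) ^ q
              = 2 * (x - 1 / 4) * (η * R.lo * q * D.g i s * (x - 1 / 4) ^ (q - 1) / (n * m)) := by
            rw [h2]; ring
          have h5 : 2 * (x - 1 / 4) * (η * R.lo * q * D.g i s * (x - 1 / 4) ^ (q - 1) / (n * m))
              ≤ 2 * x * D.incr (D.y i) r i s := by
            have h0 : 0 ≤ η * R.lo * q * D.g i s * (x - 1 / 4) ^ (q - 1) / (n * m) := by
              positivity
            exact mul_le_mul (by linarith) h1 h0 (by linarith)
          rw [h4]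
          nlinarith [sq_nonneg (D.incr (D.y i) r i s)]
      have hsum := Finset.sum_le_sum fun r (_ : r ∈ Finset.univ) => hstep r
      rw [Finset.sum_add_distrib, ← Finset.mul_sum] at hsum
      have hlow : (1 : ℝ) ≤ 1 / (m : ℝ) * ∑ r, |max 0 (D.Φ (D.y i) r i s - 1 / 4)| ^ q := by
        rw [← powMean_rpow hq]
        have h1 : D.size i s ≤ powMean q (fun r => max 0 (D.Φ (D.y i) r i s - 1 / 4)) + 1 / 4 :=
          powMean_le_add_of_abs_sub_le R.m_pos (by linarith) fun r => by
            have hx0 : 0 ≤ D.Φ (D.y i) r i s := R.Φ_nonneg rfl r s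
            rw [abs_le]
            rcases max_cases 0 (D.Φ (D.y i) r i s - 1 / 4) with h3 | h3 <;> rw [h3.1] <;>
              constructor <;> linarith
        have h2 := R.size_mono i hs
        have h3 := R.two_le_G
        exact Real.one_le_rpow (by linarith) hq.le
      have h7 : 2 * η * q * R.lo / n * D.g i s ≤ 2 * η * q * R.lo / (n * m) * D.g i s
          * ∑ r, |max 0 (D.Φ (D.y i) r i s - 1 / 4)| ^ q := by
        have hg := D.g_pos i s
        calc 2 * η * q * R.lo / n * D.g i s = 2 * η * q * R.lo / n * D.g i s * 1 := by ring
          _ ≤ 2 * η * q * R.lo / n * D.g i s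
              * (1 / (m : ℝ) * ∑ r, |max 0 (D.Φ (D.y i) r i s - 1 / 4)| ^ q) := by gcongr
          _ = _ := by ring
      linarith
  have h1 := key t htT.le le_rfl
  have h2 : ∑ r, D.Φ (D.y i) r i t ^ 2 ≤ m * ((R.θ + 2) ^ q + 1) := by
    have h3 : ∀ r, D.Φ (D.y i) r i t ^ 2 ≤ |D.Φ (D.y i) r i t| ^ q + 1 := by
      intro r
      rw [← sq_abs]
      have h0 := abs_nonneg (D.Φ (D.y i) r i t)
      rcases le_or_gt |D.Φ (D.y i) r i t| 1 with h4 | h4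
      · have : 0 ≤ |D.Φ (D.y i) r i t| ^ q := by positivity
        nlinarith
      · have h5 : |D.Φ (D.y i) r i t| ^ (2 : ℝ) ≤ |D.Φ (D.y i) r i t| ^ q :=
          Real.rpow_le_rpow_of_exponent_le h4.le h2q.le
        rw [Real.rpow_two] at h5
        linarith
    have h4 : D.size i t ^ q ≤ (R.θ + 2) ^ q :=
      Real.rpow_le_rpow (powMean_nonneg _) hsize hq.le
    have h5 : D.size i t ^ q = 1 / (m : ℝ) * ∑ r, |D.Φ (D.y i) r i t| ^ q := powMean_rpow hq _
    calc ∑ r, D.Φ (D.y i) r i t ^ 2 ≤ ∑ r, (|D.Φ (D.y i) r i t| ^ q + 1) :=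
          Finset.sum_le_sum fun r _ => h3 r
      _ = m * (D.size i t ^ q + 1) := by
          rw [h5, Finset.sum_add_distrib]; simp; field_simp
      _ ≤ _ := by gcongr
  rw [le_div_iff₀ (by positivity)]
  have h3 := h1.trans h2
  rw [div_mul_eq_mul_div, div_le_iff₀ hn] at h3
  linarith

/-- The signal coefficients are controlled by the sum of the loss derivatives. -/
lemma Γ_le_sum {t : ℕ} (hInv : ∀ s < t, R.Inv s) (ht : t ≤ R.T) (j r) :
    D.Γ j r t ≤ η * V ^ 2 / (n * m) * (q * (3 * R.B) ^ (q - 1))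
      * ∑ i, ∑ s ∈ Finset.range t, D.g i s := by
  have hn := R.n_pos'; have hm := R.m_pos'; have hη := R.η_pos
  have hB := R.B_nonneg
  have hq : 0 < q := by linarith [R.two_lt]
  induction t with
  | zero => simp [D.Γ_zero]
  | succ t ih =>
    have ih := ih (fun s hs => hInv s (by omega)) (by omega)
    have hI := hInv t (by omega)
    simp only [Finset.sum_range_succ]
    rw [Finset.sum_add_distrib, mul_add, D.Γ_succ]
    refine add_le_add ih ?_
    have h1 : ∑ i, D.g i t * (q * (max 0 (sgn (D.y i) * D.s j r t)) ^ (q - 1))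
        ≤ ∑ i, D.g i t * (q * (3 * R.B) ^ (q - 1)) := by
      refine Finset.sum_le_sum fun i _ => ?_
      refine mul_le_mul_of_nonneg_left (mul_le_mul_of_nonneg_left ?_ hq.le) (D.g_pos i t).le
      refine Real.rpow_le_rpow (le_max_left _ _) (max_le (by positivity) ?_) (by linarith [R.two_lt])
      have h2 := hI.abs_s_le (by omega : t ≤ R.T) j r
      rw [abs_le] at h2
      cases D.y i <;> simp [sgn] <;> linarith [h2.1, h2.2]
    calc η / (n * m) * (∑ i, D.g i t * (q * (max 0 (sgn (D.y i) * D.s j r t)) ^ (q - 1))) * V ^ 2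
        ≤ η / (n * m) * (∑ i, D.g i t * (q * (3 * R.B) ^ (q - 1))) * V ^ 2 := by gcongr
      _ = _ := by rw [← Finset.sum_mul]; ring

/-- The bounds hold along the whole trajectory. -/
theorem inv {t : ℕ} (ht : t ≤ R.T) : R.Inv t := by
  have hn := R.n_pos'; have hm := R.m_pos'; have hη := R.η_pos; have hlo := R.lo_pos
  have hT := R.T_pos'
  have hB := R.B_nonneg
  have hθ := R.two_le_θ
  have hq : 0 < q := by linarith [R.two_lt]
  have hc0 : 0 ≤ η * V ^ 2 / (n * m) * (q * (3 * R.B) ^ (q - 1)) := by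
    have : 0 ≤ (3 * R.B) ^ (q - 1) := by positivity
    positivity
  induction t using Nat.strong_induction_on with
  | _ t ih =>
  have hInv : ∀ s < t, R.Inv s := fun s hs => ih s hs (by omega)
  rcases Nat.eq_zero_or_pos t with rfl | htpos
  · refine ⟨fun i => ?_, fun j r i _ => by simp [D.Φ_zero], fun j r => ?_⟩
    · have : D.size i 0 ≤ 0 := powMean_le_of_forall_le R.m_pos hq fun r => by simp [D.Φ_zero]
      simp only [Nat.cast_zero, zero_div]
      linarith
    · rw [D.Γ_zero]
      refine le_trans ?_ R.signal_growth
      have : 0 ≤ (R.θ + 2) ^ q := by positivity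
      positivity
  obtain ⟨s, rfl⟩ : ∃ s, t = s + 1 := ⟨t - 1, by omega⟩
  have hs := hInv s (by omega)
  have hsize := fun i => hs.size_le_succ (by omega) i
  refine ⟨hsize, fun j r i hj => hs.wrong_succ (by omega) hj r, fun j r => ?_⟩
  refine (Γ_le_sum hInv ht j r).trans (le_trans ?_ R.signal_growth)
  refine mul_le_mul_of_nonneg_left ?_ hc0
  have hone : ∀ i, ∑ s ∈ Finset.range (s + 1), D.g i s
      ≤ R.T₁ + n * m * ((R.θ + 2) ^ q + 1) / (2 * η * q * R.lo) := by
    intro i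
    have h1 : ((s + 1 : ℕ) : ℝ) / R.T ≤ 1 := by
      rw [div_le_one hT]; exact_mod_cast ht
    have h2 := sum_g_le hInv ht (i := i) ((hsize i).trans (by linarith))
    have h3 : ∑ s ∈ Finset.range R.T₁, D.g i s ≤ R.T₁ := by
      calc ∑ s ∈ Finset.range R.T₁, D.g i s ≤ ∑ _s ∈ Finset.range R.T₁, (1 : ℝ) :=
            Finset.sum_le_sum fun s _ => D.g_le_one i s
        _ = R.T₁ := by simp
    have h4 : ∑ s ∈ Finset.range (s + 1), D.g i s
        ≤ ∑ s ∈ Finset.range R.T₁ ∪ Finset.Ico R.T₁ (s + 1), D.g i s := by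
      refine Finset.sum_le_sum_of_subset_of_nonneg (fun x hx => ?_) fun x _ _ => (D.g_pos i x).le
      simp only [Finset.mem_union, Finset.mem_range, Finset.mem_Ico] at *
      omega
    have hdisj : Disjoint (Finset.range R.T₁) (Finset.Ico R.T₁ (s + 1)) := by
      rw [Finset.disjoint_left]
      intro x hx hx'
      simp only [Finset.mem_range, Finset.mem_Ico] at *
      omega
    rw [Finset.sum_union hdisj] at h4
    linarith
  calc ∑ i, ∑ s ∈ Finset.range (s + 1), D.g i s
      ≤ ∑ _i : Fin n, (R.T₁ + n * m * ((R.θ + 2) ^ q + 1) / (2 * η * q * R.lo)) :=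
        Finset.sum_le_sum fun i _ => hone i
    _ = _ := by rw [Finset.sum_const, Finset.card_univ, Fintype.card_fin, nsmul_eq_mul]

/-- Every sample has been memorized at time `T₁`. -/
theorem two_le_Φ (i : Fin n) : ∃ j r, 2 ≤ D.Φ j r i R.T₁ := by
  obtain ⟨r, hr⟩ := exists_two_le (R := R) (fun s hs => inv (hs.trans R.T₁_le)) i
  exact ⟨_, r, hr.trans (R.Φ_mono rfl r R.t₁_le)⟩

/-- From time `T₁` on all margins are large. -/
theorem le_margin {t : ℕ} (h₁ : R.T₁ ≤ t) (ht : t ≤ R.T) (i : Fin n) :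
    (R.G - 1 / 4) ^ q - 1 ≤ D.margin i t :=
  (inv ht).le_margin ht (by linarith [R.two_le_G])
    ((G_le_size (fun _ hs => inv (hs.trans R.T₁_le)) i).trans (R.size_mono i h₁))

end Regime
end PrivateCNN

namespace PrivateCNN

/-! ### The gradient of the empirical risk -/

/-- Polynomial ReLU is differentiable everywhere, also at the kink, because `q > 1`. -/
lemma hasDerivAt_act {q : ℝ} (hq : 1 < q) (z : ℝ) :
    HasDerivAt (act q) (q * (max 0 z) ^ (q - 1)) z := by
  have hne : ∀ x : ℝ, x ≠ 0 → HasDerivAt (act q) (q * (max 0 x) ^ (q - 1)) x := by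
    intro x hx
    rcases lt_or_gt_of_ne hx with h | h
    · rw [max_eq_left h.le, Real.zero_rpow (by linarith), mul_zero]
      refine (hasDerivAt_const x (0 : ℝ)).congr_of_eventuallyEq ?_
      filter_upwards [Iio_mem_nhds h] with w hw
      simp only [act]
      rw [max_eq_left (le_of_lt hw), Real.zero_rpow (by linarith)]
    · rw [max_eq_right h.le]
      refine (Real.hasDerivAt_rpow_const (Or.inl hx)).congr_of_eventuallyEq ?_
      filter_upwards [Ioi_mem_nhds h] with w hw
      simp only [act]
      rw [max_eq_right (le_of_lt hw)]
  rcases eq_or_ne z 0 with rfl | hz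
  · refine hasDerivAt_of_hasDerivAt_of_ne (fun y hy => hne y hy) ?_ ?_
    · exact ((continuous_const.max continuous_id).rpow_const fun _ => Or.inr (by linarith)).continuousAt
    · exact (continuous_const.mul ((continuous_const.max continuous_id).rpow_const
        fun _ => Or.inr (by linarith))).continuousAt
  · exact hne z hz

lemma hasDerivAt_logistic (z : ℝ) : HasDerivAt logistic (-(1 + Real.exp z)⁻¹) z := by
  have h1 : HasDerivAt (fun z : ℝ => 1 + Real.exp (-z)) (-Real.exp (-z)) z := by
    simpa using ((hasDerivAt_neg z).exp).const_add 1
  have h2 := h1.log (by positivity)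
  have h3 : -(1 + Real.exp z)⁻¹ = -Real.exp (-z) / (1 + Real.exp (-z)) := by
    rw [Real.exp_neg]
    field_simp
    ring
  rw [h3]
  exact h2

section Gradient

variable {d n m : ℕ} {q : ℝ}

lemma hasFDerivAt_act_inner (hq : 1 < q) (x w : Vec d) :
    HasFDerivAt (fun w : Vec d => act q (inner ℝ w x))
      ((q * (max 0 (inner ℝ w x)) ^ (q - 1)) • innerSL ℝ x) w := by
  have h1 : HasFDerivAt (fun w : Vec d => inner ℝ w x) (innerSL ℝ x) w := by
    have := (innerSL ℝ x).hasFDerivAt (x := w)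
    refine this.congr_of_eventuallyEq (Filter.Eventually.of_forall fun w => ?_)
    exact real_inner_comm _ _
  exact (hasDerivAt_act hq _).comp_hasFDerivAt w h1

lemma hasFDerivAt_branch_update (hq : 1 < q) (f : Fin m → Vec d) (r : Fin m) (x : Vec d × Vec d) :
    HasFDerivAt (fun w : Vec d => branch q (Function.update f r w) x)
      ((1 / (m : ℝ)) • ((q * (max 0 (inner ℝ (f r) x.1)) ^ (q - 1)) • innerSL ℝ x.1
        + (q * (max 0 (inner ℝ (f r) x.2)) ^ (q - 1)) • innerSL ℝ x.2)) (f r) := by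
  have h1 : (fun w : Vec d => branch q (Function.update f r w) x) = fun w =>
      (1 / (m : ℝ)) * (act q (inner ℝ w x.1) + act q (inner ℝ w x.2)
        + ∑ r' ∈ Finset.univ.erase r, (act q (inner ℝ (f r') x.1) + act q (inner ℝ (f r') x.2))) := by
    funext w
    unfold branch
    rw [← Finset.add_sum_erase _ _ (Finset.mem_univ r), Function.update_self]
    congr 2
    refine Finset.sum_congr rfl fun r' hr' => ?_
    rw [Function.update_of_ne (Finset.ne_of_mem_erase hr')]
  rw [h1]
  exact (((hasFDerivAt_act_inner hq x.1 (f r)).add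
    (hasFDerivAt_act_inner hq x.2 (f r))).add_const _).const_mul _

lemma hasFDerivAt_net_update (hq : 1 < q) (W : Weights d m) (j : Bool) (r : Fin m)
    (x : Vec d × Vec d) :
    HasFDerivAt (fun w : Vec d => net q (Function.update W j (Function.update (W j) r w)) x)
      (sgn j • (1 / (m : ℝ)) • ((q * (max 0 (inner ℝ (W j r) x.1)) ^ (q - 1)) • innerSL ℝ x.1
        + (q * (max 0 (inner ℝ (W j r) x.2)) ^ (q - 1)) • innerSL ℝ x.2)) (W j r) := by
  have h := hasFDerivAt_branch_update hq (W j) r x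
  cases j
  · simp only [net, Function.update_self, sgn]
    simp only [ne_eq, Bool.true_eq_false, not_false_eq_true, Function.update_of_ne,
      Bool.false_eq_true, if_false]
    rw [neg_one_smul]
    exact h.const_sub _
  · simp only [net, Function.update_self, sgn]
    simp only [ne_eq, Bool.false_eq_true, not_false_eq_true, Function.update_of_ne, if_true]
    rw [one_smul]
    exact h.sub_const _

lemma partialGrad_empRisk (hq : 1 < q) (v : Vec d) (y : Fin n → Bool) (ξ : Fin n → Vec d)
    (W : Weights d m) (j : Bool) (r : Fin m) :
    partialGrad (empRisk q v y ξ) W j r = (1 / (n : ℝ)) • ∑ i,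
      (-(1 + Real.exp (sgn (y i) * net q W (sgn (y i) • v, ξ i)))⁻¹ * (sgn (y i) * sgn j *
        (1 / (m : ℝ)))) • ((q * (max 0 (inner ℝ (W j r) (sgn (y i) • v))) ^ (q - 1)) • sgn (y i) • v
          + (q * (max 0 (inner ℝ (W j r) (ξ i))) ^ (q - 1)) • ξ i) := by
  unfold partialGrad
  apply HasGradientAt.gradient
  rw [hasGradientAt_iff_hasFDerivAt]
  have h : ∀ i, HasFDerivAt (fun w : Vec d => logistic (sgn (y i) *
      net q (Function.update W j (Function.update (W j) r w)) (sgn (y i) • v, ξ i)))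
      ((-(1 + Real.exp (sgn (y i) * net q W (sgn (y i) • v, ξ i)))⁻¹) • (sgn (y i) •
        (sgn j • (1 / (m : ℝ)) • ((q * (max 0 (inner ℝ (W j r) (sgn (y i) • v))) ^ (q - 1)) •
          innerSL ℝ (sgn (y i) • v)
        + (q * (max 0 (inner ℝ (W j r) (ξ i))) ^ (q - 1)) • innerSL ℝ (ξ i))))) (W j r) := by
    intro i
    have h1 := (hasFDerivAt_net_update hq W j r (sgn (y i) • v, ξ i)).const_mul (sgn (y i))
    have h2 := hasDerivAt_logistic (sgn (y i) *
      net q (Function.update W j (Function.update (W j) r (W j r))) (sgn (y i) • v, ξ i))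
    have h3 := h2.comp_hasFDerivAt (W j r) h1
    rw [Function.update_eq_self, Function.update_eq_self] at h3
    exact h3
  have hs := (HasFDerivAt.fun_sum (u := Finset.univ) fun i _ => h i).const_mul (1 / (n : ℝ))
  unfold empRisk
  refine hs.congr_fderiv ?_
  ext w
  simp only [InnerProductSpace.toDual_apply_apply, inner_smul_left, sum_inner, inner_add_left,
    smul_apply, sum_apply, add_apply,
    innerSL_apply_apply, smul_eq_mul, conj_trivial, map_smul]
  congr 1
  refine Finset.sum_congr rfl fun i _ => ?_
  ring

end Gradient

/-! ### The signal-noise decomposition -/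

section Decomposition

variable {d n m : ℕ} (q η : ℝ) (v : Vec d) (y : Fin n → Bool) (ξ : Fin n → Vec d)
  (W₀ : Weights d m) (z : ℕ → Vec d)

/-- The trajectory of noisy gradient descent on the data set with labels `y`. -/
abbrev traj : ℕ → Weights d m := noisyGD η (empRisk q v y ξ) W₀ z

/-- Minus the derivative of the logistic loss at the margin of sample `i`. -/
def lossDeriv (i : Fin n) (t : ℕ) : ℝ :=
  (1 + Real.exp (sgn (y i) * net q (traj q η v y ξ W₀ z t) (sgn (y i) • v, ξ i)))⁻¹

/-- The signal coefficient: the accumulated components of the gradient steps along `v`. -/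
def signalCoef (j : Bool) (r : Fin m) (t : ℕ) : ℝ :=
  ∑ s ∈ Finset.range t, η / (n * m) * (∑ i, lossDeriv q η v y ξ W₀ z i s *
    (q * (max 0 (sgn (y i) * inner ℝ (traj q η v y ξ W₀ z s j r) v)) ^ (q - 1))) * ‖v‖ ^ 2

/-- The noise coefficient: the accumulated components of the gradient steps along `ξ_i`. -/
def noiseCoef (j : Bool) (r : Fin m) (i : Fin n) (t : ℕ) : ℝ :=
  ∑ s ∈ Finset.range t, sgn j * sgn (y i) * (η / (n * m) * lossDeriv q η v y ξ W₀ z i s *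
    (q * (max 0 (inner ℝ (traj q η v y ξ W₀ z s j r) (ξ i))) ^ (q - 1)) * ‖ξ i‖ ^ 2)

variable {q η v y ξ W₀ z}

/-- The signal-noise decomposition of the trajectory. -/
lemma traj_eq (hq : 1 < q) (hv : v ≠ 0) (hξ : ∀ i, ξ i ≠ 0) (j : Bool) (r : Fin m) (t : ℕ) :
    traj q η v y ξ W₀ z t j r = W₀ j r
      + (sgn j * signalCoef q η v y ξ W₀ z j r t * (‖v‖ ^ 2)⁻¹) • v
      + ∑ i, (noiseCoef q η v y ξ W₀ z j r i t * (‖ξ i‖ ^ 2)⁻¹) • ξ i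
      - η • ∑ s ∈ Finset.Icc 1 t, z s := by
  have hv' : ‖v‖ ^ 2 ≠ 0 := by simpa using hv
  have hξ' : ∀ i, ‖ξ i‖ ^ 2 ≠ 0 := fun i => by simpa using hξ i
  induction t with
  | zero => simp [signalCoef, noiseCoef, noisyGD]
  | succ t ih =>
    have hstep : traj q η v y ξ W₀ z (t + 1) j r = traj q η v y ξ W₀ z t j r
        - η • (partialGrad (empRisk q v y ξ) (traj q η v y ξ W₀ z t) j r + z (t + 1)) := rfl
    have hΓ : signalCoef q η v y ξ W₀ z j r (t + 1) = signalCoef q η v y ξ W₀ z j r t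
      + η / (n * m) * (∑ i, lossDeriv q η v y ξ W₀ z i t *
      (q * (max 0 (sgn (y i) * inner ℝ (traj q η v y ξ W₀ z t j r) v)) ^ (q - 1))) * ‖v‖ ^ 2 :=
      Finset.sum_range_succ _ _
    have hΦ : ∀ i, noiseCoef q η v y ξ W₀ z j r i (t + 1) = noiseCoef q η v y ξ W₀ z j r i t
      + sgn j * sgn (y i) * (η / (n * m) * lossDeriv q η v y ξ W₀ z i t *
      (q * (max 0 (inner ℝ (traj q η v y ξ W₀ z t j r) (ξ i))) ^ (q - 1)) * ‖ξ i‖ ^ 2) :=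
      fun i => Finset.sum_range_succ _ _
    set c : Fin n → ℝ := fun i => -lossDeriv q η v y ξ W₀ z i t * (sgn (y i) * sgn j *
      (1 / (m : ℝ))) with hc
    set a : Fin n → ℝ := fun i =>
      q * (max 0 (sgn (y i) * inner ℝ (traj q η v y ξ W₀ z t j r) v)) ^ (q - 1) with ha
    set b : Fin n → ℝ := fun i =>
      q * (max 0 (inner ℝ (traj q η v y ξ W₀ z t j r) (ξ i))) ^ (q - 1) with hb
    have hgrad : (1 / (n : ℝ)) • ∑ i, c i • (a i • sgn (y i) • v + b i • ξ i)
        = (∑ i, 1 / (n : ℝ) * (c i * a i * sgn (y i))) • v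
          + ∑ i, (1 / (n : ℝ) * (c i * b i)) • ξ i := by
      simp only [smul_add, Finset.smul_sum, Finset.sum_smul, Finset.sum_add_distrib, smul_smul,
        mul_assoc]
    have e1 : sgn j * signalCoef q η v y ξ W₀ z j r (t + 1) * (‖v‖ ^ 2)⁻¹
        = sgn j * signalCoef q η v y ξ W₀ z j r t * (‖v‖ ^ 2)⁻¹
          - η * ∑ i, 1 / (n : ℝ) * (c i * a i * sgn (y i)) := by
      have e3 : ∑ i, 1 / (n : ℝ) * (c i * a i * sgn (y i))
          = -(sgn j * (1 / (n * m) * ∑ i, lossDeriv q η v y ξ W₀ z i t * a i)) := by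
        simp only [Finset.mul_sum, ← Finset.sum_neg_distrib]
        refine Finset.sum_congr rfl fun i _ => ?_
        have := Dynamics.sgn_mul_self (y i)
        calc 1 / (n : ℝ) * (c i * a i * sgn (y i))
            = -(sgn j * (1 / (n * m) * (lossDeriv q η v y ξ W₀ z i t * a i)))
              * (sgn (y i) * sgn (y i)) := by rw [hc]; ring
          _ = _ := by rw [this, mul_one]
      have hΓ' : signalCoef q η v y ξ W₀ z j r (t + 1) = signalCoef q η v y ξ W₀ z j r t
        + η / (n * m) * (∑ i, lossDeriv q η v y ξ W₀ z i t * a i) * ‖v‖ ^ 2 := hΓ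
      rw [hΓ', e3]
      linear_combination (sgn j * (η / (n * m) * (∑ i, lossDeriv q η v y ξ W₀ z i t * a i)))
        * mul_inv_cancel₀ hv'
    have e2 : ∀ i, noiseCoef q η v y ξ W₀ z j r i (t + 1) * (‖ξ i‖ ^ 2)⁻¹
        = noiseCoef q η v y ξ W₀ z j r i t * (‖ξ i‖ ^ 2)⁻¹ - η * (1 / (n : ℝ) * (c i * b i)) := by
      intro i
      have hΦ' : noiseCoef q η v y ξ W₀ z j r i (t + 1) = noiseCoef q η v y ξ W₀ z j r i t
        + sgn j * sgn (y i) * (η / (n * m) * lossDeriv q η v y ξ W₀ z i t * b i * ‖ξ i‖ ^ 2) :=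
        hΦ i
      have hci : c i = -lossDeriv q η v y ξ W₀ z i t * (sgn (y i) * sgn j * (1 / (m : ℝ))) := rfl
      rw [hΦ', hci]
      linear_combination (sgn j * sgn (y i) * (η / (n * m) * lossDeriv q η v y ξ W₀ z i t * b i))
        * mul_inv_cancel₀ (hξ' i)
    have hpg : partialGrad (empRisk q v y ξ) (traj q η v y ξ W₀ z t) j r
        = (1 / (n : ℝ)) • ∑ i, c i • (a i • sgn (y i) • v + b i • ξ i) := by
      rw [partialGrad_empRisk hq]
      simp only [real_inner_smul_right, hc, ha, hb, lossDeriv]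
    rw [hstep, hpg, hgrad, Finset.sum_Icc_succ_top (by omega), e1, ih]
    simp only [e2, sub_smul, Finset.sum_sub_distrib, mul_smul η, ← Finset.smul_sum]
    module

/-- The coefficients of noisy gradient descent follow the scalar dynamics. -/
def dynamics (hq : 1 < q) (hv : v ≠ 0) (hξ : ∀ i, ξ i ≠ 0) (hvξ : ∀ i, inner ℝ v (ξ i) = 0) :
    Dynamics n m q η ‖v‖ where
  y := y
  sq i := ‖ξ i‖ ^ 2
  corr i' i := (‖ξ i'‖ ^ 2)⁻¹ * inner ℝ (ξ i') (ξ i)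
  u₀ j r i := inner ℝ (W₀ j r) (ξ i)
  s₀ j r := inner ℝ (W₀ j r) v
  νξ i t := η * inner ℝ (∑ s ∈ Finset.Icc 1 t, z s) (ξ i)
  νv t := η * inner ℝ (∑ s ∈ Finset.Icc 1 t, z s) v
  Φ := noiseCoef q η v y ξ W₀ z
  Γ := signalCoef q η v y ξ W₀ z
  u j r i t := inner ℝ (traj q η v y ξ W₀ z t j r) (ξ i)
  s j r t := inner ℝ (traj q η v y ξ W₀ z t j r) v
  margin i t := sgn (y i) * net q (traj q η v y ξ W₀ z t) (sgn (y i) • v, ξ i)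
  g := lossDeriv q η v y ξ W₀ z
  Φ_zero j r i := by simp [noiseCoef]
  Φ_succ j r i t := Finset.sum_range_succ _ _
  Γ_zero j r := by simp [signalCoef]
  Γ_succ j r t := Finset.sum_range_succ _ _
  u_eq j r i t := by
    rw [traj_eq hq hv hξ]
    simp only [inner_add_left, inner_sub_left, sum_inner, real_inner_smul_left, hvξ, mul_zero,
      add_zero, mul_assoc, Finset.mul_sum]
  s_eq j r t := by
    have hv' : ‖v‖ ^ 2 ≠ 0 := by simpa using hv
    have hξv : ∀ i, inner ℝ (ξ i) v = 0 := fun i => by rw [real_inner_comm]; exact hvξ i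
    rw [traj_eq hq hv hξ]
    simp only [inner_add_left, inner_sub_left, sum_inner, real_inner_smul_left, hξv, mul_zero,
      add_zero, Finset.sum_const_zero, real_inner_self_eq_norm_sq]
    field_simp
  margin_eq i t := by
    simp only [net, branch, real_inner_smul_right]
    cases y i <;> simp [sgn]
  g_eq i t := rfl

/-- The coefficients of the decomposition are unique, because the data noises are nearly
orthogonal to each other and orthogonal to `v`. -/
lemma IsDecomposition.unique {W : ℕ → Weights d m} {Γ Γ' : Bool → Fin m → ℕ → ℝ}
    {Φ Φ' : Bool → Fin m → Fin n → ℕ → ℝ} {τ : ℝ} (hv : v ≠ 0) (hξ : ∀ i, ξ i ≠ 0)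
    (hvξ : ∀ i, inner ℝ v (ξ i) = 0) (hτ0 : 0 ≤ τ)
    (hτ : ∀ i' i, i' ≠ i → |(‖ξ i'‖ ^ 2)⁻¹ * inner ℝ (ξ i') (ξ i)| ≤ τ) (hn : n * τ < 1)
    (h : IsDecomposition v ξ η z W Γ Φ) (h' : IsDecomposition v ξ η z W Γ' Φ') :
    Γ' = Γ ∧ Φ' = Φ := by
  have hv' : ‖v‖ ^ 2 ≠ 0 := by simpa using hv
  have hξ' : ∀ i, ‖ξ i‖ ^ 2 ≠ 0 := fun i => by simpa using hξ i
  have hξv : ∀ i, inner ℝ (ξ i) v = 0 := fun i => by rw [real_inner_comm]; exact hvξ i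
  have key : ∀ j r t, (sgn j * Γ j r t * (‖v‖ ^ 2)⁻¹) • v
      + ∑ i, (Φ j r i t * (‖ξ i‖ ^ 2)⁻¹) • ξ i = (sgn j * Γ' j r t * (‖v‖ ^ 2)⁻¹) • v
      + ∑ i, (Φ' j r i t * (‖ξ i‖ ^ 2)⁻¹) • ξ i := by
    intro j r t
    have h1 := (h.eq j r t).symm.trans (h'.eq j r t)
    have h2 := sub_left_injective h1
    simpa [add_assoc] using h2
  have hsgn : ∀ j, sgn j ≠ 0 := fun j => by cases j <;> simp [sgn]
  constructor
  · funext j r t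
    have h1 := congrArg (fun x => inner ℝ x v) (key j r t)
    simp only [inner_add_left, sum_inner, real_inner_smul_left, hξv, mul_zero,
      Finset.sum_const_zero, add_zero, real_inner_self_eq_norm_sq] at h1
    rw [inv_mul_cancel_right₀ hv', inv_mul_cancel_right₀ hv'] at h1
    exact (mul_left_cancel₀ (hsgn j) h1).symm
  · funext j r i t
    have hdiff : ∀ i, (Φ' j r i t - Φ j r i t)
        + ∑ i' ∈ Finset.univ.erase i, (Φ' j r i' t - Φ j r i' t)
          * ((‖ξ i'‖ ^ 2)⁻¹ * inner ℝ (ξ i') (ξ i)) = 0 := by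
      intro i
      have h1 := congrArg (fun x => inner ℝ x (ξ i)) (key j r t)
      simp only [inner_add_left, sum_inner, real_inner_smul_left, hvξ, mul_zero, zero_add] at h1
      have h2 : ∑ i', (Φ' j r i' t - Φ j r i' t) * ((‖ξ i'‖ ^ 2)⁻¹ * inner ℝ (ξ i') (ξ i)) = 0 := by
        simp only [sub_mul, Finset.sum_sub_distrib, ← mul_assoc]
        linarith
      rw [← Finset.add_sum_erase _ _ (Finset.mem_univ i), real_inner_self_eq_norm_sq,
        inv_mul_cancel₀ (hξ' i), mul_one] at h2
      exact h2
    -- the largest difference of the coefficients is at most `n * τ < 1` times itself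
    obtain ⟨i₀, -, hi₀⟩ := Finset.exists_max_image Finset.univ
      (fun i => |Φ' j r i t - Φ j r i t|) ⟨i, Finset.mem_univ i⟩
    set M := |Φ' j r i₀ t - Φ j r i₀ t| with hM
    have h1 : M ≤ n * τ * M := by
      have h2 : Φ' j r i₀ t - Φ j r i₀ t = -∑ i' ∈ Finset.univ.erase i₀,
          (Φ' j r i' t - Φ j r i' t) * ((‖ξ i'‖ ^ 2)⁻¹ * inner ℝ (ξ i') (ξ i₀)) := by
        linarith [hdiff i₀]
      rw [hM, h2, abs_neg]
      refine (Finset.abs_sum_le_sum_abs _ _).trans ?_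
      rw [← abs_neg, ← h2]
      calc _ ≤ ∑ _i' ∈ Finset.univ.erase i₀, M * τ := by
            refine Finset.sum_le_sum fun i' hi' => ?_
            rw [abs_mul]
            exact mul_le_mul (hi₀ i' (Finset.mem_univ _)) (hτ _ _ (Finset.ne_of_mem_erase hi'))
              (abs_nonneg _) (abs_nonneg _)
        _ ≤ ∑ _i' : Fin n, M * τ := Finset.sum_le_sum_of_subset_of_nonneg (Finset.subset_univ _)
            fun _ _ _ => mul_nonneg (abs_nonneg _) hτ0
        _ = n * τ * M := by simp; ring
    have hM0 : 0 ≤ M := abs_nonneg _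
    have hM1 : M = 0 := by nlinarith
    have h3 := hi₀ i (Finset.mem_univ i)
    have h4 : |Φ' j r i t - Φ j r i t| = 0 := le_antisymm (by linarith) (abs_nonneg _)
    exact sub_eq_zero.mp (abs_eq_zero.mp h4)

end Decomposition

end PrivateCNN

namespace PrivateCNN

/-! ### Gaussian tails and counts -/

section Tails

variable {Ω : Type*} [MeasurableSpace Ω] {μ : Measure Ω}

/-- The two-sided sub-Gaussian tail.  The strict inequality covers the degenerate case `c = 0`. -/
lemma subgaussian_abs_tail [IsProbabilityMeasure μ] {X : Ω → ℝ} {c : NNReal}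
    (h : HasSubgaussianMGF X c μ) {ζ : ℝ} (hζ : 0 ≤ ζ) :
    μ.real {ω | ζ * √(c : ℝ) < |X ω|} ≤ 2 * Real.exp (-ζ ^ 2 / 2) := by
  rcases eq_or_ne c 0 with rfl | hc
  · have h0 : X =ᵐ[μ] 0 := h.ae_eq_zero_of_hasSubgaussianMGF_zero
    have h1 : μ {ω | ζ * √((0 : NNReal) : ℝ) < |X ω|} = 0 := by
      refine measure_mono_null (fun ω hω => ?_) (ae_iff.mp h0)
      simp only [NNReal.coe_zero, Real.sqrt_zero, mul_zero, Set.mem_ofPred_eq, abs_pos] at hω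
      exact hω
    rw [measureReal_def, h1]
    simp only [ENNReal.toReal_zero]
    positivity
  · have hc0 : (0 : ℝ) < c := by positivity
    have hpos : 0 ≤ ζ * √(c : ℝ) := by positivity
    have h1 := h.measure_ge_le hpos
    have h2 := h.neg.measure_ge_le hpos
    have h3 : -(ζ * √(c : ℝ)) ^ 2 / (2 * c) = -ζ ^ 2 / 2 := by
      rw [mul_pow, Real.sq_sqrt hc0.le]; field_simp
    rw [h3] at h1 h2
    have h4 : {ω | ζ * √(c : ℝ) < |X ω|} ⊆
        {ω | ζ * √(c : ℝ) ≤ X ω} ∪ {ω | ζ * √(c : ℝ) ≤ (-X) ω} := by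
      intro ω hω
      rw [Set.mem_ofPred_eq] at hω
      rcases lt_abs.mp hω with h5 | h5
      · exact Or.inl h5.le
      · exact Or.inr h5.le
    have h5 := (measureReal_mono h4 (measure_ne_top μ _)).trans (measureReal_union_le _ _)
    linarith

/-- Hoeffding's inequality for the number of successes in `m` independent trials. -/
lemma pi_count_lt_le [IsProbabilityMeasure μ] (m : ℕ) {A : Set Ω} (hA : MeasurableSet A) {p : ℝ}
    (hp : 0 < p) (hpA : p ≤ μ.real A) :
    (Measure.pi fun _ : Fin m => μ).real
      {f | (∑ r, A.indicator (fun _ => (1 : ℝ)) (f r)) < p / 2 * m}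
      ≤ Real.exp (-(p ^ 2 * m / 2)) := by
  rcases Nat.eq_zero_or_pos m with rfl | hm
  · simp
  set ν := Measure.pi fun _ : Fin m => μ with hν
  have hm' : (0 : ℝ) < m := by exact_mod_cast hm
  set Y : Ω → ℝ := A.indicator fun _ => (1 : ℝ) with hY
  have hYm : Measurable Y := measurable_const.indicator hA
  have hind : iIndepFun (fun (r : Fin m) (f : Fin m → Ω) => μ.real A - Y (f r)) ν :=
    iIndepFun_pi (X := fun (_ : Fin m) ω => μ.real A - Y ω) fun _ => by fun_prop
  have hsub0 : HasSubgaussianMGF (fun ω => μ.real A - Y ω) ((‖(1 : ℝ) - 0‖₊ / 2) ^ 2) μ := by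
    have h1 : HasSubgaussianMGF (fun ω => Y ω - ∫ x, Y x ∂μ) ((‖(1 : ℝ) - 0‖₊ / 2) ^ 2) μ :=
      hasSubgaussianMGF_of_mem_Icc hYm.aemeasurable (Filter.Eventually.of_forall fun ω => by
        by_cases h : ω ∈ A <;> simp [hY, h])
    have h2 : ∫ x, Y x ∂μ = μ.real A := by
      rw [hY, integral_indicator_const _ hA]; simp
    rw [h2] at h1
    refine h1.neg.congr (Filter.Eventually.of_forall fun ω => ?_)
    simp
  have hsub : ∀ r : Fin m, HasSubgaussianMGF (fun f : Fin m → Ω => μ.real A - Y (f r))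
      ((‖(1 : ℝ) - 0‖₊ / 2) ^ 2) ν := by
    intro r
    have hmp := measurePreserving_eval (fun _ : Fin m => μ) r
    refine HasSubgaussianMGF.of_map (Y := Function.eval r) (X := fun ω => μ.real A - Y ω)
      hmp.measurable.aemeasurable ?_
    rw [hmp.map_eq]; exact hsub0
  have h := HasSubgaussianMGF.measure_sum_ge_le_of_iIndepFun hind (s := Finset.univ)
    (fun r _ => hsub r) (ε := p / 2 * m) (by positivity)
  have h3 : -(p / 2 * m) ^ 2 / (2 * ((∑ _r : Fin m, (‖(1 : ℝ) - 0‖₊ / 2) ^ 2 : NNReal) : ℝ))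
      = -(p ^ 2 * m / 2) := by
    simp; field_simp
  rw [h3] at h
  refine (measureReal_mono (fun f hf => ?_) (measure_ne_top _ _)).trans h
  simp only [Set.mem_ofPred_eq] at hf ⊢
  rw [Finset.sum_sub_distrib]
  simp only [Finset.sum_const, Finset.card_univ, Fintype.card_fin, nsmul_eq_mul]
  nlinarith

/-- Tonelli's bound: a set whose sections all have measure at most `c` has measure at most `c`. -/
lemma prod_real_le {Ω' : Type*} [MeasurableSpace Ω'] {ν : Measure Ω'} [IsProbabilityMeasure μ]
    [IsProbabilityMeasure ν] {s : Set (Ω × Ω')} (hs : MeasurableSet s) {c : ℝ}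
    (h : ∀ x, ν.real (Prod.mk x ⁻¹' s) ≤ c) : (μ.prod ν).real s ≤ c := by
  obtain ⟨x₀⟩ : Nonempty Ω := by
    by_contra hne
    rw [not_nonempty_iff] at hne
    have : μ Set.univ = 0 := by rw [Set.univ_eq_empty_iff.mpr hne]; simp
    simp at this
  have hc : 0 ≤ c := measureReal_nonneg.trans (h x₀)
  rw [measureReal_def]
  refine ENNReal.toReal_le_of_le_ofReal hc ?_
  rw [Measure.prod_apply hs]
  calc ∫⁻ x, ν (Prod.mk x ⁻¹' s) ∂μ ≤ ∫⁻ _x, ENNReal.ofReal c ∂μ := by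
        refine lintegral_mono fun x => ?_
        rw [← ENNReal.ofReal_toReal (measure_ne_top ν (Prod.mk x ⁻¹' s))]
        exact ENNReal.ofReal_le_ofReal (h x)
    _ = ENNReal.ofReal c := by simp

lemma prod_real_fst {Ω' : Type*} [MeasurableSpace Ω'] {ν : Measure Ω'} [IsProbabilityMeasure μ]
    [IsProbabilityMeasure ν] {s : Set Ω} (hs : MeasurableSet s) :
    (μ.prod ν).real (Prod.fst ⁻¹' s) = μ.real s :=
  measurePreserving_fst.measureReal_preimage hs.nullMeasurableSet

lemma prod_real_snd {Ω' : Type*} [MeasurableSpace Ω'] {ν : Measure Ω'} [IsProbabilityMeasure μ]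
    [IsProbabilityMeasure ν] {s : Set Ω'} (hs : MeasurableSet s) :
    (μ.prod ν).real (Prod.snd ⁻¹' s) = ν.real s :=
  measurePreserving_snd.measureReal_preimage hs.nullMeasurableSet

lemma pi_real_eval {ι : Type*} [Fintype ι] [IsProbabilityMeasure μ] (i : ι) {s : Set Ω}
    (hs : MeasurableSet s) :
    (Measure.pi fun _ : ι => μ).real (Function.eval i ⁻¹' s) = μ.real s :=
  (measurePreserving_eval (fun _ : ι => μ) i).measureReal_preimage hs.nullMeasurableSet

lemma pi_real_eval_pair {ι : Type*} [Fintype ι] [IsProbabilityMeasure μ] {i j : ι} (hij : i ≠ j)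
    {s : Set (Ω × Ω)} (hs : MeasurableSet s) :
    (Measure.pi fun _ : ι => μ).real {f | (f i, f j) ∈ s} = (μ.prod μ).real s := by
  have h := Measure.infinitePi_map_eval_prod (P := fun _ : ι => μ) hij
  rw [Measure.infinitePi_eq_pi] at h
  rw [measureReal_def, measureReal_def, ← h, Measure.map_apply (by fun_prop) hs]
  rfl

end Tails

section MultivariateGaussian

open Matrix

variable {d : ℕ} {S : Matrix (Fin d) (Fin d) ℝ}

lemma map_inner_multivariateGaussian (hS : S.PosSemidef) (x : Vec d) :
    (multivariateGaussian 0 S).map (fun g => inner ℝ x g)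
      = gaussianReal 0 (x ⬝ᵥ S *ᵥ x).toNNReal := by
  have h := IsGaussian.map_eq_gaussianReal (μ := multivariateGaussian (0 : Vec d) S) (innerSL ℝ x)
  have h1 : ∫ g, innerSL ℝ x g ∂(multivariateGaussian (0 : Vec d) S) = 0 := by
    rw [ContinuousLinearMap.integral_comp_id_comm IsGaussian.integrable_id,
      integral_id_multivariateGaussian, map_zero]
  have h2 : Var[innerSL ℝ x; multivariateGaussian (0 : Vec d) S] = x ⬝ᵥ S *ᵥ x := by
    rw [← covarianceBilin_multivariateGaussian (μ := 0) hS,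
      covarianceBilin_self IsGaussian.memLp_two_id]
    rfl
  rw [h1, h2] at h
  exact h

lemma subgaussian_inner (hS : S.PosSemidef) {x : Vec d} {c : NNReal}
    (hc : x ⬝ᵥ S *ᵥ x ≤ c) :
    HasSubgaussianMGF (fun g => inner ℝ x g) c (multivariateGaussian 0 S) := by
  have h := map_inner_multivariateGaussian hS x
  have hm : AEMeasurable (fun g : Vec d => inner ℝ x g) (multivariateGaussian 0 S) := by fun_prop
  refine HasSubgaussianMGF.of_map (X := id) hm ?_
  rw [h]
  refine ⟨fun t => integrable_exp_mul_gaussianReal t, fun t => ?_⟩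
  rw [mgf_id_gaussianReal]
  refine Real.exp_le_exp.mpr ?_
  have : ((x ⬝ᵥ S *ᵥ x).toNNReal : ℝ) ≤ c := by
    rw [Real.coe_toNNReal']; exact max_le hc c.2
  have h3 := mul_le_mul_of_nonneg_right this (sq_nonneg t)
  linarith

end MultivariateGaussian

namespace Setup

open Matrix
open scoped MatrixOrder

variable (P : Setup)

lemma norm_v_pos : 0 < ‖P.v‖ := norm_pos_iff.mpr P.v_ne

lemma H_eq : P.H = 1 - (‖P.v‖ ^ 2)⁻¹ • vecMulVec P.v P.v := rfl

lemma v_dotProduct_self : (P.v : Fin P.d → ℝ) ⬝ᵥ P.v = ‖P.v‖ ^ 2 := by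
  rw [EuclideanSpace.real_norm_sq_eq]
  simp [dotProduct, sq]

lemma H_mul_H : P.H * P.H = P.H := by
  have hv : ‖P.v‖ ^ 2 ≠ 0 := by have := P.norm_v_pos; positivity
  rw [H_eq, sub_mul, mul_sub, mul_sub, one_mul, mul_one, one_mul, smul_mul_smul_comm,
    vecMulVec_mul_vecMulVec, v_dotProduct_self, vecMulVec_smul, smul_smul,
    mul_assoc, inv_mul_cancel₀ hv, mul_one, sub_self, sub_zero]

lemma H_isHermitian : P.H.IsHermitian := by
  rw [H_eq]
  ext a b
  simp [vecMulVec_apply, Matrix.one_apply, mul_comm, eq_comm]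

lemma H_posSemidef : P.H.PosSemidef := by
  have h := posSemidef_conjTranspose_mul_self P.H
  rwa [P.H_isHermitian, H_mul_H] at h

lemma H_mulVec (x : Vec P.d) :
    P.H *ᵥ x = (x : Fin P.d → ℝ) - ((‖P.v‖ ^ 2)⁻¹ * inner ℝ P.v x) • (P.v : Fin P.d → ℝ) := by
  rw [H_eq, sub_mulVec, one_mulVec, smul_mulVec, vecMulVec_mulVec]
  have : (P.v : Fin P.d → ℝ) ⬝ᵥ x = inner ℝ P.v x := by
    simp [dotProduct, PiLp.inner_apply, mul_comm]
  rw [this]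
  ext k
  simp
  ring

lemma quadForm_H (x : Vec P.d) :
    x ⬝ᵥ P.H *ᵥ x = ‖x‖ ^ 2 - (‖P.v‖ ^ 2)⁻¹ * inner ℝ P.v x ^ 2 := by
  have h1 : (x : Fin P.d → ℝ) ⬝ᵥ P.v = inner ℝ P.v x := by
    simp [dotProduct, PiLp.inner_apply]
  have h2 : (x : Fin P.d → ℝ) ⬝ᵥ x = ‖x‖ ^ 2 := by
    rw [EuclideanSpace.real_norm_sq_eq]; simp [dotProduct, sq]
  rw [H_mulVec, dotProduct_sub, dotProduct_smul, h1, h2, smul_eq_mul]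
  ring

lemma quadForm_smul_H_le (x : Vec P.d) :
    x ⬝ᵥ (P.σξ ^ 2 • P.H) *ᵥ x ≤ (Real.toNNReal (P.σξ ^ 2 * ‖x‖ ^ 2) : ℝ) := by
  rw [smul_mulVec, dotProduct_smul, quadForm_H, smul_eq_mul, Real.coe_toNNReal _ (by positivity)]
  have : 0 ≤ (‖P.v‖ ^ 2)⁻¹ * inner ℝ P.v x ^ 2 := by positivity
  exact mul_le_mul_of_nonneg_left (by linarith) (by positivity)

lemma quadForm_smul_one (s : ℝ) (x : Vec P.d) :
    x ⬝ᵥ (s ^ 2 • (1 : Matrix (Fin P.d) (Fin P.d) ℝ)) *ᵥ x = s ^ 2 * ‖x‖ ^ 2 := by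
  rw [smul_mulVec, one_mulVec, dotProduct_smul, EuclideanSpace.real_norm_sq_eq]
  simp [dotProduct, sq]

lemma sqrt_cov : CFC.sqrt (P.σξ ^ 2 • P.H) = P.σξ • P.H := by
  refine CFC.sqrt_unique ?_ ?_
  · rw [smul_mul_smul_comm, H_mul_H, sq]
  · exact (P.H_posSemidef.smul P.σξ_pos.le).nonneg

end Setup

end PrivateCNN

/-! ### The Gaussian laws of the data and of the noise -/

namespace PrivateCNN

/-- The probability that a standard Gaussian is at least `1`. -/
def gaussTail : ℝ := (gaussianReal 0 1).real (Set.Ici 1)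

lemma gaussTail_pos : 0 < gaussTail := by
  unfold gaussTail
  rw [measureReal_def, ENNReal.toReal_pos_iff]
  refine ⟨?_, measure_lt_top _ _⟩
  have h := gaussianReal_absolutelyContinuous' 0 (v := 1) one_ne_zero
  rw [pos_iff_ne_zero]
  intro h0
  have h1 := h h0
  simp at h1

lemma gaussTail_le_one : gaussTail ≤ 1 := measureReal_le_one

lemma gaussTail_le_gaussianReal {c : ℝ} (hc : 0 ≤ c) :
    gaussTail ≤ (gaussianReal 0 (c ^ 2).toNNReal).real (Set.Ici c) := by
  have h := gaussianReal_map_const_mul (μ := 0) (v := 1) c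
  have h2 : gaussianReal 0 (c ^ 2).toNNReal = (gaussianReal 0 1).map (fun x => c * x) := by
    rw [h, mul_zero, mul_one]
    congr 1
    ext
    simp [sq_nonneg]
  rw [h2, map_measureReal_apply (by fun_prop) measurableSet_Ici]
  refine measureReal_mono (fun x hx => ?_) (measure_ne_top _ _)
  simp only [Set.mem_Ici, Set.mem_preimage] at *
  nlinarith

namespace Setup

open scoped MatrixOrder

variable (P : Setup)

/-- The law of one data noise. -/
abbrev dataLaw : Measure (Vec P.d) := multivariateGaussian 0 (P.σξ ^ 2 • P.H)

lemma dataLaw_tail (x : Vec P.d) {ζ : ℝ} (hζ : 0 ≤ ζ) :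
    P.dataLaw.real {g | ζ * (P.σξ * ‖x‖) < |inner ℝ x g|} ≤ 2 * Real.exp (-ζ ^ 2 / 2) := by
  have h := subgaussian_abs_tail (subgaussian_inner (P.H_posSemidef.smul (sq_nonneg P.σξ))
    (P.quadForm_smul_H_le x)) hζ
  rwa [Real.coe_toNNReal _ (by positivity), ← mul_pow, Real.sqrt_sq
    (mul_nonneg P.σξ_pos.le (norm_nonneg x))] at h

lemma posSemidef_smul_one (s : ℝ) :
    (s ^ 2 • (1 : Matrix (Fin P.d) (Fin P.d) ℝ)).PosSemidef :=
  Matrix.PosSemidef.one.smul (sq_nonneg s)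

lemma subgaussian_isoGaussian (s : ℝ) (x : Vec P.d) :
    HasSubgaussianMGF (fun g => inner ℝ x g) (s ^ 2 * ‖x‖ ^ 2).toNNReal (P.isoGaussian s) := by
  refine subgaussian_inner (P.posSemidef_smul_one s) ?_
  rw [quadForm_smul_one, Real.coe_toNNReal _ (by positivity)]

lemma isoGaussian_tail {s : ℝ} (hs : 0 ≤ s) (x : Vec P.d) {ζ : ℝ} (hζ : 0 ≤ ζ) :
    (P.isoGaussian s).real {g | ζ * (s * ‖x‖) < |inner ℝ x g|} ≤ 2 * Real.exp (-ζ ^ 2 / 2) := by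
  have h := subgaussian_abs_tail (P.subgaussian_isoGaussian s x) hζ
  rwa [Real.coe_toNNReal _ (by positivity), ← mul_pow, Real.sqrt_sq
    (mul_nonneg hs (norm_nonneg x))] at h

lemma gaussTail_le_isoGaussian {s : ℝ} (hs : 0 ≤ s) (x : Vec P.d) :
    gaussTail ≤ (P.isoGaussian s).real {g | s * ‖x‖ ≤ inner ℝ x g} := by
  have h := gaussTail_le_gaussianReal (mul_nonneg hs (norm_nonneg x))
  rw [mul_pow, ← P.quadForm_smul_one, ← map_inner_multivariateGaussian (P.posSemidef_smul_one s),
    map_measureReal_apply (by fun_prop) measurableSet_Ici] at h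
  exact h

/-- The private noise accumulated over `t` steps has size `√t`. -/
lemma isoGaussian_sum_tail {s : ℝ} (hs : 0 ≤ s) (x : Vec P.d) {ζ : ℝ} (hζ : 0 ≤ ζ) (t : ℕ) :
    (Measure.infinitePi fun _ : ℕ => P.isoGaussian s).real
      {z | ζ * (√(t : ℝ) * (s * ‖x‖)) < |inner ℝ x (∑ k ∈ Finset.Icc 1 t, z k)|}
      ≤ 2 * Real.exp (-ζ ^ 2 / 2) := by
  set ν := Measure.infinitePi fun _ : ℕ => P.isoGaussian s with hν
  have hind : iIndepFun (fun (k : ℕ) (z : ℕ → Vec P.d) => inner ℝ x (z k)) ν :=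
    iIndepFun_infinitePi (X := fun (_ : ℕ) (g : Vec P.d) => inner ℝ x g) fun _ => by fun_prop
  have hsub : ∀ k, HasSubgaussianMGF (fun z : ℕ → Vec P.d => inner ℝ x (z k))
      (s ^ 2 * ‖x‖ ^ 2).toNNReal ν := by
    intro k
    have hmp := measurePreserving_eval_infinitePi (fun _ : ℕ => P.isoGaussian s) k
    refine HasSubgaussianMGF.of_map (Y := Function.eval k) (X := fun g => inner ℝ x g)
      hmp.measurable.aemeasurable ?_
    rw [hmp.map_eq]; exact P.subgaussian_isoGaussian s x
  have h := subgaussian_abs_tail (HasSubgaussianMGF.sum_of_iIndepFun hind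
    (s := Finset.Icc 1 t) fun k _ => hsub k) hζ
  have h2 : √((∑ _k ∈ Finset.Icc 1 t, (s ^ 2 * ‖x‖ ^ 2).toNNReal : NNReal) : ℝ)
      = √(t : ℝ) * (s * ‖x‖) := by
    simp only [Finset.sum_const, Nat.card_Icc, add_tsub_cancel_right, nsmul_eq_mul, NNReal.coe_mul,
      NNReal.coe_natCast]
    rw [Real.coe_toNNReal _ (by positivity), Real.sqrt_mul (by positivity), ← mul_pow, Real.sqrt_sq
      (mul_nonneg hs (norm_nonneg x))]
  rw [h2] at h
  simpa only [inner_sum] using h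

/-- Almost surely the data noise is orthogonal to the signal. -/
lemma dataLaw_inner_v : P.dataLaw.real {g | inner ℝ P.v g ≠ 0} = 0 := by
  have hv := P.norm_v_pos
  have h0 : P.v.ofLp ⬝ᵥ (P.σξ ^ 2 • P.H).mulVec P.v.ofLp ≤ ((0 : NNReal) : ℝ) := by
    rw [Matrix.smul_mulVec, dotProduct_smul, quadForm_H, real_inner_self_eq_norm_sq]
    refine le_of_eq ?_
    simp only [smul_eq_mul, NNReal.coe_zero, mul_eq_zero]
    right
    field_simp
    ring
  have h := (subgaussian_inner (P.H_posSemidef.smul (sq_nonneg P.σξ))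
    h0).ae_eq_zero_of_hasSubgaussianMGF_zero
  rw [measureReal_def]
  have h1 : P.dataLaw {g | inner ℝ P.v g ≠ 0} = 0 := ae_iff.mp h
  rw [h1]; rfl

/-- A data noise is a standard Gaussian vector `g`, projected orthogonally to `v` and scaled by
`σ_ξ`.  A fixed fraction of the coordinates of `g` is at least `1`, and the component of `g`
along `v` is negligible. -/
lemma dataLaw_lower {ζ : ℝ} (hζ : 0 ≤ ζ) (hd : ζ ^ 2 ≤ gaussTail / 4 * P.d) :
    P.dataLaw.real {g | ‖g‖ ^ 2 < gaussTail / 4 * P.ξnorm ^ 2}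
      ≤ Real.exp (-(gaussTail ^ 2 * P.d / 2)) + 2 * Real.exp (-ζ ^ 2 / 2) := by
  have hv := P.norm_v_pos
  have hmap : P.dataLaw = (Measure.pi fun _ : Fin P.d => gaussianReal 0 1).map
      (fun f => Matrix.toEuclideanCLM (𝕜 := ℝ) (P.σξ • P.H) (WithLp.toLp 2 f)) := by
    have h : P.dataLaw = (stdGaussian (EuclideanSpace ℝ (Fin P.d))).map
        (fun x => 0 + Matrix.toEuclideanCLM (𝕜 := ℝ) (CFC.sqrt (P.σξ ^ 2 • P.H)) x) := rfl
    rw [h, sqrt_cov, ← map_pi_eq_stdGaussian, Measure.map_map (by fun_prop) (by fun_prop)]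
    congr 1
    funext f
    simp
  rw [hmap, map_measureReal_apply (by fun_prop) (measurableSet_lt (by fun_prop) (by fun_prop))]
  have hE1 := pi_count_lt_le (μ := gaussianReal 0 1) P.d measurableSet_Ici gaussTail_pos
    (le_refl gaussTail)
  have hE2 : (Measure.pi fun _ : Fin P.d => gaussianReal 0 1).real
      {f | ζ * ‖P.v‖ < |inner ℝ P.v (WithLp.toLp 2 f)|} ≤ 2 * Real.exp (-ζ ^ 2 / 2) := by
    have h := P.isoGaussian_tail zero_le_one P.v hζ
    have h1 : P.isoGaussian 1
        = (Measure.pi fun _ : Fin P.d => gaussianReal 0 1).map (WithLp.toLp 2) := by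
      rw [map_pi_eq_stdGaussian]; simp [isoGaussian]
    rw [h1, map_measureReal_apply (by fun_prop)
      (measurableSet_lt (by fun_prop) (by fun_prop)), one_mul] at h
    exact h
  refine (measureReal_mono (fun f hf => ?_) (measure_ne_top _ _)).trans
    ((measureReal_union_le _ _).trans (add_le_add hE1 hE2))
  by_contra hcon
  simp only [Set.mem_union, Set.mem_ofPred_eq, not_or, not_lt] at hcon
  simp only [Set.mem_preimage, Set.mem_ofPred_eq] at hf
  obtain ⟨hc1, hc2⟩ := hcon
  set x : Vec P.d := WithLp.toLp 2 f with hx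
  have hxi : Matrix.toEuclideanCLM (𝕜 := ℝ) (P.σξ • P.H) x
      = P.σξ • (x - ((‖P.v‖ ^ 2)⁻¹ * inner ℝ P.v x) • P.v) := by
    ext k
    rw [Matrix.ofLp_toEuclideanCLM, Matrix.smul_mulVec, H_mulVec]
    simp
  have hnorm : ‖x - ((‖P.v‖ ^ 2)⁻¹ * inner ℝ P.v x) • P.v‖ ^ 2
      = ‖x‖ ^ 2 - (‖P.v‖ ^ 2)⁻¹ * inner ℝ P.v x ^ 2 := by
    rw [norm_sub_sq_real, real_inner_smul_right, norm_smul, real_inner_comm, mul_pow,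
      Real.norm_eq_abs, sq_abs]
    field_simp
    ring
  have hcount : ∑ r, (Set.Ici 1).indicator (fun _ => (1 : ℝ)) (f r) ≤ ‖x‖ ^ 2 := by
    rw [EuclideanSpace.real_norm_sq_eq]
    refine Finset.sum_le_sum fun r _ => ?_
    by_cases hr : f r ∈ Set.Ici (1 : ℝ)
    · rw [Set.indicator_of_mem hr]
      simp only [Set.mem_Ici] at hr
      have : x r = f r := rfl
      rw [this]; nlinarith
    · rw [Set.indicator_of_notMem hr]; positivity
  have hin : (‖P.v‖ ^ 2)⁻¹ * inner ℝ P.v x ^ 2 ≤ ζ ^ 2 := by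
    rw [inv_mul_le_iff₀ (by positivity), ← sq_abs (inner ℝ P.v x)]
    calc |inner ℝ P.v x| ^ 2 ≤ (ζ * ‖P.v‖) ^ 2 := pow_le_pow_left₀ (abs_nonneg _) hc2 2
      _ = _ := by ring
  rw [hxi, norm_smul, mul_pow, hnorm, Real.norm_eq_abs, sq_abs, ξnorm, mul_pow,
    Real.sq_sqrt (by positivity)] at hf
  have h3 : P.σξ ^ 2 * (gaussTail / 4 * P.d)
      ≤ P.σξ ^ 2 * (‖x‖ ^ 2 - (‖P.v‖ ^ 2)⁻¹ * inner ℝ P.v x ^ 2) :=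
    mul_le_mul_of_nonneg_left (by linarith) (sq_nonneg _)
  linarith

/-! ### Marginals of the joint law -/

section Marginals

instance : IsProbabilityMeasure P.law := by
  have h := PMF.toMeasure.isProbabilityMeasure (PMF.uniformOfFintype Bool)
  have h1 : IsProbabilityMeasure (Measure.pi fun _ : Fin P.n =>
      (PMF.uniformOfFintype Bool).toMeasure) := by infer_instance
  have h2 : IsProbabilityMeasure (Measure.pi fun _ : Fin P.n =>
      multivariateGaussian 0 (P.σξ ^ 2 • P.H)) := by infer_instance
  have h3 : IsProbabilityMeasure (Measure.pi fun _ : Bool => Measure.pi fun _ : Fin P.m =>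
      P.isoGaussian P.σ₀) := by infer_instance
  have h4 : IsProbabilityMeasure (Measure.infinitePi fun _ : ℕ => P.isoGaussian P.σz) := by
    infer_instance
  unfold law
  exact inferInstance

/-- The law of the initialization. -/
abbrev initLaw : Measure (Weights P.d P.m) :=
  Measure.pi fun _ : Bool => Measure.pi fun _ : Fin P.m => P.isoGaussian P.σ₀

/-- The law of the private noise. -/
abbrev noiseLaw : Measure (ℕ → Vec P.d) := Measure.infinitePi fun _ : ℕ => P.isoGaussian P.σz

lemma law_data {s : Set (Fin P.n → Vec P.d)} (hs : MeasurableSet s) :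
    P.law.real {ω | ω.2.1 ∈ s} = (Measure.pi fun _ : Fin P.n => P.dataLaw).real s := by
  have h1 : {ω : P.Sample | ω.2.1 ∈ s} = Prod.snd ⁻¹' (Prod.fst ⁻¹' s) := rfl
  rw [h1, law, prod_real_snd (measurable_fst hs), prod_real_fst hs]

lemma law_init {s : Set (Weights P.d P.m)} (hs : MeasurableSet s) :
    P.law.real {ω | ω.2.2.1 ∈ s} = P.initLaw.real s := by
  have h1 : {ω : P.Sample | ω.2.2.1 ∈ s} = Prod.snd ⁻¹' (Prod.snd ⁻¹' (Prod.fst ⁻¹' s)) := rfl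
  rw [h1, law, prod_real_snd (measurable_snd (measurable_fst hs)),
    prod_real_snd (measurable_fst hs), prod_real_fst hs]

lemma law_noise {s : Set (ℕ → Vec P.d)} (hs : MeasurableSet s) :
    P.law.real {ω | ω.2.2.2 ∈ s} = P.noiseLaw.real s := by
  have h1 : {ω : P.Sample | ω.2.2.2 ∈ s} = Prod.snd ⁻¹' (Prod.snd ⁻¹' (Prod.snd ⁻¹' s)) := rfl
  rw [h1, law, prod_real_snd (measurable_snd (measurable_snd hs)),
    prod_real_snd (measurable_snd hs), prod_real_snd hs]

lemma law_data_init_le {s : Set ((Fin P.n → Vec P.d) × Weights P.d P.m)} (hs : MeasurableSet s)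
    {c : ℝ} (h : ∀ ξ, P.initLaw.real (Prod.mk ξ ⁻¹' s) ≤ c) :
    P.law.real {ω | (ω.2.1, ω.2.2.1) ∈ s} ≤ c := by
  have h1 : {ω : P.Sample | (ω.2.1, ω.2.2.1) ∈ s}
      = Prod.snd ⁻¹' {p | (p.1, p.2.1) ∈ s} := rfl
  have hm : MeasurableSet {p : (Fin P.n → Vec P.d) × Weights P.d P.m × (ℕ → Vec P.d) |
      (p.1, p.2.1) ∈ s} := by
    have : Measurable fun p : (Fin P.n → Vec P.d) × Weights P.d P.m × (ℕ → Vec P.d) =>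
      (p.1, p.2.1) := by fun_prop
    exact this hs
  rw [h1, law, prod_real_snd hm]
  refine prod_real_le hm fun ξ => ?_
  refine le_trans (le_of_eq ?_) (h ξ)
  exact prod_real_fst (measurable_prodMk_left hs)

lemma law_data_noise_le {s : Set ((Fin P.n → Vec P.d) × (ℕ → Vec P.d))} (hs : MeasurableSet s)
    {c : ℝ} (h : ∀ ξ, P.noiseLaw.real (Prod.mk ξ ⁻¹' s) ≤ c) :
    P.law.real {ω | (ω.2.1, ω.2.2.2) ∈ s} ≤ c := by
  have h1 : {ω : P.Sample | (ω.2.1, ω.2.2.2) ∈ s}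
      = Prod.snd ⁻¹' {p | (p.1, p.2.2) ∈ s} := rfl
  have hm : MeasurableSet {p : (Fin P.n → Vec P.d) × Weights P.d P.m × (ℕ → Vec P.d) |
      (p.1, p.2.2) ∈ s} := by
    have : Measurable fun p : (Fin P.n → Vec P.d) × Weights P.d P.m × (ℕ → Vec P.d) =>
      (p.1, p.2.2) := by fun_prop
    exact this hs
  rw [h1, law, prod_real_snd hm]
  refine prod_real_le hm fun ξ => ?_
  refine le_trans (le_of_eq ?_) (h ξ)
  exact prod_real_snd (measurable_prodMk_left hs)

end Marginals

end Setup

end PrivateCNN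

/-! ### Typical samples -/

namespace PrivateCNN

namespace Setup

variable (P : Setup)

/-- The typical samples, at confidence level `ζ`: every Gaussian inner product is at most `ζ`
standard deviations, the data noises have norm of order `‖ξ‖`, and for every data noise and every
sign a fixed fraction of the initial filters is at least one standard deviation along it. -/
structure Typical (ζ : ℝ) (ω : P.Sample) : Prop where
  lower : ∀ i, gaussTail / 4 * P.ξnorm ^ 2 ≤ ‖ω.2.1 i‖ ^ 2
  upper : ∀ i, ‖ω.2.1 i‖ ^ 2 ≤ ζ ^ 2 * P.ξnorm ^ 2
  cross : ∀ i' i, i' ≠ i → |inner ℝ (ω.2.1 i') (ω.2.1 i)| ≤ ζ * (P.σξ * ‖ω.2.1 i'‖)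
  orth : ∀ i, inner ℝ P.v (ω.2.1 i) = 0
  init_data : ∀ j r i, |inner ℝ (ω.2.1 i) (ω.2.2.1 j r)| ≤ ζ * (P.σ₀ * ‖ω.2.1 i‖)
  init_signal : ∀ j r, |inner ℝ P.v (ω.2.2.1 j r)| ≤ ζ * (P.σ₀ * ‖P.v‖)
  seeds : ∀ j i, gaussTail / 2 * P.m ≤ ∑ r, {g : Vec P.d |
    P.σ₀ * ‖ω.2.1 i‖ ≤ inner ℝ (ω.2.1 i) g}.indicator (fun _ => (1 : ℝ)) (ω.2.2.1 j r)
  noise_data : ∀ t ≤ P.T, ∀ i, |inner ℝ (ω.2.1 i) (∑ k ∈ Finset.Icc 1 t, ω.2.2.2 k)|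
    ≤ ζ * (√(t : ℝ) * (P.σz * ‖ω.2.1 i‖))
  noise_signal : ∀ t ≤ P.T, |inner ℝ P.v (∑ k ∈ Finset.Icc 1 t, ω.2.2.2 k)|
    ≤ ζ * (√(t : ℝ) * (P.σz * ‖P.v‖))

lemma σz_nonneg : 0 ≤ P.σz := by
  have h1 := P.sens_nonneg; have h2 := P.ε_pos
  have h3 : 0 ≤ P.ξnorm := mul_nonneg P.σξ_pos.le (Real.sqrt_nonneg _)
  unfold σz
  positivity

variable {P}

lemma measureReal_iUnion_le_card {Ω ι : Type*} [MeasurableSpace Ω] [Fintype ι] {μ : Measure Ω}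
    (s : ι → Set Ω) {c : ℝ} (h : ∀ i, μ.real (s i) ≤ c) :
    μ.real (⋃ i, s i) ≤ Fintype.card ι * c := by
  refine (measureReal_iUnion_fintype_le s).trans ?_
  calc ∑ i, μ.real (s i) ≤ ∑ _i : ι, c := Finset.sum_le_sum fun i _ => h i
    _ = _ := by simp

lemma law_not_lower {ζ : ℝ} (hζ : 0 ≤ ζ) (hd : ζ ^ 2 ≤ gaussTail / 4 * P.d) (i : Fin P.n) :
    P.law.real {ω | ‖ω.2.1 i‖ ^ 2 < gaussTail / 4 * P.ξnorm ^ 2}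
      ≤ Real.exp (-(gaussTail ^ 2 * P.d / 2)) + 2 * Real.exp (-ζ ^ 2 / 2) := by
  have hm : MeasurableSet {g : Vec P.d | ‖g‖ ^ 2 < gaussTail / 4 * P.ξnorm ^ 2} :=
    measurableSet_lt (by fun_prop) (by fun_prop)
  refine le_trans (le_of_eq ?_) (P.dataLaw_lower hζ hd)
  rw [← pi_real_eval i hm, ← P.law_data (measurable_pi_apply i hm)]
  rfl

lemma law_not_coord {ζ : ℝ} (hζ : 0 ≤ ζ) (p : Fin P.n × Fin P.d) :
    P.law.real {ω | ζ * P.σξ < |ω.2.1 p.1 p.2|} ≤ 2 * Real.exp (-ζ ^ 2 / 2) := by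
  have h := P.dataLaw_tail (EuclideanSpace.single p.2 (1 : ℝ)) hζ
  simp only [PiLp.norm_single, norm_one, mul_one, EuclideanSpace.inner_single_left,
    map_one, one_mul] at h
  have hm : MeasurableSet {g : Vec P.d | ζ * P.σξ < |g p.2|} :=
    measurableSet_lt (by fun_prop) (by fun_prop)
  refine le_trans (le_of_eq ?_) h
  rw [← pi_real_eval p.1 hm, ← P.law_data (measurable_pi_apply p.1 hm)]
  rfl

lemma law_not_cross {ζ : ℝ} (hζ : 0 ≤ ζ) (p : Fin P.n × Fin P.n) :
    P.law.real {ω | p.1 ≠ p.2 ∧ ζ * (P.σξ * ‖ω.2.1 p.1‖) < |inner ℝ (ω.2.1 p.1) (ω.2.1 p.2)|}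
      ≤ 2 * Real.exp (-ζ ^ 2 / 2) := by
  by_cases hp : p.1 = p.2
  · have : {ω : P.Sample | p.1 ≠ p.2 ∧
        ζ * (P.σξ * ‖ω.2.1 p.1‖) < |inner ℝ (ω.2.1 p.1) (ω.2.1 p.2)|} = ∅ := by
      ext ω; simp [hp]
    rw [this, measureReal_empty]
    positivity
  · have hm : MeasurableSet {x : Vec P.d × Vec P.d | ζ * (P.σξ * ‖x.1‖) < |inner ℝ x.1 x.2|} :=
      measurableSet_lt (by fun_prop) (by fun_prop)
    have h : (P.dataLaw.prod P.dataLaw).real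
        {x : Vec P.d × Vec P.d | ζ * (P.σξ * ‖x.1‖) < |inner ℝ x.1 x.2|}
        ≤ 2 * Real.exp (-ζ ^ 2 / 2) := prod_real_le hm fun x => P.dataLaw_tail x hζ
    have hm2 : MeasurableSet {f : Fin P.n → Vec P.d | (f p.1, f p.2) ∈
        {x : Vec P.d × Vec P.d | ζ * (P.σξ * ‖x.1‖) < |inner ℝ x.1 x.2|}} := by
      have : Measurable fun f : Fin P.n → Vec P.d => (f p.1, f p.2) := by fun_prop
      exact this hm
    refine le_trans (le_of_eq ?_) h
    rw [← pi_real_eval_pair hp hm, ← P.law_data hm2]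
    congr 1
    ext ω
    simp [hp]

lemma law_not_orth (i : Fin P.n) :
    P.law.real {ω | inner ℝ P.v (ω.2.1 i) ≠ 0} ≤ 0 := by
  have hm : MeasurableSet {g : Vec P.d | inner ℝ P.v g ≠ 0} := by
    have : Measurable fun g : Vec P.d => inner ℝ P.v g := by fun_prop
    exact this (measurableSet_singleton (0 : ℝ)).compl
  refine le_of_eq (Eq.trans ?_ P.dataLaw_inner_v)
  rw [← pi_real_eval i hm, ← P.law_data (measurable_pi_apply i hm)]
  rfl

lemma law_not_init_data {ζ : ℝ} (hζ : 0 ≤ ζ) (p : Bool × Fin P.m × Fin P.n) :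
    P.law.real {ω | ζ * (P.σ₀ * ‖ω.2.1 p.2.2‖) < |inner ℝ (ω.2.1 p.2.2) (ω.2.2.1 p.1 p.2.1)|}
      ≤ 2 * Real.exp (-ζ ^ 2 / 2) := by
  have hm : MeasurableSet {x : (Fin P.n → Vec P.d) × Weights P.d P.m |
      ζ * (P.σ₀ * ‖x.1 p.2.2‖) < |inner ℝ (x.1 p.2.2) (x.2 p.1 p.2.1)|} :=
    measurableSet_lt (by fun_prop) (by fun_prop)
  refine P.law_data_init_le hm fun ξ => ?_
  have hm2 : MeasurableSet {g : Vec P.d | ζ * (P.σ₀ * ‖ξ p.2.2‖) < |inner ℝ (ξ p.2.2) g|} :=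
    measurableSet_lt (by fun_prop) (by fun_prop)
  refine le_trans (le_of_eq ?_) (P.isoGaussian_tail P.σ₀_pos.le (ξ p.2.2) hζ)
  rw [← pi_real_eval p.2.1 hm2, ← pi_real_eval p.1 (measurable_pi_apply p.2.1 hm2)]
  rfl

lemma law_not_init_signal {ζ : ℝ} (hζ : 0 ≤ ζ) (p : Bool × Fin P.m) :
    P.law.real {ω | ζ * (P.σ₀ * ‖P.v‖) < |inner ℝ P.v (ω.2.2.1 p.1 p.2)|}
      ≤ 2 * Real.exp (-ζ ^ 2 / 2) := by
  have hm2 : MeasurableSet {g : Vec P.d | ζ * (P.σ₀ * ‖P.v‖) < |inner ℝ P.v g|} :=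
    measurableSet_lt (by fun_prop) (by fun_prop)
  refine le_trans (le_of_eq ?_) (P.isoGaussian_tail P.σ₀_pos.le P.v hζ)
  rw [← pi_real_eval p.2 hm2, ← pi_real_eval p.1 (measurable_pi_apply p.2 hm2),
    ← P.law_init (measurable_pi_apply p.1 (measurable_pi_apply p.2 hm2))]
  rfl

lemma law_not_seeds (p : Bool × Fin P.n) :
    P.law.real {ω | ∑ r, {g : Vec P.d | P.σ₀ * ‖ω.2.1 p.2‖ ≤ inner ℝ (ω.2.1 p.2) g}.indicator
      (fun _ => (1 : ℝ)) (ω.2.2.1 p.1 r) < gaussTail / 2 * P.m}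
      ≤ Real.exp (-(gaussTail ^ 2 * P.m / 2)) := by
  have hA : MeasurableSet {x : Vec P.d × Vec P.d | P.σ₀ * ‖x.1‖ ≤ inner ℝ x.1 x.2} :=
    measurableSet_le (by fun_prop) (by fun_prop)
  have hind : ∀ (x g : Vec P.d), {g : Vec P.d | P.σ₀ * ‖x‖ ≤ inner ℝ x g}.indicator
      (fun _ => (1 : ℝ)) g = {x : Vec P.d × Vec P.d | P.σ₀ * ‖x.1‖ ≤ inner ℝ x.1 x.2}.indicator
      (fun _ => (1 : ℝ)) (x, g) := fun x g => rfl
  have hmeas : Measurable ({x : Vec P.d × Vec P.d | P.σ₀ * ‖x.1‖ ≤ inner ℝ x.1 x.2}.indicator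
      (fun _ => (1 : ℝ))) := measurable_const.indicator hA
  have hm : MeasurableSet {x : (Fin P.n → Vec P.d) × Weights P.d P.m |
      ∑ r, {g : Vec P.d | P.σ₀ * ‖x.1 p.2‖ ≤ inner ℝ (x.1 p.2) g}.indicator
      (fun _ => (1 : ℝ)) (x.2 p.1 r) < gaussTail / 2 * P.m} := by
    simp only [hind]
    exact measurableSet_lt (by fun_prop) (by fun_prop)
  refine P.law_data_init_le hm fun ξ => ?_
  have hA2 : MeasurableSet {g : Vec P.d | P.σ₀ * ‖ξ p.2‖ ≤ inner ℝ (ξ p.2) g} :=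
    measurableSet_le (by fun_prop) (by fun_prop)
  have hm2 : MeasurableSet {f : Fin P.m → Vec P.d |
      ∑ r, {g : Vec P.d | P.σ₀ * ‖ξ p.2‖ ≤ inner ℝ (ξ p.2) g}.indicator
      (fun _ => (1 : ℝ)) (f r) < gaussTail / 2 * P.m} := by
    have : Measurable ({g : Vec P.d | P.σ₀ * ‖ξ p.2‖ ≤ inner ℝ (ξ p.2) g}.indicator
        (fun _ => (1 : ℝ))) := measurable_const.indicator hA2
    exact measurableSet_lt (by fun_prop) (by fun_prop)
  refine le_trans (le_of_eq ?_) (pi_count_lt_le P.m hA2 gaussTail_pos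
    (P.gaussTail_le_isoGaussian P.σ₀_pos.le (ξ p.2)))
  rw [← pi_real_eval p.1 hm2]
  rfl

lemma law_not_noise_data {ζ : ℝ} (hζ : 0 ≤ ζ) (p : Fin (P.T + 1) × Fin P.n) :
    P.law.real {ω | ζ * (√((p.1 : ℕ) : ℝ) * (P.σz * ‖ω.2.1 p.2‖))
      < |inner ℝ (ω.2.1 p.2) (∑ k ∈ Finset.Icc 1 (p.1 : ℕ), ω.2.2.2 k)|}
      ≤ 2 * Real.exp (-ζ ^ 2 / 2) := by
  have hm : MeasurableSet {x : (Fin P.n → Vec P.d) × (ℕ → Vec P.d) |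
      ζ * (√((p.1 : ℕ) : ℝ) * (P.σz * ‖x.1 p.2‖))
        < |inner ℝ (x.1 p.2) (∑ k ∈ Finset.Icc 1 (p.1 : ℕ), x.2 k)|} :=
    measurableSet_lt (by fun_prop) (by fun_prop)
  exact P.law_data_noise_le hm fun ξ => P.isoGaussian_sum_tail P.σz_nonneg (ξ p.2) hζ p.1

lemma law_not_noise_signal {ζ : ℝ} (hζ : 0 ≤ ζ) (t : Fin (P.T + 1)) :
    P.law.real {ω | ζ * (√((t : ℕ) : ℝ) * (P.σz * ‖P.v‖))
      < |inner ℝ P.v (∑ k ∈ Finset.Icc 1 (t : ℕ), ω.2.2.2 k)|}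
      ≤ 2 * Real.exp (-ζ ^ 2 / 2) := by
  have hm : MeasurableSet {z : ℕ → Vec P.d | ζ * (√((t : ℕ) : ℝ) * (P.σz * ‖P.v‖))
      < |inner ℝ P.v (∑ k ∈ Finset.Icc 1 (t : ℕ), z k)|} :=
    measurableSet_lt (by fun_prop) (by fun_prop)
  refine le_trans (le_of_eq ?_) (P.isoGaussian_sum_tail P.σz_nonneg P.v hζ t)
  rw [← P.law_noise hm]
  rfl

/-- The union bound over all the events of `Typical`. -/
lemma law_not_typical_le {ζ : ℝ} (hζ : 0 ≤ ζ) (hd : ζ ^ 2 ≤ gaussTail / 4 * P.d) :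
    P.law.real {ω | ¬ P.Typical ζ ω} ≤
      P.n * Real.exp (-(gaussTail ^ 2 * P.d / 2)) + 2 * P.n * Real.exp (-(gaussTail ^ 2 * P.m / 2))
      + 2 * (P.n + P.n * P.d + P.n * P.n + 2 * (P.m * P.n) + 2 * P.m + (P.T + 1) * P.n
        + (P.T + 1)) * Real.exp (-ζ ^ 2 / 2) := by
  have h1 := measureReal_iUnion_le_card _ (law_not_lower (P := P) hζ hd)
  have h2 := measureReal_iUnion_le_card _ (law_not_coord (P := P) hζ)
  have h3 := measureReal_iUnion_le_card _ (law_not_cross (P := P) hζ)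
  have h4 := measureReal_iUnion_le_card _ (law_not_orth (P := P))
  have h5 := measureReal_iUnion_le_card _ (law_not_init_data (P := P) hζ)
  have h6 := measureReal_iUnion_le_card _ (law_not_init_signal (P := P) hζ)
  have h7 := measureReal_iUnion_le_card _ (law_not_seeds (P := P))
  have h8 := measureReal_iUnion_le_card _ (law_not_noise_data (P := P) hζ)
  have h9 := measureReal_iUnion_le_card _ (law_not_noise_signal (P := P) hζ)
  have hU : ∀ {A B : Set P.Sample} {a b : ℝ}, P.law.real A ≤ a → P.law.real B ≤ b →
      P.law.real (A ∪ B) ≤ a + b := fun hA hB =>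
    (measureReal_union_le _ _).trans (add_le_add hA hB)
  have hall := hU h1 (hU h2 (hU h3 (hU h4 (hU h5 (hU h6 (hU h7 (hU h8 h9)))))))
  refine (measureReal_mono ?_).trans (hall.trans (le_of_eq ?_))
  · intro ω hω
    by_contra hcon
    simp only [Set.mem_union, Set.mem_iUnion, Set.mem_ofPred_eq, not_or, not_exists, not_lt,
      Prod.forall, not_and, not_not, Fin.forall_iff] at hcon
    obtain ⟨g1, g2, g3, g4, g5, g6, g7, g8, g9⟩ := hcon
    refine hω ⟨fun i => g1 i i.2, fun i => ?_, fun i' i h => ?_, fun i => g4 i i.2,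
      fun j r i => g5 j r r.2 i i.2, fun j r => g6 j r r.2, fun j i => g7 j i i.2,
      fun t ht i => g8 t (by omega) i i.2, fun t ht => g9 t (by omega)⟩
    · have hc : ∀ a, (ω.2.1 i a) ^ 2 ≤ (ζ * P.σξ) ^ 2 := fun a =>
        sq_le_sq' (by linarith [(abs_le.1 (g2 i i.2 a a.2)).1]) (abs_le.1 (g2 i i.2 a a.2)).2
      rw [EuclideanSpace.real_norm_sq_eq]
      calc ∑ a, (ω.2.1 i a) ^ 2 ≤ ∑ _a : Fin P.d, (ζ * P.σξ) ^ 2 :=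
            Finset.sum_le_sum fun a _ => hc a
        _ = ζ ^ 2 * P.ξnorm ^ 2 := by
            rw [ξnorm, mul_pow P.σξ, Real.sq_sqrt (Nat.cast_nonneg _)]
            simp
            ring
    · exact g3 i' i'.2 i i.2 (fun hh => h (by simpa using hh))
  · simp only [Fintype.card_prod, Fintype.card_fin, Fintype.card_bool]
    push_cast
    ring

end Setup

end PrivateCNN

/-! ### Calibration of the parameters and the growth conditions -/

namespace PrivateCNN

/-- The rate constant of the first stage: a seed is multiplied by `(10/(σ₀‖ξ‖)) * (12/gaussTail)`
within a quarter of `stageRate q * log (10/(σ₀‖ξ‖)) * n m / (η ‖ξ‖² (σ₀‖ξ‖)^{q-2})` steps. -/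
def stageRate (q : ℝ) : ℝ :=
  16 * (1 + Real.log (12 / gaussTail)) /
    ((gaussTail / 4) ^ (q - 1) * q * Real.exp (-((3 : ℝ) ^ q + 1)))

lemma one_le_twelve_div : 1 ≤ 12 / gaussTail := by
  rw [le_div_iff₀ gaussTail_pos]; linarith [gaussTail_le_one]

lemma stageRate_pos {q : ℝ} (hq : 0 < q) : 0 < stageRate q := by
  have := gaussTail_pos
  have := Real.log_nonneg one_le_twelve_div
  unfold stageRate
  positivity

/-- The constant `c` in the length of the first stage. -/
def stageConst (q : ℝ) : ℝ := stageRate q * (0.15 : ℝ) ^ (q - 2) * q / 4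

lemma stageConst_pos {q : ℝ} (hq : 0 < q) : 0 < stageConst q := by
  have := stageRate_pos hq
  unfold stageConst
  positivity

lemma exp_half_mul_le_one_add_pow {x : ℝ} (h0 : 0 ≤ x) (h1 : x ≤ 1) (k : ℕ) :
    Real.exp (x * k / 2) ≤ (1 + x) ^ k := by
  have h2 : x / 2 ≤ Real.log (1 + x) := by
    refine le_trans ?_ (Real.one_sub_inv_le_log_of_pos (by linarith))
    have : 1 - (1 + x)⁻¹ = x / (1 + x) := by field_simp; ring
    rw [this]
    exact div_le_div_of_nonneg_left h0 (by linarith) (by linarith)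
  calc Real.exp (x * k / 2) = Real.exp (x / 2) ^ k := by rw [← Real.exp_nat_mul]; ring_nf
    _ ≤ (1 + x) ^ k := by
      refine pow_le_pow_left₀ (Real.exp_nonneg _) ?_ k
      calc Real.exp (x / 2) ≤ Real.exp (Real.log (1 + x)) := Real.exp_le_exp.2 h2
        _ = 1 + x := Real.exp_log (by linarith)

namespace Setup

variable (P : Setup)

/-- The size `σ₀ ‖ξ‖` of the inner products of the initial filters with the data noises. -/
def initSize : ℝ := P.σ₀ * P.ξnorm

lemma d_pos : 0 < P.d := by
  rcases Nat.eq_zero_or_pos P.d with h | h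
  · exfalso
    apply P.v_ne
    ext i
    exact absurd i.2 (by omega)
  · exact h

lemma d_pos' : (0 : ℝ) < P.d := by exact_mod_cast P.d_pos
lemma n_pos' : (0 : ℝ) < P.n := by exact_mod_cast P.n_pos
lemma m_pos' : (0 : ℝ) < P.m := by exact_mod_cast P.m_pos
lemma one_le_n : (1 : ℝ) ≤ P.n := by exact_mod_cast P.n_pos
lemma one_le_m : (1 : ℝ) ≤ P.m := by exact_mod_cast P.m_pos

lemma ξnorm_pos : 0 < P.ξnorm := mul_pos P.σξ_pos (Real.sqrt_pos.2 P.d_pos')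

lemma initSize_pos : 0 < P.initSize := mul_pos P.σ₀_pos P.ξnorm_pos

/-- The length of the first stage before rounding up. -/
def stageLength (q : ℝ) : ℝ :=
  stageRate q * Real.log (10 / P.initSize) * (P.n * P.m)
    / (P.η * P.ξnorm ^ 2 * P.initSize ^ (q - 2))

lemma T₁_stageConst {q : ℝ} (hq : 2 < q) : P.T₁ q (stageConst q) = ⌈P.stageLength q⌉₊ := by
  have h1 := P.ξnorm_pos; have h2 := P.σ₀_pos; have h3 := P.η_pos
  have h4 : P.ξnorm ^ q = P.ξnorm ^ (q - 2) * P.ξnorm ^ 2 := by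
    rw [← Real.rpow_natCast, ← Real.rpow_add h1]; norm_num
  have h5 : (0 : ℝ) < 0.15 ^ (q - 2) := by positivity
  have h6 : 0 < P.ξnorm ^ (q - 2) := by positivity
  have h7 : 0 < P.σ₀ ^ (q - 2) := by positivity
  have h8 : q ≠ 0 := by linarith
  unfold T₁ stageLength stageConst initSize
  congr 1
  rw [h4, Real.mul_rpow h2.le h1.le]
  generalize (0.15 : ℝ) ^ (q - 2) = x at *
  field_simp

/-- The parameters are in the regime of data noise memorization, with all polylogarithmic factors
measured by powers of a single number `Z`.  The number `ζ` is the confidence level, `θ` the level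
at which the coefficients saturate, and `G` the level that they reach in the first stage. -/
structure Calibrated (q ζ θ G Z : ℝ) (N : ℕ) : Prop where
  two_lt : 2 < q
  le_N : 6 * ⌈q⌉₊ + 20 ≤ N
  two_le_N_mul : 2 ≤ N * (q - 2)
  le_Z : 1000 / gaussTail ≤ Z
  q_le : q ≤ Z
  rate_le : 2 * stageRate q ≤ Z
  four_le_rate : 4 ≤ stageRate q * Z
  late_rate : 1 ≤ Z * (stageRate q * gaussTail * q * Real.exp (-((G + 1) ^ q + 1)) / 128)
  ζ_nonneg : 0 ≤ ζ
  ζ_le : 2 * ζ ≤ gaussTail * Z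
  two_le_θ : 2 ≤ θ
  θ_le : θ + 3 ≤ Z
  horizon : P.T * Real.exp (2 - θ) ≤ 1
  two_le_G : 2 ≤ G
  G_le : P.m * G ≤ Real.exp Z
  sens_le : P.sens * √(2 * Real.log (1.25 / P.δ)) ≤ Z ^ 2
  time_le : P.η * P.T * (‖P.v‖ + P.ξnorm) ≤ Z * P.m * P.n * P.ε * P.σ₀
  log_le : Real.log (10 / P.initSize) ≤ Z
  le_init : Z ^ (2 * N) ≤ P.ε * P.initSize ^ q
  init_le : Z ^ N * P.initSize ≤ 1
  signal_le : Z ^ N * (P.n * P.snr ^ q) ≤ 1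
  norm_v_le : ‖P.v‖ ≤ P.ξnorm
  init_dim : Z ^ N * P.n ≤ P.initSize * √(P.d : ℝ)
  step_le : Z ^ N * (P.η * P.ξnorm ^ 2) ≤ 1
  dim_le : Z ^ N * (P.m ^ 2 * P.n ^ 4) ≤ P.d
  T₁_le : P.T₁ q (stageConst q) ≤ P.T

namespace Calibrated

variable {P} {q ζ θ G Z : ℝ} {N : ℕ} (h : P.Calibrated q ζ θ G Z N)
include h

lemma thousand_le : 1000 ≤ Z * gaussTail := by
  have := h.le_Z
  rwa [div_le_iff₀ gaussTail_pos] at this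

lemma Z_ge : 1000 ≤ Z := by
  have h1 := h.thousand_le; have h2 := gaussTail_le_one; have h3 := gaussTail_pos
  by_contra hc
  push Not at hc
  nlinarith

lemma Z_pos : 0 < Z := by linarith [h.Z_ge]

lemma one_le_Z : 1 ≤ Z := by linarith [h.Z_ge]

lemma pow_le {k : ℕ} (hk : k ≤ 6 * ⌈q⌉₊ + 20) : Z ^ k ≤ Z ^ N :=
  pow_le_pow_right₀ h.one_le_Z (hk.trans h.le_N)

lemma rpow_le {x : ℝ} (hx : x ≤ q) : Z ^ x ≤ Z ^ ⌈q⌉₊ := by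
  rw [← Real.rpow_natCast]
  exact Real.rpow_le_rpow_of_exponent_le h.one_le_Z (hx.trans (Nat.le_ceil q))

lemma init_small {k : ℕ} (hk : k ≤ 6 * ⌈q⌉₊ + 20) : Z ^ k * P.initSize ≤ 1 :=
  (mul_le_mul_of_nonneg_right (h.pow_le hk) P.initSize_pos.le).trans h.init_le

lemma step_small {k : ℕ} (hk : k ≤ 6 * ⌈q⌉₊ + 20) : Z ^ k * (P.η * P.ξnorm ^ 2) ≤ 1 := by
  have := P.η_pos
  exact (mul_le_mul_of_nonneg_right (h.pow_le hk) (by positivity)).trans h.step_le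

lemma signal_small {k : ℕ} (hk : k ≤ 6 * ⌈q⌉₊ + 20) : Z ^ k * (P.n * P.snr ^ q) ≤ 1 := by
  have : 0 ≤ P.snr := div_nonneg (norm_nonneg _) P.ξnorm_pos.le
  exact (mul_le_mul_of_nonneg_right (h.pow_le hk) (by positivity)).trans h.signal_le

lemma init_le_one : P.initSize ≤ 1 := by simpa using h.init_small (k := 0) (by omega)

lemma one_le_log : 1 ≤ Real.log (10 / P.initSize) := by
  rw [Real.le_log_iff_exp_le (by have := P.initSize_pos; positivity),
    le_div_iff₀ P.initSize_pos]
  have := Real.exp_one_lt_d9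
  nlinarith [h.init_le_one, P.initSize_pos, Real.exp_pos 1]

lemma q_pos : 0 < q := by linarith [h.two_lt]

lemma initSize_rpow_le_one : P.initSize ^ (q - 2) ≤ 1 :=
  Real.rpow_le_one P.initSize_pos.le h.init_le_one (by linarith [h.two_lt])

lemma stageLength_ge : 4 ≤ P.stageLength q := by
  have h1 := P.ξnorm_pos; have h2 := P.initSize_pos; have h3 := P.η_pos
  have h4 := h.step_small (k := 1) (by omega)
  rw [pow_one] at h4
  have h5 : P.η * P.ξnorm ^ 2 * P.initSize ^ (q - 2) ≤ P.η * P.ξnorm ^ 2 :=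
    mul_le_of_le_one_right (by positivity) h.initSize_rpow_le_one
  have h6 : (1 : ℝ) ≤ P.n * P.m := one_le_mul_of_one_le_of_one_le P.one_le_n P.one_le_m
  have h7 := stageRate_pos h.q_pos
  rw [stageLength, le_div_iff₀ (by positivity)]
  calc 4 * (P.η * P.ξnorm ^ 2 * P.initSize ^ (q - 2))
      ≤ stageRate q * Z * (P.η * P.ξnorm ^ 2) := by
        have := h.four_le_rate
        gcongr
    _ = stageRate q * (Z * (P.η * P.ξnorm ^ 2)) := by ring
    _ ≤ stageRate q * 1 * 1 := by rw [mul_one]; gcongr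
    _ ≤ _ := by
        have := h.one_le_log
        gcongr

lemma T₁_eq : P.T₁ q (stageConst q) = ⌈P.stageLength q⌉₊ := P.T₁_stageConst h.two_lt

lemma stageLength_le : P.stageLength q ≤ P.T₁ q (stageConst q) := by
  rw [h.T₁_eq]; exact Nat.le_ceil _

lemma T₁_le_two_mul : (P.T₁ q (stageConst q) : ℝ) ≤ 2 * P.stageLength q := by
  rw [h.T₁_eq]
  have := h.stageLength_ge
  have := Nat.ceil_lt_add_one (a := P.stageLength q) (by linarith)
  linarith

lemma T₁_pos : 0 < P.T₁ q (stageConst q) := by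
  have : (0 : ℝ) < P.T₁ q (stageConst q) := by linarith [h.stageLength_ge, h.stageLength_le]
  exact_mod_cast this

lemma quarter_le_half_T₁ : P.stageLength q / 4 ≤ (P.T₁ q (stageConst q) / 2 : ℕ) := by
  have h1 := h.stageLength_ge; have h2 := h.stageLength_le
  have h3 : P.T₁ q (stageConst q) ≤ 2 * (P.T₁ q (stageConst q) / 2) + 1 := by omega
  have h4 : (P.T₁ q (stageConst q) : ℝ) ≤ 2 * (P.T₁ q (stageConst q) / 2 : ℕ) + 1 := by
    exact_mod_cast h3
  linarith

lemma quarter_le_rest : P.stageLength q / 4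
    ≤ (P.T₁ q (stageConst q) - P.T₁ q (stageConst q) / 2 : ℕ) := by
  refine h.quarter_le_half_T₁.trans ?_
  exact_mod_cast (by omega)

lemma η_mul_T₁_le : P.η * P.T₁ q (stageConst q)
    ≤ Z ^ 2 * (P.m * P.n) / (P.ξnorm ^ 2 * P.initSize ^ (q - 2)) := by
  have h1 := P.ξnorm_pos; have h2 := P.initSize_pos; have h3 := P.η_pos
  have h7 := stageRate_pos h.q_pos
  calc P.η * P.T₁ q (stageConst q) ≤ P.η * (2 * P.stageLength q) := by
        have := h.T₁_le_two_mul
        gcongr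
    _ = (2 * stageRate q) * Real.log (10 / P.initSize) * (P.m * P.n)
          / (P.ξnorm ^ 2 * P.initSize ^ (q - 2)) := by
        unfold stageLength; field_simp
    _ ≤ Z * Z * (P.m * P.n) / (P.ξnorm ^ 2 * P.initSize ^ (q - 2)) := by
        have := h.rate_le; have := h.log_le
        have := h.one_le_log; have := h.Z_pos
        gcongr
    _ = _ := by ring

lemma growth_early : 3 ≤ gaussTail / 2 * P.initSize / 2 * (1 + P.η * (gaussTail / 4 * P.ξnorm ^ 2)
    * q * (Real.exp (-((3 : ℝ) ^ q + 1)) / 2) * (gaussTail / 2 * P.initSize / 2) ^ (q - 2)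
    / (P.n * P.m)) ^ (P.T₁ q (stageConst q) / 2) := by
  have h1 := P.ξnorm_pos; have h2 := P.initSize_pos; have h3 := P.η_pos
  have h4 := gaussTail_pos; have h5 := P.n_pos'; have h6 := P.m_pos'; have h7 := h.q_pos
  have hE : Real.exp (-((3 : ℝ) ^ q + 1)) ≤ 1 := by
    rw [Real.exp_le_one_iff]; have : (0 : ℝ) < 3 ^ q := by positivity
    linarith
  set x := P.η * (gaussTail / 4 * P.ξnorm ^ 2)
    * q * (Real.exp (-((3 : ℝ) ^ q + 1)) / 2) * (gaussTail / 2 * P.initSize / 2) ^ (q - 2)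
    / (P.n * P.m) with hx
  have hx0 : 0 ≤ x := by positivity
  have hs := h.step_small (k := 1) (by omega)
  rw [pow_one] at hs
  have hx1 : x ≤ 1 := by
    have e1 : (gaussTail / 2 * P.initSize / 2) ^ (q - 2) ≤ 1 :=
      Real.rpow_le_one (by positivity)
        (by nlinarith [h.init_le_one, gaussTail_le_one]) (by linarith [h.two_lt])
    have e2 : (1 : ℝ) ≤ P.n * P.m := one_le_mul_of_one_le_of_one_le P.one_le_n P.one_le_m
    rw [hx]
    refine (div_le_self (by positivity) e2).trans ?_
    calc _ ≤ P.η * (1 * P.ξnorm ^ 2) * Z * 1 * 1 := by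
          have := h.q_le; have := h.Z_pos
          have g1 : gaussTail / 4 ≤ 1 := by linarith [gaussTail_le_one]
          gcongr
          linarith
      _ = Z * (P.η * P.ξnorm ^ 2) := by ring
      _ ≤ 1 := hs
  have hrate : x * P.stageLength q = 8 * ((1 + Real.log (12 / gaussTail))
      * Real.log (10 / P.initSize)) := by
    have e1 : (gaussTail / 2 * P.initSize / 2) ^ (q - 2)
        = (gaussTail / 4) ^ (q - 2) * P.initSize ^ (q - 2) := by
      rw [← Real.mul_rpow (by positivity) h2.le]; ring_nf
    have e2 : (gaussTail / 4) ^ (q - 1) = (gaussTail / 4) ^ (q - 2) * (gaussTail / 4) := by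
      rw [show q - 1 = q - 2 + 1 by ring, Real.rpow_add_one (by positivity)]
    have e3 : 0 < (gaussTail / 4) ^ (q - 2) := by positivity
    rw [hx, stageLength, stageRate, e1, e2]
    field_simp
    ring
  -- both logarithms are nonnegative and the first is at least `1`, so that their sum is at most
  -- `(1 + log (12 / gaussTail)) * log (10 / initSize)`
  have hkey : Real.log (10 / P.initSize) + Real.log (12 / gaussTail)
      ≤ x * (P.T₁ q (stageConst q) / 2 : ℕ) / 2 := by
    have e1 := mul_le_mul_of_nonneg_left h.quarter_le_half_T₁ hx0
    have e2 := h.one_le_log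
    have e3 := Real.log_nonneg one_le_twelve_div
    nlinarith
  calc (3 : ℝ) ≤ gaussTail / 2 * P.initSize / 2 * (10 / P.initSize * (12 / gaussTail)) := by
        have : gaussTail / 2 * P.initSize / 2 * (10 / P.initSize * (12 / gaussTail)) = 30 := by
          field_simp; norm_num
        rw [this]; norm_num
    _ = gaussTail / 2 * P.initSize / 2
          * Real.exp (Real.log (10 / P.initSize) + Real.log (12 / gaussTail)) := by
        rw [Real.exp_add, Real.exp_log (by positivity), Real.exp_log (by positivity)]
    _ ≤ _ := by
        have := (Real.exp_le_exp.2 hkey).trans (exp_half_mul_le_one_add_pow hx0 hx1 _)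
        gcongr

lemma growth_late : P.m * G < 2 * (1 + P.η * (gaussTail / 4 * P.ξnorm ^ 2)
    * q * (Real.exp (-((G + 1) ^ q + 1)) / 2) / (2 * (P.n * P.m)))
      ^ (P.T₁ q (stageConst q) - P.T₁ q (stageConst q) / 2) := by
  have h1 := P.ξnorm_pos; have h2 := P.initSize_pos; have h3 := P.η_pos
  have h4 := gaussTail_pos; have h5 := P.n_pos'; have h6 := P.m_pos'; have h7 := h.q_pos
  have hG := h.two_le_G
  have hE : Real.exp (-((G + 1) ^ q + 1)) ≤ 1 := by
    rw [Real.exp_le_one_iff]; have : (0 : ℝ) < (G + 1) ^ q := by positivity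
    linarith
  set x := P.η * (gaussTail / 4 * P.ξnorm ^ 2)
    * q * (Real.exp (-((G + 1) ^ q + 1)) / 2) / (2 * (P.n * P.m)) with hx
  have hx0 : 0 ≤ x := by positivity
  have hs := h.step_small (k := 1) (by omega)
  rw [pow_one] at hs
  have hx1 : x ≤ 1 := by
    have e2 : (1 : ℝ) ≤ P.n * P.m := one_le_mul_of_one_le_of_one_le P.one_le_n P.one_le_m
    rw [hx]
    refine (div_le_self (by positivity) (by linarith)).trans ?_
    calc _ ≤ P.η * (1 * P.ξnorm ^ 2) * Z * 1 := by
          have := h.q_le; have := h.Z_pos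
          have g1 : gaussTail / 4 ≤ 1 := by linarith [gaussTail_le_one]
          gcongr
          linarith
      _ = Z * (P.η * P.ξnorm ^ 2) := by ring
      _ ≤ 1 := hs
  have hap : 0 < P.initSize ^ (q - 2) := by positivity
  have hrate : x * P.stageLength q / 8
      = (stageRate q * gaussTail * q * Real.exp (-((G + 1) ^ q + 1)) / 128)
        * (Real.log (10 / P.initSize) / P.initSize ^ (q - 2)) := by
    rw [hx, stageLength]
    field_simp
    ring
  -- a power of the separation between `initSize` and `1` pays for the logarithm of `m * G`
  have hlarge : Z ^ 2 ≤ Real.log (10 / P.initSize) / P.initSize ^ (q - 2) := by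
    rw [le_div_iff₀ hap]
    refine le_trans ?_ h.one_le_log
    have e1 : Z ^ 2 ≤ (Z ^ N) ^ (q - 2) := by
      rw [← Real.rpow_natCast Z N, ← Real.rpow_mul h.Z_pos.le, ← Real.rpow_natCast Z 2]
      exact Real.rpow_le_rpow_of_exponent_le h.one_le_Z (by simpa using h.two_le_N_mul)
    calc Z ^ 2 * P.initSize ^ (q - 2) ≤ (Z ^ N) ^ (q - 2) * P.initSize ^ (q - 2) := by gcongr
      _ = (Z ^ N * P.initSize) ^ (q - 2) :=
          (Real.mul_rpow (by have := h.Z_pos; positivity) h2.le).symm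
      _ ≤ 1 := Real.rpow_le_one (by have := h.Z_pos; positivity) h.init_le
          (by linarith [h.two_lt])
  have hkey : Z ≤ x * (P.T₁ q (stageConst q) - P.T₁ q (stageConst q) / 2 : ℕ) / 2 := by
    have e1 := mul_le_mul_of_nonneg_left h.quarter_le_rest hx0
    have e2 : Z ≤ x * P.stageLength q / 8 := by
      rw [hrate]
      have e3 := h.late_rate
      have e4 : 0 ≤ stageRate q * gaussTail * q * Real.exp (-((G + 1) ^ q + 1)) / 128 := by
        have := stageRate_pos h7
        positivity
      have e5 := h.Z_pos
      calc Z = 1 * Z := (one_mul Z).symm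
        _ ≤ Z * (stageRate q * gaussTail * q * Real.exp (-((G + 1) ^ q + 1)) / 128) * Z := by
            gcongr
        _ = (stageRate q * gaussTail * q * Real.exp (-((G + 1) ^ q + 1)) / 128) * Z ^ 2 := by ring
        _ ≤ _ := by gcongr
    linarith
  have := (Real.exp_le_exp.2 hkey).trans (exp_half_mul_le_one_add_pow hx0 hx1 _)
  have h8 := h.G_le
  have h9 := Real.exp_pos Z
  linarith

end Calibrated

end Setup

end PrivateCNN

/-! ### The smallness conditions of the regime -/

namespace PrivateCNN

namespace Setup

variable {P : Setup}

namespace Calibrated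

variable {q ζ θ G Z : ℝ} {N : ℕ} (h : P.Calibrated q ζ θ G Z N)
include h

lemma ζ_le_Z : ζ ≤ Z := by
  have h1 := h.ζ_le; have h2 := gaussTail_le_one; have h3 := h.Z_pos; have h4 := h.ζ_nonneg
  nlinarith

lemma sqrt_d_ge {k : ℕ} (hk : k ≤ 3 * ⌈q⌉₊ + 10) : Z ^ k * (P.m * P.n ^ 2) ≤ √(P.d : ℝ) := by
  refine Real.le_sqrt_of_sq_le ?_
  refine le_trans ?_ h.dim_le
  have h1 := h.pow_le (k := 2 * k) (by omega)
  calc (Z ^ k * (P.m * P.n ^ 2)) ^ 2 = Z ^ (2 * k) * (P.m ^ 2 * P.n ^ 4 : ℝ) := by ring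
    _ ≤ _ := by gcongr

/-- The private noise of the whole run moves the filters by much less than their initial size,
up to logarithms: this is the permissible number of iterations. -/
lemma η_mul_σz_mul_sqrt_le : P.η * (P.σz * √(P.T : ℝ)) ≤ Z ^ 3 * P.σ₀ := by
  have h1 := P.ξnorm_pos; have h3 := P.η_pos
  have h5 := P.n_pos'; have h6 := P.m_pos'; have h7 := P.ε_pos; have h8 := h.Z_pos
  have h9 := P.σ₀_pos; have hS := P.sens_nonneg
  have hlog : √(2 * P.T * Real.log (1.25 / P.δ)) * √(P.T : ℝ)
      = √(2 * Real.log (1.25 / P.δ)) * P.T := by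
    rw [show 2 * (P.T : ℝ) * Real.log (1.25 / P.δ) = P.T * (2 * Real.log (1.25 / P.δ)) by ring,
      Real.sqrt_mul (Nat.cast_nonneg _), mul_comm (√(P.T : ℝ)), mul_assoc,
      Real.mul_self_sqrt (Nat.cast_nonneg _)]
  calc P.η * (P.σz * √(P.T : ℝ))
      = P.η * (P.sens * (‖P.v‖ + P.ξnorm) / (P.n * P.m) / P.ε)
        * (√(2 * P.T * Real.log (1.25 / P.δ)) * √(P.T : ℝ)) := by unfold σz; ring
    _ = (P.sens * √(2 * Real.log (1.25 / P.δ))) * (P.η * P.T * (‖P.v‖ + P.ξnorm))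
          / (P.n * P.m * P.ε) := by rw [hlog]; field_simp
    _ ≤ Z ^ 2 * (Z * P.m * P.n * P.ε * P.σ₀) / (P.n * P.m * P.ε) := by
        have := h.sens_le; have := h.time_le
        gcongr
    _ = _ := by field_simp

/-- The private noise of the first stage is negligible against the initial filters.  The variance
is a geometric mean of the permissible number of iterations and the length of the first stage. -/
lemma η_mul_σz_mul_sqrt_T₁_le :
    P.η * (P.σz * √(P.T₁ q (stageConst q) : ℝ)) ≤ gaussTail / 8 * P.σ₀ / Z ^ 2 := by
  have h1 := P.ξnorm_pos; have h3 := P.η_pos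
  have h5 := P.n_pos'; have h6 := P.m_pos'; have h7 := P.ε_pos; have h8 := h.Z_pos
  have h9 := P.σ₀_pos; have hS := P.sens_nonneg; have h10 := gaussTail_pos
  have ha := P.initSize_pos
  have hδ : 0 ≤ Real.log (1.25 / P.δ) := by
    refine Real.log_nonneg ?_
    rw [le_div_iff₀ P.δ_pos]; linarith [P.δ_lt]
  have hap : 0 < P.initSize ^ (q - 2) := by positivity
  have haq : P.initSize ^ q = P.initSize ^ (q - 2) * P.initSize ^ 2 := by
    rw [← Real.rpow_natCast, ← Real.rpow_add ha]; norm_num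
  refine abs_le_of_sq_le_sq' (a := P.η * (P.σz * √(P.T₁ q (stageConst q) : ℝ))) ?_
    (by positivity) |>.2
  have hsq : (P.η * (P.σz * √(P.T₁ q (stageConst q) : ℝ))) ^ 2
      = (P.sens * √(2 * Real.log (1.25 / P.δ))) ^ 2 * (‖P.v‖ + P.ξnorm)
        * (P.η * P.T * (‖P.v‖ + P.ξnorm)) * (P.η * P.T₁ q (stageConst q))
        / (P.n * P.m * P.ε) ^ 2 := by
    have e1 : √(2 * P.T * Real.log (1.25 / P.δ)) ^ 2
        = P.T * √(2 * Real.log (1.25 / P.δ)) ^ 2 := by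
      rw [Real.sq_sqrt (by positivity), Real.sq_sqrt (by positivity)]; ring
    have e2 : √(P.T₁ q (stageConst q) : ℝ) ^ 2 = P.T₁ q (stageConst q) :=
      Real.sq_sqrt (Nat.cast_nonneg _)
    unfold σz
    rw [mul_pow, mul_pow, e2, div_pow, mul_pow, e1]
    field_simp
  have hinit : Z ^ (2 * N) ≤ P.ε * (P.initSize ^ (q - 2) * P.initSize ^ 2) := haq ▸ h.le_init
  have hZN : 128 * Z ^ 11 ≤ gaussTail ^ 2 * Z ^ (2 * N) := by
    have e1 : Z ^ 13 ≤ Z ^ N := h.pow_le (by omega)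
    have e2 : Z ^ N ≤ Z ^ (2 * N) := pow_le_pow_right₀ h.one_le_Z (by omega)
    have e3 := h.thousand_le
    calc 128 * Z ^ 11 ≤ (Z * gaussTail) ^ 2 * Z ^ 11 := by
          have : (128 : ℝ) ≤ (Z * gaussTail) ^ 2 := by nlinarith
          gcongr
      _ = gaussTail ^ 2 * Z ^ 13 := by ring
      _ ≤ _ := by
        have := e1.trans e2
        gcongr
  rw [hsq]
  have hσ : P.σ₀ = P.initSize / P.ξnorm := by unfold initSize; field_simp
  calc _ ≤ (Z ^ 2) ^ 2 * (P.ξnorm + P.ξnorm) * (Z * P.m * P.n * P.ε * P.σ₀)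
        * (Z ^ 2 * (P.m * P.n) / (P.ξnorm ^ 2 * P.initSize ^ (q - 2)))
        / (P.n * P.m * P.ε) ^ 2 := by
        have := h.sens_le; have := h.time_le; have := h.η_mul_T₁_le; have := h.norm_v_le
        gcongr
    _ = 2 * Z ^ 7 * P.σ₀ ^ 2 * P.initSize / (P.ε * (P.initSize ^ (q - 2) * P.initSize ^ 2)) := by
        rw [hσ]; field_simp; norm_num
    _ ≤ 2 * Z ^ 7 * P.σ₀ ^ 2 * 1 / Z ^ (2 * N) := by
        have := h.init_le_one
        gcongr
    _ ≤ (gaussTail / 8 * P.σ₀ / Z ^ 2) ^ 2 := by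
        rw [div_le_iff₀ (by positivity)]
        have e : (gaussTail / 8 * P.σ₀ / Z ^ 2) ^ 2 * Z ^ (2 * N)
            = P.σ₀ ^ 2 / (64 * Z ^ 4) * (gaussTail ^ 2 * Z ^ (2 * N)) := by
          field_simp; ring
        rw [e]
        calc 2 * Z ^ 7 * P.σ₀ ^ 2 * 1 = P.σ₀ ^ 2 / (64 * Z ^ 4) * (128 * Z ^ 11) := by
              field_simp; ring
          _ ≤ _ := by gcongr

lemma fluct : 2 * (Z ^ 5 * P.initSize) + P.n * (P.m * (θ + 3)) * (Z / √(P.d : ℝ)) ≤ 1 / 4 := by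
  have h5 := P.n_pos'; have h6 := P.m_pos'; have h8 := h.Z_pos; have ha := P.initSize_pos
  have hd : 0 < √(P.d : ℝ) := Real.sqrt_pos.2 P.d_pos'
  have h16 : (16 : ℝ) ≤ Z := by linarith [h.Z_ge]
  have e1 : 16 * (Z ^ 5 * P.initSize) ≤ 1 := by
    calc 16 * (Z ^ 5 * P.initSize) ≤ Z * (Z ^ 5 * P.initSize) := by gcongr
      _ = Z ^ 6 * P.initSize := by ring
      _ ≤ 1 := h.init_small (by omega)
  have e2 : 8 * (P.n * (P.m * (θ + 3)) * (Z / √(P.d : ℝ))) ≤ 1 := by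
    have e3 := h.sqrt_d_ge (k := 3) (by omega)
    rw [← mul_div_assoc, ← mul_div_assoc, div_le_one hd]
    refine le_trans ?_ e3
    calc 8 * (P.n * (P.m * (θ + 3)) * Z) ≤ Z * (P.n * P.n * (P.m * Z) * Z) := by
          have := h.θ_le
          have := h.two_le_θ
          have : (P.n : ℝ) ≤ P.n * P.n := le_mul_of_one_le_left h5.le P.one_le_n
          gcongr
          linarith
      _ = _ := by ring
  linarith

lemma step : P.η * q * (ζ ^ 2 * P.ξnorm ^ 2) * (θ + 3) ^ (q - 1) / P.n ≤ 1 / 4 := by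
  have h5 := P.one_le_n; have h8 := h.Z_pos; have h3 := P.η_pos; have h1 := P.ξnorm_pos
  have h9 := h.q_pos; have h2 := h.two_le_θ
  have e1 : (θ + 3) ^ (q - 1) ≤ Z ^ ⌈q⌉₊ :=
    (Real.rpow_le_rpow (by linarith) h.θ_le (by linarith [h.two_lt])).trans (h.rpow_le (by linarith))
  have e2 := h.step_small (k := ⌈q⌉₊ + 4) (by omega)
  have e3 : (4 : ℝ) ≤ Z := by linarith [h.Z_ge]
  have e5 : 0 ≤ (θ + 3) ^ (q - 1) := Real.rpow_nonneg (by linarith) _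
  refine (div_le_self (by positivity) h5).trans ?_
  have e4 : 4 * (P.η * q * (ζ ^ 2 * P.ξnorm ^ 2) * (θ + 3) ^ (q - 1)) ≤ 1 := by
    refine le_trans ?_ e2
    calc 4 * (P.η * q * (ζ ^ 2 * P.ξnorm ^ 2) * (θ + 3) ^ (q - 1))
        ≤ Z * (P.η * Z * (Z ^ 2 * P.ξnorm ^ 2) * Z ^ ⌈q⌉₊) := by
          have := h.q_le; have := h.ζ_le_Z; have := h.ζ_nonneg
          gcongr
      _ = Z ^ (⌈q⌉₊ + 4) * (P.η * P.ξnorm ^ 2) := by ring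
  linarith

lemma interference : P.n * (θ + 3) * (Z / √(P.d : ℝ)) * 4
    < gaussTail / 2 * P.initSize * (gaussTail / 2) := by
  have h5 := P.n_pos'; have h8 := h.Z_pos; have ha := P.initSize_pos; have h2 := h.two_le_θ
  have h10 := gaussTail_pos
  have hd : 0 < √(P.d : ℝ) := Real.sqrt_pos.2 P.d_pos'
  have e1 : Z ^ 4 * P.n ≤ P.initSize * √(P.d : ℝ) :=
    (mul_le_mul_of_nonneg_right (h.pow_le (by omega)) h5.le).trans h.init_dim
  have e2 := h.thousand_le
  have e3 : 1000 * 1000 * Z ^ 2 ≤ gaussTail ^ 2 * Z ^ 4 := by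
    calc 1000 * 1000 * Z ^ 2 ≤ (Z * gaussTail) * (Z * gaussTail) * Z ^ 2 := by gcongr
      _ = _ := by ring
  rw [mul_div_assoc', div_mul_eq_mul_div, div_lt_iff₀ hd]
  calc P.n * (θ + 3) * Z * 4 ≤ P.n * Z * Z * 4 := by
        have := h.θ_le
        gcongr
    _ < P.n * (1000 * 1000 * Z ^ 2) / 4 := by
        have : 0 < (P.n : ℝ) * Z ^ 2 := by positivity
        linarith
    _ ≤ P.n * (gaussTail ^ 2 * Z ^ 4) / 4 := by gcongr
    _ = gaussTail ^ 2 / 4 * (Z ^ 4 * P.n) := by ring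
    _ ≤ gaussTail ^ 2 / 4 * (P.initSize * √(P.d : ℝ)) := by gcongr
    _ = _ := by ring

lemma σ₀_mul_norm_v_le : P.σ₀ * ‖P.v‖ ≤ P.initSize := by
  have := h.norm_v_le; have := P.σ₀_pos
  unfold initSize
  gcongr

lemma signal : (3 * (Z ^ 4 * (P.σ₀ * ‖P.v‖))) ^ q ≤ 1 / 2 := by
  have h8 := h.Z_pos; have h9 := P.σ₀_pos
  have e1 : 3 * (Z ^ 4 * (P.σ₀ * ‖P.v‖)) ≤ 1 / 2 := by
    have e2 := h.init_small (k := 5) (by omega)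
    have e3 := h.Z_ge
    have e4 : 0 ≤ Z ^ 4 * (P.σ₀ * ‖P.v‖) := by positivity
    have e5 : Z * (Z ^ 4 * (P.σ₀ * ‖P.v‖)) ≤ 1 := by
      refine le_trans ?_ e2
      have := h.σ₀_mul_norm_v_le
      calc Z * (Z ^ 4 * (P.σ₀ * ‖P.v‖)) ≤ Z * (Z ^ 4 * P.initSize) := by gcongr
        _ = _ := by ring
    nlinarith
  calc (3 * (Z ^ 4 * (P.σ₀ * ‖P.v‖))) ^ q ≤ (1 / 2 : ℝ) ^ q :=
        Real.rpow_le_rpow (by positivity) e1 h.q_pos.le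
    _ ≤ (1 / 2 : ℝ) ^ (1 : ℝ) :=
        Real.rpow_le_rpow_of_exponent_ge (by norm_num) (by norm_num) (by linarith [h.two_lt])
    _ = 1 / 2 := Real.rpow_one _

/-- The signal coefficients stay at the scale of their initialization: over the whole run the loss
derivatives sum up to a time of the order of the first stage, during which the signal learning is
slower than the noise memorization by the factor `n * SNR ^ q`. -/
lemma signal_growth : P.η * ‖P.v‖ ^ 2 / (P.n * P.m)
    * (q * (3 * (Z ^ 4 * (P.σ₀ * ‖P.v‖))) ^ (q - 1))
    * (P.n * (P.T₁ q (stageConst q) + P.n * P.m * ((θ + 2) ^ q + 1)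
      / (2 * P.η * q * (gaussTail / 4 * P.ξnorm ^ 2)))) ≤ P.σ₀ * ‖P.v‖ := by
  have h1 := P.ξnorm_pos; have h3 := P.η_pos
  have h5 := P.n_pos'; have h6 := P.m_pos'; have h8 := h.Z_pos
  have h9 := P.σ₀_pos; have h10 := gaussTail_pos; have hV : 0 < ‖P.v‖ := norm_pos_iff.2 P.v_ne
  have ha := P.initSize_pos; have hq := h.q_pos; have hθ := h.two_le_θ
  have hap : 0 < P.initSize ^ (q - 2) := by positivity
  have hsnr : 0 < P.snr := div_pos hV h1
  have hsp : 0 < P.snr ^ (q - 2) := by positivity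
  have hs : P.σ₀ * ‖P.v‖ = P.initSize * P.snr := by
    unfold initSize snr; field_simp
  have hVX : ‖P.v‖ = P.snr * P.ξnorm := by unfold snr; field_simp
  have hsq : P.snr ^ q = P.snr ^ (q - 2) * P.snr ^ 2 := by
    rw [← Real.rpow_natCast, ← Real.rpow_add hsnr]; norm_num
  have hpow : (3 * (Z ^ 4 * (P.σ₀ * ‖P.v‖))) ^ (q - 1)
      ≤ Z ^ (5 * ⌈q⌉₊) * (P.initSize * P.snr * (P.initSize ^ (q - 2) * P.snr ^ (q - 2))) := by
    have e1 : (3 * (Z ^ 4 * (P.σ₀ * ‖P.v‖))) ≤ Z ^ 5 * (P.initSize * P.snr) := by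
      rw [hs]
      have : 3 ≤ Z := by linarith [h.Z_ge]
      calc 3 * (Z ^ 4 * (P.initSize * P.snr)) ≤ Z * (Z ^ 4 * (P.initSize * P.snr)) := by gcongr
        _ = _ := by ring
    have e2 : (Z ^ 5) ^ (q - 1) ≤ Z ^ (5 * ⌈q⌉₊) := by
      rw [← Real.rpow_natCast Z 5, ← Real.rpow_mul h8.le, mul_comm ((5 : ℕ) : ℝ),
        Real.rpow_mul h8.le, Real.rpow_natCast, mul_comm 5, pow_mul]
      exact pow_le_pow_left₀ (by positivity) (h.rpow_le (by linarith)) 5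
    have e3 : (P.initSize * P.snr) ^ (q - 1)
        = P.initSize * P.snr * (P.initSize ^ (q - 2) * P.snr ^ (q - 2)) := by
      rw [show q - 1 = 1 + (q - 2) by ring, Real.rpow_add (by positivity), Real.rpow_one,
        Real.mul_rpow ha.le hsnr.le]
    calc _ ≤ (Z ^ 5 * (P.initSize * P.snr)) ^ (q - 1) :=
          Real.rpow_le_rpow (by positivity) e1 (by linarith [h.two_lt])
      _ = (Z ^ 5) ^ (q - 1) * (P.initSize * P.snr) ^ (q - 1) :=
          Real.mul_rpow (by positivity) (by positivity)
      _ ≤ _ := by rw [e3]; gcongr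
  have hθq : (θ + 2) ^ q + 1 ≤ 2 * Z ^ ⌈q⌉₊ := by
    have e1 : (θ + 2) ^ q ≤ Z ^ ⌈q⌉₊ :=
      (Real.rpow_le_rpow (by linarith) (by linarith [h.θ_le]) hq.le).trans (h.rpow_le le_rfl)
    have e2 : 1 ≤ Z ^ ⌈q⌉₊ := one_le_pow₀ h.one_le_Z
    linarith
  have hsmall := h.signal_small (k := 6 * ⌈q⌉₊ + 5) (by omega)
  rw [hsq] at hsmall
  set M := ⌈q⌉₊ with hM
  set W := P.initSize * P.snr with hW
  have hWpos : 0 < W := by positivity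
  have hZM : 1 ≤ Z ^ M := one_le_pow₀ h.one_le_Z
  -- the contribution of the first stage
  have hA : P.η * ‖P.v‖ ^ 2 / (P.n * P.m) * (q * (Z ^ (5 * M) * (W * (P.initSize ^ (q - 2)
      * P.snr ^ (q - 2))))) * (P.n * P.T₁ q (stageConst q)) ≤ W / 2 := by
    calc _ = ‖P.v‖ ^ 2 / P.m * (q * (Z ^ (5 * M) * (W * (P.initSize ^ (q - 2)
            * P.snr ^ (q - 2))))) * (P.η * P.T₁ q (stageConst q)) := by field_simp
      _ ≤ ‖P.v‖ ^ 2 / P.m * (Z * (Z ^ (5 * M) * (W * (P.initSize ^ (q - 2)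
            * P.snr ^ (q - 2))))) * (Z ^ 2 * (P.m * P.n)
              / (P.ξnorm ^ 2 * P.initSize ^ (q - 2))) := by
          have := h.q_le; have := h.η_mul_T₁_le
          gcongr
      _ = W * (Z ^ (5 * M + 3) * (P.n * (P.snr ^ (q - 2) * P.snr ^ 2))) := by
          rw [hVX]; field_simp; ring
      _ ≤ W * (1 / 2) := by
          refine mul_le_mul_of_nonneg_left ?_ hWpos.le
          have e1 : 2 * Z ^ (5 * M + 3) ≤ Z ^ (6 * M + 5) := by
            have : 2 * Z ^ (5 * M + 3) ≤ Z * Z ^ (5 * M + 3) := by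
              have := h.Z_ge
              gcongr; linarith
            refine this.trans ?_
            rw [← pow_succ']
            exact pow_le_pow_right₀ h.one_le_Z (by omega)
          have e2 : 0 ≤ P.n * (P.snr ^ (q - 2) * P.snr ^ 2) := by positivity
          nlinarith
      _ = W / 2 := by ring
  -- the contribution of the later iterations
  have hB : P.η * ‖P.v‖ ^ 2 / (P.n * P.m) * (q * (Z ^ (5 * M) * (W * (P.initSize ^ (q - 2)
      * P.snr ^ (q - 2))))) * (P.n * (P.n * P.m * (2 * Z ^ M)
        / (2 * P.η * q * (gaussTail / 4 * P.ξnorm ^ 2)))) ≤ W / 2 := by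
    calc _ = W * (4 / gaussTail * Z ^ (6 * M) * P.initSize ^ (q - 2)
            * (P.n * (P.snr ^ (q - 2) * P.snr ^ 2))) := by
          rw [hVX]; field_simp; ring
      _ ≤ W * (Z * Z ^ (6 * M) * 1 * (P.n * (P.snr ^ (q - 2) * P.snr ^ 2))) := by
          have e1 : 4 / gaussTail ≤ Z := by
            rw [div_le_iff₀ h10]; linarith [h.thousand_le]
          have := h.initSize_rpow_le_one
          gcongr
      _ ≤ W * (1 / 2) := by
          refine mul_le_mul_of_nonneg_left ?_ hWpos.le
          have e1 : 2 * (Z * Z ^ (6 * M)) ≤ Z ^ (6 * M + 5) := by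
            have : 2 * (Z * Z ^ (6 * M)) ≤ Z * (Z * Z ^ (6 * M)) := by
              have := h.Z_ge
              gcongr; linarith
            refine this.trans ?_
            rw [← pow_succ', ← pow_succ']
            exact pow_le_pow_right₀ h.one_le_Z (by omega)
          have e2 : 0 ≤ P.n * (P.snr ^ (q - 2) * P.snr ^ 2) := by positivity
          nlinarith
      _ = W / 2 := by ring
  calc _ ≤ P.η * ‖P.v‖ ^ 2 / (P.n * P.m) * (q * (Z ^ (5 * M) * (W * (P.initSize ^ (q - 2)
      * P.snr ^ (q - 2))))) * (P.n * (P.T₁ q (stageConst q) + P.n * P.m * (2 * Z ^ M)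
        / (2 * P.η * q * (gaussTail / 4 * P.ξnorm ^ 2)))) := by gcongr
    _ ≤ W / 2 + W / 2 := by
        rw [mul_add (P.n : ℝ), mul_add]
        exact add_le_add hA hB
    _ = P.σ₀ * ‖P.v‖ := by rw [hs]; ring

end Calibrated

end Setup

end PrivateCNN

/-! ### From typical samples to the scalar regime -/

namespace PrivateCNN

namespace Setup

variable {P : Setup} {q ζ θ G Z : ℝ} {N : ℕ} {ω : P.Sample}

lemma η_mul_σz_mul_sqrt_mono {s t : ℕ} (hst : s ≤ t) :
    P.η * (P.σz * √(s : ℝ)) ≤ P.η * (P.σz * √(t : ℝ)) := by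
  have h3 := P.η_pos; have h4 := P.σz_nonneg
  gcongr

namespace Typical

lemma norm_ge (hω : P.Typical ζ ω) (i : Fin P.n) : gaussTail / 2 * P.ξnorm ≤ ‖ω.2.1 i‖ := by
  have h1 := hω.lower i; have h2 := gaussTail_pos; have h3 := gaussTail_le_one
  have h4 := P.ξnorm_pos
  refine abs_le_of_sq_le_sq' (a := gaussTail / 2 * P.ξnorm) ?_ (norm_nonneg _) |>.2
  refine le_trans ?_ h1
  have : 0 ≤ gaussTail * (1 - gaussTail) := mul_nonneg h2.le (by linarith)
  have h5 : 0 ≤ P.ξnorm ^ 2 * (gaussTail * (1 - gaussTail)) := by positivity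
  nlinarith

lemma norm_le (hω : P.Typical ζ ω) (hζ : 0 ≤ ζ) (i : Fin P.n) : ‖ω.2.1 i‖ ≤ ζ * P.ξnorm := by
  have h4 := P.ξnorm_pos
  refine abs_le_of_sq_le_sq' (a := ‖ω.2.1 i‖) ?_ (by positivity) |>.2
  rw [mul_pow]
  exact hω.upper i

lemma ne_zero (hω : P.Typical ζ ω) (i : Fin P.n) : ω.2.1 i ≠ 0 := by
  have h1 := hω.norm_ge i; have h2 := gaussTail_pos; have h4 := P.ξnorm_pos
  exact norm_pos_iff.1 (lt_of_lt_of_le (by positivity) h1)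

/-- The scalar dynamics of noisy gradient descent on a typical sample. -/
def dynamics (hω : P.Typical ζ ω) (hq : 1 < q) : Dynamics P.n P.m q P.η ‖P.v‖ :=
  PrivateCNN.dynamics (y := ω.1) (W₀ := ω.2.2.1) (z := ω.2.2.2) hq P.v_ne hω.ne_zero hω.orth

end Typical

namespace Calibrated

lemma corr_le (h : P.Calibrated q ζ θ G Z N) (hω : P.Typical ζ ω) {i' i : Fin P.n}
    (hi : i' ≠ i) : |(‖ω.2.1 i'‖ ^ 2)⁻¹ * inner ℝ (ω.2.1 i') (ω.2.1 i)| ≤ Z / √(P.d : ℝ) := by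
  have h1 := hω.norm_ge i'; have h2 := gaussTail_pos; have h4 := P.ξnorm_pos
  have h5 : 0 < ‖ω.2.1 i'‖ := norm_pos_iff.2 (hω.ne_zero i')
  have hd : 0 < √(P.d : ℝ) := Real.sqrt_pos.2 P.d_pos'
  have h6 := P.σξ_pos; have h7 := h.Z_pos
  rw [abs_mul, abs_of_pos (by positivity)]
  calc (‖ω.2.1 i'‖ ^ 2)⁻¹ * |inner ℝ (ω.2.1 i') (ω.2.1 i)|
      ≤ (‖ω.2.1 i'‖ ^ 2)⁻¹ * (ζ * (P.σξ * ‖ω.2.1 i'‖)) := by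
        have := hω.cross i' i hi
        gcongr
    _ = ζ * P.σξ / ‖ω.2.1 i'‖ := by field_simp
    _ ≤ ζ * P.σξ / (gaussTail / 2 * P.ξnorm) := by
        have := h.ζ_nonneg
        gcongr
    _ = 2 * ζ / (gaussTail * √(P.d : ℝ)) := by unfold ξnorm; field_simp
    _ ≤ gaussTail * Z / (gaussTail * √(P.d : ℝ)) := by
        have := h.ζ_le
        gcongr
    _ = _ := by field_simp

lemma seeds_le (hω : P.Typical ζ ω) (j : Bool) (i : Fin P.n) :
    gaussTail / 2 * P.m ≤ ((Finset.univ.filter fun r =>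
      gaussTail / 2 * P.initSize ≤ inner ℝ (ω.2.2.1 j r) (ω.2.1 i)).card : ℝ) := by
  refine (hω.seeds j i).trans ?_
  rw [Finset.card_filter]
  push_cast
  refine Finset.sum_le_sum fun r _ => ?_
  have h1 := mul_le_mul_of_nonneg_left (hω.norm_ge i) P.σ₀_pos.le
  by_cases hr : P.σ₀ * ‖ω.2.1 i‖ ≤ inner ℝ (ω.2.1 i) (ω.2.2.1 j r)
  · have h2 : gaussTail / 2 * P.initSize ≤ inner ℝ (ω.2.2.1 j r) (ω.2.1 i) := by
      rw [real_inner_comm]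
      unfold initSize
      linarith
    rw [if_pos h2, Set.indicator_of_mem (by exact hr)]
  · rw [Set.indicator_of_notMem (by exact hr)]
    split_ifs <;> norm_num

variable (h : P.Calibrated q ζ θ G Z N)
include h

lemma η_mul_inner_le (x : Vec P.d) {t : ℕ} {c : ℝ} (ht : P.η * (P.σz * √(t : ℝ)) ≤ c)
    (hx : |inner ℝ x (∑ k ∈ Finset.Icc 1 t, ω.2.2.2 k)| ≤ ζ * (√(t : ℝ) * (P.σz * ‖x‖))) :
    |P.η * inner ℝ (∑ k ∈ Finset.Icc 1 t, ω.2.2.2 k) x| ≤ ζ * c * ‖x‖ := by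
  have h3 := P.η_pos; have h4 := h.ζ_nonneg
  rw [abs_mul, abs_of_pos h3, real_inner_comm]
  calc P.η * |inner ℝ x (∑ k ∈ Finset.Icc 1 t, ω.2.2.2 k)|
      ≤ P.η * (ζ * (√(t : ℝ) * (P.σz * ‖x‖))) := by gcongr
    _ = ζ * (P.η * (P.σz * √(t : ℝ))) * ‖x‖ := by ring
    _ ≤ _ := by gcongr

/-- On a typical sample, noisy gradient descent is in the regime of noise memorization. -/
def regime (hω : P.Typical ζ ω) (hq : 1 < q) : Regime (hω.dynamics hq) where
  lo := gaussTail / 4 * P.ξnorm ^ 2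
  hi := ζ ^ 2 * P.ξnorm ^ 2
  τ := Z / √(P.d : ℝ)
  α := gaussTail / 2 * P.initSize
  c₂ := gaussTail / 2
  ω := Z ^ 5 * P.initSize
  B := Z ^ 4 * (P.σ₀ * ‖P.v‖)
  θ := θ
  Γm := P.σ₀ * ‖P.v‖
  G := G
  T := P.T
  T₁ := P.T₁ q (stageConst q)
  t₁ := P.T₁ q (stageConst q) / 2
  n_pos := P.n_pos
  m_pos := P.m_pos
  two_lt := h.two_lt
  η_pos := P.η_pos
  lo_pos := by have := gaussTail_pos; have := P.ξnorm_pos; positivity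
  τ_nonneg := by have := h.Z_pos; positivity
  α_pos := by have := gaussTail_pos; have := P.initSize_pos; positivity
  B_nonneg := by have := h.Z_pos; have := P.σ₀_pos; positivity
  two_le_θ := h.two_le_θ
  two_le_G := h.two_le_G
  t₁_le := Nat.div_le_self _ _
  T₁_pos := h.T₁_pos
  T₁_le := h.T₁_le
  lo_le := hω.lower
  le_hi := hω.upper
  corr_self i := by
    have : ‖ω.2.1 i‖ ^ 2 ≠ 0 := by simpa using hω.ne_zero i
    change (‖ω.2.1 i‖ ^ 2)⁻¹ * inner ℝ (ω.2.1 i) (ω.2.1 i) = 1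
    rw [real_inner_self_eq_norm_sq, inv_mul_cancel₀ this]
  corr_le i' i hi := h.corr_le hω hi
  u₀_le j r i := by
    change |inner ℝ (ω.2.2.1 j r) (ω.2.1 i)| ≤ _
    have h1 := P.σ₀_pos; have h2 := P.ξnorm_pos; have h3 := h.Z_pos; have h4 := h.ζ_nonneg
    have ha := P.initSize_pos
    rw [real_inner_comm]
    calc _ ≤ ζ * (P.σ₀ * ‖ω.2.1 i‖) := hω.init_data j r i
      _ ≤ Z * (P.σ₀ * (Z * P.ξnorm)) := by
          have e := hω.norm_le h4 i; have := h.ζ_le_Z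
          have : ‖ω.2.1 i‖ ≤ Z * P.ξnorm := e.trans (by gcongr)
          gcongr
      _ = Z ^ 2 * P.initSize := by unfold initSize; ring
      _ ≤ Z ^ 5 * P.initSize := by
          have : Z ^ 2 ≤ Z ^ 5 := pow_le_pow_right₀ h.one_le_Z (by norm_num)
          gcongr
  s₀_le j r := by
    change |inner ℝ (ω.2.2.1 j r) P.v| ≤ _
    have h1 := P.σ₀_pos; have h3 := h.Z_pos
    rw [real_inner_comm]
    refine (hω.init_signal j r).trans ?_
    have : ζ ≤ Z ^ 4 := h.ζ_le_Z.trans (le_self_pow₀ h.one_le_Z (by norm_num))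
    gcongr
  νξ_le i t ht := by
    have h1 := P.σ₀_pos; have h2 := P.ξnorm_pos; have h3 := h.Z_pos; have h4 := h.ζ_nonneg
    refine (h.η_mul_inner_le (ω.2.1 i)
      ((η_mul_σz_mul_sqrt_mono ht).trans h.η_mul_σz_mul_sqrt_le) (hω.noise_data t ht i)).trans ?_
    have e := hω.norm_le h4 i; have := h.ζ_le_Z
    have : ‖ω.2.1 i‖ ≤ Z * P.ξnorm := e.trans (by gcongr)
    calc ζ * (Z ^ 3 * P.σ₀) * ‖ω.2.1 i‖ ≤ Z * (Z ^ 3 * P.σ₀) * (Z * P.ξnorm) := by gcongr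
      _ = Z ^ 5 * P.initSize := by unfold initSize; ring
  νv_le t ht := by
    have h1 := P.σ₀_pos; have h3 := h.Z_pos
    refine (h.η_mul_inner_le P.v
      ((η_mul_σz_mul_sqrt_mono ht).trans h.η_mul_σz_mul_sqrt_le) (hω.noise_signal t ht)).trans ?_
    have := h.ζ_le_Z
    calc ζ * (Z ^ 3 * P.σ₀) * ‖P.v‖ ≤ Z * (Z ^ 3 * P.σ₀) * ‖P.v‖ := by gcongr
      _ = Z ^ 4 * (P.σ₀ * ‖P.v‖) := by ring
  νξ_le_early i t ht := by
    have h1 := P.σ₀_pos; have h2 := P.ξnorm_pos; have h3 := h.Z_pos; have h4 := h.ζ_nonneg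
    have h5 := gaussTail_pos
    refine (h.η_mul_inner_le (ω.2.1 i) ((η_mul_σz_mul_sqrt_mono ht).trans h.η_mul_σz_mul_sqrt_T₁_le)
      (hω.noise_data t (ht.trans h.T₁_le) i)).trans ?_
    have e := hω.norm_le h4 i; have := h.ζ_le_Z
    have : ‖ω.2.1 i‖ ≤ Z * P.ξnorm := e.trans (by gcongr)
    calc ζ * (gaussTail / 8 * P.σ₀ / Z ^ 2) * ‖ω.2.1 i‖
        ≤ Z * (gaussTail / 8 * P.σ₀ / Z ^ 2) * (Z * P.ξnorm) := by gcongr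
      _ = gaussTail / 2 * P.initSize / 4 := by unfold initSize; field_simp; norm_num
  seeds i := seeds_le hω (ω.1 i) i
  Γm_le := by
    have h1 := P.σ₀_pos
    exact le_mul_of_one_le_left (by positivity) (one_le_pow₀ h.one_le_Z)
  fluct := h.fluct
  step := h.step
  horizon := h.horizon
  interference := h.interference
  signal := h.signal
  signal_growth := h.signal_growth
  growth_early := h.growth_early
  growth_late := h.growth_late

end Calibrated

/-- On a typical sample the coefficients exist and are unique, every data noise has been memorized
at the end of the first stage, the signal coefficients stay below their initial scale, and every
sample is fitted from then on. -/
lemma Calibrated.conclusion (h : P.Calibrated q ζ θ G Z N) (hω : P.Typical ζ ω) :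
    ∃ (Γ : Bool → Fin P.m → ℕ → ℝ) (Φ : Bool → Fin P.m → Fin P.n → ℕ → ℝ),
      IsDecomposition P.v ω.2.1 P.η ω.2.2.2 (P.iter q ω) Γ Φ ∧
      (∀ Γ₂ Φ₂, IsDecomposition P.v ω.2.1 P.η ω.2.2.2 (P.iter q ω) Γ₂ Φ₂ → Γ₂ = Γ ∧ Φ₂ = Φ) ∧
      (∀ i, ∃ j r, 2 ≤ Φ j r i (P.T₁ q (stageConst q))) ∧
      (∀ t ≤ P.T, ∀ j r, |Γ j r t| ≤ P.σ₀ * ‖P.v‖) ∧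
      ∀ t ∈ Finset.Icc (P.T₁ q (stageConst q)) P.T, ∀ i, (G - 1 / 4) ^ q - 1 ≤
        sgn (ω.1 i) * net q (P.iter q ω t) (sgn (ω.1 i) • P.v, ω.2.1 i) := by
  have hq : 1 < q := by linarith [h.two_lt]
  set R := h.regime hω hq
  have hdec : IsDecomposition P.v ω.2.1 P.η ω.2.2.2 (P.iter q ω) (hω.dynamics hq).Γ
      (hω.dynamics hq).Φ :=
    ⟨R.Γ_nonneg, traj_eq hq P.v_ne hω.ne_zero⟩
  refine ⟨_, _, hdec, fun Γ₂ Φ₂ h₂ => ?_, R.two_le_Φ, fun t ht j r => ?_, fun t ht i => ?_⟩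
  · have hn : (P.n : ℝ) * (Z / √(P.d : ℝ)) < 1 := by
      have h1 := h.fluct; have h2 := h.θ_le; have h3 := h.two_le_θ; have h4 := P.one_le_m
      have h5 := h.Z_pos; have h6 := P.initSize_pos
      have h7 : (1 : ℝ) ≤ P.m * (θ + 3) := by nlinarith
      have h8 : 0 ≤ (P.n : ℝ) * (Z / √(P.d : ℝ)) := by positivity
      have h9 : 0 ≤ Z ^ 5 * P.initSize := by positivity
      nlinarith
    exact IsDecomposition.unique P.v_ne hω.ne_zero hω.orth
      (by have := h.Z_pos; positivity) (fun i' i hi => h.corr_le hω hi) hn hdec h₂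
  · rw [abs_of_nonneg (R.Γ_nonneg j r t)]
    exact (R.inv ht).signal j r
  · rw [Finset.mem_Icc] at ht
    exact R.le_margin ht.1 ht.2 i

end Setup

end PrivateCNN

/-! ### The conditions of data noise memorization calibrate the parameters -/

namespace PrivateCNN

namespace Setup

variable (P : Setup) {q κ : ℝ} {k : ℕ}

lemma exp_logSize (hκ : 0 < κ) : Real.exp (P.logSize κ) =
    3 + P.d + P.n + P.m + (‖P.v‖ + ‖P.v‖⁻¹) + (P.σξ + P.σξ⁻¹) + (P.σ₀ + P.σ₀⁻¹)
    + (P.η + P.η⁻¹) + (P.ε + P.ε⁻¹) + P.δ⁻¹ + (κ + κ⁻¹) := by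
  have := P.σξ_pos; have := P.σ₀_pos; have := P.η_pos; have := P.ε_pos; have := P.δ_pos
  exact Real.exp_log (by positivity)

/-- The parameters are at most exponential in `logSize`. -/
lemma le_exp_logSize (hκ : 0 < κ) :
    (P.d : ℝ) ≤ Real.exp (P.logSize κ) ∧ (P.n : ℝ) ≤ Real.exp (P.logSize κ) ∧
    (P.m : ℝ) ≤ Real.exp (P.logSize κ) ∧ P.σξ⁻¹ ≤ Real.exp (P.logSize κ) ∧
    P.σ₀⁻¹ ≤ Real.exp (P.logSize κ) ∧ P.η⁻¹ ≤ Real.exp (P.logSize κ) ∧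
    P.δ⁻¹ ≤ Real.exp (P.logSize κ) ∧
    2 + κ⁻¹ + ‖P.v‖⁻¹ + P.σ₀⁻¹ + P.n + P.m + P.d ≤ Real.exp (P.logSize κ) := by
  have h1 := P.σξ_pos; have h2 := P.σ₀_pos; have h3 := P.η_pos
  have h4 := P.ε_pos; have h5 := P.δ_pos
  have e1 := inv_pos.2 h1; have e2 := inv_pos.2 h2; have e3 := inv_pos.2 h3
  have e4 := inv_pos.2 h4; have e5 := inv_pos.2 h5; have e6 := inv_pos.2 hκ
  have e7 : 0 ≤ ‖P.v‖ := norm_nonneg _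
  have e8 : 0 ≤ ‖P.v‖⁻¹ := inv_nonneg.2 e7
  have e9 := P.d_pos'; have e10 := P.n_pos'; have e11 := P.m_pos'
  rw [P.exp_logSize hκ]
  refine ⟨?_, ?_, ?_, ?_, ?_, ?_, ?_, ?_⟩ <;> linarith

lemma one_le_logSize (hκ : 0 < κ) : 1 ≤ P.logSize κ := by
  rw [← Real.exp_le_exp]
  have h8 := (P.le_exp_logSize hκ).2.2.2.2.2.2.2
  have e6 := inv_pos.2 hκ; have e2 := inv_pos.2 P.σ₀_pos
  have e8 : 0 ≤ ‖P.v‖⁻¹ := inv_nonneg.2 (norm_nonneg _)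
  have e9 : (1 : ℝ) ≤ P.d := by exact_mod_cast P.d_pos
  linarith [P.one_le_n, P.one_le_m, Real.exp_one_lt_d9]

lemma Tstar_pos (hκ : 0 < κ) : 0 < P.Tstar κ k := by
  have h1 := P.σξ_pos; have h2 := P.σ₀_pos; have h3 := P.η_pos
  unfold Tstar
  positivity

/-- The number of iterations is polynomial in the parameters. -/
lemma Tstar_le (hκ : 0 < κ) : P.Tstar κ k ≤ Real.exp ((1 + 3 * k) * P.logSize κ) := by
  obtain ⟨-, -, -, h4, -, h6, -, h8⟩ := P.le_exp_logSize hκ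
  have h1 := P.σξ_pos; have h2 := P.σ₀_pos; have h3 := P.η_pos
  have hL := P.one_le_logSize hκ
  set E := Real.exp (P.logSize κ) with hE
  have hE2 : 2 ≤ E := by
    have := Real.add_one_le_exp (P.logSize κ)
    linarith
  have e1 : (P.d * P.σξ ^ 2)⁻¹ ≤ E ^ 2 := by
    have e9 : (1 : ℝ) ≤ P.d := by exact_mod_cast P.d_pos
    calc (P.d * P.σξ ^ 2)⁻¹ ≤ (1 * P.σξ ^ 2)⁻¹ := by gcongr
      _ = (P.σξ⁻¹) ^ 2 := by rw [one_mul, inv_pow]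
      _ ≤ E ^ 2 := by gcongr
  have e2 : 2 + κ⁻¹ + ‖P.v‖⁻¹ + (P.d * P.σξ ^ 2)⁻¹ + P.σ₀⁻¹ + P.n + P.m + P.d ≤ E ^ 3 := by
    have : E + E ^ 2 ≤ E ^ 3 := by nlinarith [sq_nonneg E]
    linarith
  calc P.Tstar κ k ≤ E * (E ^ 3) ^ k := by
        unfold Tstar
        gcongr
    _ = Real.exp ((1 + 3 * k) * P.logSize κ) := by
        rw [← pow_mul, ← pow_succ', hE, ← Real.exp_nat_mul]
        push_cast
        ring_nf

lemma log_Tstar_le (hκ : 0 < κ) : Real.log (P.Tstar κ k) ≤ (1 + 3 * k) * P.logSize κ := by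
  rw [Real.log_le_iff_le_exp (P.Tstar_pos hκ)]
  exact P.Tstar_le hκ

/-- The level that the coefficients reach in the first stage: it makes the loss of every sample at
most `κ / (2 q - 1)`. -/
def level (q κ : ℝ) : ℝ := (2 * q - 1) / κ + 2

/-- The factor of the polylogarithm by which all the parameters are separated. -/
def sepConst (q κ A : ℝ) (k : ℕ) : ℝ :=
  1000 / gaussTail + q + 2 * stageRate q + 4 / stageRate q
    + (stageRate q * gaussTail * q * Real.exp (-((level q κ + 1) ^ q + 1)) / 128)⁻¹
    + 2 * (8 + 3 * k) / gaussTail + 4 * (1 + 3 * k) + level q κ + |A| + 20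

/-- The exponent that turns the polylogarithm into the hidden factor of the conditions. -/
def sepPow (q : ℝ) : ℕ := 6 * ⌈q⌉₊ + 20 + ⌈2 / (q - 2)⌉₊

lemma two_le_level (hq : 2 < q) (hκ : 0 < κ) : 2 ≤ level q κ := by
  have : 0 ≤ (2 * q - 1) / κ := div_nonneg (by linarith) hκ.le
  unfold level
  linarith

lemma sepConst_bounds (hq : 2 < q) (hκ : 0 < κ) (A : ℝ) (k : ℕ) {L : ℝ} (hL : 1 ≤ L) (b : ℕ)
    {Z : ℝ} (hZ : Z = sepConst q κ A k * L ^ (b + 2)) :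
    1000 / gaussTail ≤ Z ∧ q ≤ Z ∧ 2 * stageRate q ≤ Z ∧ 4 / stageRate q ≤ Z ∧
    (stageRate q * gaussTail * q * Real.exp (-((level q κ + 1) ^ q + 1)) / 128)⁻¹ ≤ Z ∧
    2 * (8 + 3 * k) / gaussTail * L ≤ Z ∧ 4 * (1 + 3 * k) * L ≤ Z ∧
    (level q κ + 4 * (1 + 3 * k) + 20) * L ≤ Z ∧ |A| * L ^ b ≤ Z := by
  have h1 := gaussTail_pos
  have h2 : 0 < q := by linarith
  have h3 := stageRate_pos h2
  have h4 := two_le_level hq hκ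
  have h5 := abs_nonneg A
  have hk : (0 : ℝ) ≤ k := Nat.cast_nonneg k
  have h6 : L ≤ L ^ (b + 2) := le_self_pow₀ hL (by omega)
  have h7 : L ^ b ≤ L ^ (b + 2) := pow_le_pow_right₀ hL (by omega)
  have a1 : 0 < 1000 / gaussTail := by positivity
  have a2 : 0 < 4 / stageRate q := by positivity
  have a3 : 0 < (stageRate q * gaussTail * q
    * Real.exp (-((level q κ + 1) ^ q + 1)) / 128)⁻¹ := by positivity
  have a4 : 0 < 2 * (8 + 3 * k) / gaussTail := by positivity
  set D := sepConst q κ A k with hD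
  unfold sepConst at hD
  have a5 : 0 < D := by linarith
  have key : ∀ x, x ≤ D → x * L ≤ Z := fun x hx => by
    rcases le_total 0 x with hx0 | hx0
    · rw [hZ]; gcongr
    · have : 0 ≤ Z := by rw [hZ]; positivity
      nlinarith
  have key1 : ∀ x, 0 ≤ x → x ≤ D → x ≤ Z := fun x hx0 hx =>
    (le_mul_of_one_le_right hx0 hL).trans (key x hx)
  refine ⟨key1 _ (by linarith) (by linarith), key1 _ (by linarith) (by linarith),
    key1 _ (by linarith) (by linarith), key1 _ (by linarith) (by linarith),
    key1 _ (by linarith) (by linarith), key _ (by linarith), key _ (by linarith),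
    key _ (by linarith), ?_⟩
  rw [hZ]
  gcongr
  linarith

set_option maxHeartbeats 1000000 in
/-- The conditions of data noise memorization calibrate the parameters. -/
lemma NoiseMemorization.calibrated {P : Setup} {A : ℝ} {b : ℕ} (hq : 2 < q) (hκ : 0 < κ)
    (h : P.NoiseMemorization q κ (sepConst q κ A k ^ sepPow q) ((b + 2) * sepPow q))
    (hS : P.sens ≤ A * P.logSize κ ^ b) (hT₁ : P.T₁ q (stageConst q) ≤ P.T)
    (hT : (P.T : ℝ) ≤ P.TpStar κ k) :
    P.Calibrated q ((8 + 3 * k) * P.logSize κ) (2 + (1 + 3 * k) * P.logSize κ) (level q κ)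
      (sepConst q κ A k * P.logSize κ ^ (b + 2)) (sepPow q) := by
  have hL := P.one_le_logSize hκ
  obtain ⟨p1, p2, p3, p4, p5, p6, p7⟩ := P.le_exp_logSize hκ
  set L := P.logSize κ with hLdef
  obtain ⟨z1, z2, z3, z4, z5, z6, z7, z8, z9⟩ := sepConst_bounds hq hκ A k hL b rfl
  have hh : sepConst q κ A k ^ sepPow q * L ^ ((b + 2) * sepPow q)
      = (sepConst q κ A k * L ^ (b + 2)) ^ sepPow q := by rw [mul_pow, ← pow_mul]
  obtain ⟨c1, -, -, c4, c5, c6, c7⟩ := h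
  rw [← hLdef, hh] at c1 c4 c5 c6 c7
  set Z := sepConst q κ A k * L ^ (b + 2) with hZ
  have h1 := gaussTail_pos
  have h1' := gaussTail_le_one
  have hq0 : 0 < q := by linarith
  have h3 := stageRate_pos hq0
  have hk : (0 : ℝ) ≤ k := Nat.cast_nonneg k
  have hX := P.ξnorm_pos; have hσ := P.σ₀_pos; have hη := P.η_pos; have hε := P.ε_pos
  have hV : 0 < ‖P.v‖ := norm_pos_iff.2 P.v_ne
  have ha := P.initSize_pos
  have hG := two_le_level hq hκ
  have hZ1 : 1 ≤ Z := by
    have : (1000 : ℝ) ≤ 1000 / gaussTail := by rw [le_div_iff₀ h1]; linarith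
    linarith
  have hZ0 : 0 < Z := by linarith
  set H := Z ^ sepPow q with hH
  have hH1 : 1 ≤ H := one_le_pow₀ hZ1
  have hd : 0 < √(P.d : ℝ) := Real.sqrt_pos.2 P.d_pos'
  have hsnr : 0 < P.snr := div_pos hV hX
  have hn := P.one_le_n; have hm := P.one_le_m
  have hsig : H * (P.n * P.snr ^ q) ≤ 1 := by
    have := c7.trans (min_le_right _ _)
    rw [← mul_inv, le_inv_comm₀ (by positivity) (by positivity)] at this
    calc H * (P.n * P.snr ^ q) = H * (P.snr ^ q * P.n) := by ring
      _ ≤ H * H⁻¹ := by gcongr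
      _ = 1 := mul_inv_cancel₀ (by positivity)
  have hVX : ‖P.v‖ ≤ P.ξnorm := by
    by_contra hc
    push Not at hc
    have e1 : 1 < P.snr := by rw [snr, lt_div_iff₀ hX]; linarith
    have e2 : 1 < P.snr ^ q := Real.one_lt_rpow e1 hq0
    have e3 : 1 < P.n * P.snr ^ q := by nlinarith
    nlinarith
  exact {
    two_lt := hq
    le_N := by unfold sepPow; omega
    two_le_N_mul := by
      have e1 : 2 / (q - 2) ≤ sepPow q := by
        refine (Nat.le_ceil _).trans ?_
        unfold sepPow
        exact_mod_cast (by omega)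
      rwa [div_le_iff₀ (by linarith)] at e1
    le_Z := z1
    q_le := z2
    rate_le := z3
    four_le_rate := by rw [div_le_iff₀ h3] at z4; linarith
    late_rate := by
      have : 0 < stageRate q * gaussTail * q * Real.exp (-((level q κ + 1) ^ q + 1)) / 128 := by
        positivity
      rwa [inv_le_iff_one_le_mul₀ this] at z5
    ζ_nonneg := by positivity
    ζ_le := by
      rw [div_mul_eq_mul_div, div_le_iff₀ h1] at z6
      linarith
    two_le_θ := by
      have : 0 ≤ (1 + 3 * k) * L := by positivity
      linarith
    θ_le := by
      have e1 : 0 ≤ level q κ * L := by positivity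
      have e2 : 0 ≤ (1 + 3 * k) * L := by positivity
      nlinarith
    horizon := by
      have e1 : (P.T : ℝ) ≤ Real.exp ((1 + 3 * k) * L) :=
        (hT.trans (min_le_left _ _)).trans (P.Tstar_le hκ)
      calc P.T * Real.exp (2 - (2 + (1 + 3 * k) * L))
          ≤ Real.exp ((1 + 3 * k) * L) * Real.exp (2 - (2 + (1 + 3 * k) * L)) := by gcongr
        _ = 1 := by rw [← Real.exp_add]; simp
    two_le_G := hG
    G_le := by
      have e1 : level q κ ≤ Real.exp (level q κ) := by
        linarith [Real.add_one_le_exp (level q κ)]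
      calc P.m * level q κ ≤ Real.exp L * Real.exp (level q κ) := by gcongr
        _ = Real.exp (L + level q κ) := (Real.exp_add _ _).symm
        _ ≤ Real.exp Z := by
          have e2 : level q κ ≤ level q κ * L := le_mul_of_one_le_right (by linarith) hL
          have e3 : 0 ≤ (4 * (1 + 3 * k)) * L := by positivity
          exact Real.exp_le_exp.2 (by linarith)
    sens_le := by
      have e1 : P.sens ≤ Z := by
        refine hS.trans (le_trans ?_ z9)
        have := le_abs_self A
        gcongr
      have e2 : Real.log (1.25 / P.δ) ≤ 2 * L := by
        rw [Real.log_le_iff_le_exp (by have := P.δ_pos; positivity)]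
        have e3 : (1.25 : ℝ) ≤ Real.exp L := by linarith [Real.add_one_le_exp L]
        calc 1.25 / P.δ = 1.25 * P.δ⁻¹ := div_eq_mul_inv _ _
          _ ≤ Real.exp L * Real.exp L := by
            have := inv_pos.2 P.δ_pos
            have := p7.1
            gcongr
          _ = Real.exp (2 * L) := by rw [← Real.exp_add]; ring_nf
      have e3 : √(2 * Real.log (1.25 / P.δ)) ≤ Z := by
        refine Real.sqrt_le_iff.2 ⟨hZ0.le, ?_⟩
        have e4 : 4 * L ≤ Z := by
          refine le_trans ?_ z7
          have : (4 : ℝ) ≤ 4 * (1 + 3 * k) := by linarith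
          gcongr
        nlinarith
      calc _ ≤ Z * Z := by gcongr
        _ = Z ^ 2 := by ring
    time_le := by
      have e1 : (P.T : ℝ) ≤ P.η⁻¹ * (4 * Real.log (P.Tstar κ k) * P.m * P.n * P.ε * P.σ₀
        / (P.μ * (‖P.v‖ + P.ξnorm))) := hT.trans (min_le_right _ _)
      have hμ : 1 ≤ P.μ := le_max_left _ _
      have e2 : 4 * Real.log (P.Tstar κ k) ≤ Z := by
        refine le_trans ?_ z7
        have := P.log_Tstar_le (k := k) hκ
        linarith
      calc P.η * P.T * (‖P.v‖ + P.ξnorm)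
          ≤ P.η * (P.η⁻¹ * (4 * Real.log (P.Tstar κ k) * P.m * P.n * P.ε * P.σ₀
            / (P.μ * (‖P.v‖ + P.ξnorm)))) * (‖P.v‖ + P.ξnorm) := by gcongr
        _ = (4 * Real.log (P.Tstar κ k)) * P.m * P.n * P.ε * P.σ₀ / P.μ := by
            field_simp
        _ ≤ Z * P.m * P.n * P.ε * P.σ₀ / P.μ := by gcongr
        _ ≤ Z * P.m * P.n * P.ε * P.σ₀ := div_le_self (by positivity) hμ
    log_le := by
      have e0 : 5 * L ≤ Z := by
        refine le_trans ?_ z8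
        gcongr
        linarith
      refine le_trans ?_ e0
      rw [Real.log_le_iff_le_exp (by positivity)]
      have e1 : P.initSize⁻¹ ≤ Real.exp L * Real.exp L := by
        have e2 : P.ξnorm⁻¹ ≤ P.σξ⁻¹ := by
          have e9 : (1 : ℝ) ≤ √(P.d : ℝ) := Real.one_le_sqrt.2 (by exact_mod_cast P.d_pos)
          have := P.σξ_pos
          refine inv_anti₀ P.σξ_pos ?_
          exact le_mul_of_one_le_right this.le e9
        have e3 : 0 < P.ξnorm⁻¹ := inv_pos.2 hX
        unfold initSize
        rw [mul_inv]
        gcongr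
        exact e2.trans p4
      have e4 : (10 : ℝ) ≤ Real.exp (3 * L) := by
        have e5 : 2.7 ≤ Real.exp L := by
          have := Real.exp_one_gt_d9
          have := Real.exp_le_exp.2 hL
          linarith
        have e6 : Real.exp (3 * L) = Real.exp L ^ 3 := by rw [← Real.exp_nat_mul]; simp
        rw [e6]
        calc (10 : ℝ) ≤ 2.7 ^ 3 := by norm_num
          _ ≤ _ := by gcongr
      calc 10 / P.initSize = 10 * P.initSize⁻¹ := div_eq_mul_inv _ _
        _ ≤ Real.exp (3 * L) * (Real.exp L * Real.exp L) := by gcongr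
        _ = Real.exp (5 * L) := by rw [← Real.exp_add, ← Real.exp_add]; ring_nf
    le_init := by
      have e1 : H * (P.ε ^ (-1 / q) * P.ξnorm⁻¹) ≤ P.σ₀ :=
        (mul_le_mul_of_nonneg_left (le_max_left _ _) (by positivity)).trans c5
      have e2 : H * P.ε ^ (-1 / q) ≤ P.initSize := by
        calc H * P.ε ^ (-1 / q) = H * (P.ε ^ (-1 / q) * P.ξnorm⁻¹) * P.ξnorm := by field_simp
          _ ≤ P.σ₀ * P.ξnorm := by gcongr
      have e3 : H ^ q * P.ε⁻¹ ≤ P.initSize ^ q := by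
        have e4 := Real.rpow_le_rpow (by positivity) e2 hq0.le
        rw [Real.mul_rpow (by positivity) (by positivity), ← Real.rpow_mul hε.le,
          div_mul_cancel₀ _ hq0.ne', Real.rpow_neg_one] at e4
        exact e4
      calc Z ^ (2 * sepPow q) = H ^ (2 : ℝ) := by
            rw [hH, mul_comm 2, pow_mul]; norm_cast
        _ ≤ H ^ q := Real.rpow_le_rpow_of_exponent_le hH1 hq.le
        _ = P.ε * (H ^ q * P.ε⁻¹) := by field_simp
        _ ≤ _ := by gcongr
    init_le := by
      have e1 := c6.trans (min_le_right _ _)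
      calc H * P.initSize = H * P.σ₀ * P.ξnorm := by unfold initSize; ring
        _ ≤ P.ξnorm⁻¹ * P.ξnorm := by gcongr
        _ = 1 := inv_mul_cancel₀ hX.ne'
    signal_le := hsig
    norm_v_le := hVX
    init_dim := by
      have e1 : H * (P.n / √(P.d : ℝ) * ‖P.v‖⁻¹) ≤ P.σ₀ :=
        (mul_le_mul_of_nonneg_left (le_max_right _ _) (by positivity)).trans c5
      calc H * P.n = H * (P.n / √(P.d : ℝ) * ‖P.v‖⁻¹) * ‖P.v‖ * √(P.d : ℝ) := by field_simp
        _ ≤ P.σ₀ * P.ξnorm * √(P.d : ℝ) := by gcongr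
    step_le := by
      have e1 := c4.trans (min_le_right _ _)
      calc H * (P.η * P.ξnorm ^ 2) = H * P.η * P.ξnorm ^ 2 := by ring
        _ ≤ (P.ξnorm ^ 2)⁻¹ * P.ξnorm ^ 2 := by gcongr
        _ = 1 := inv_mul_cancel₀ (by positivity)
    dim_le := by
      refine le_trans ?_ c1
      have e1 : (P.m : ℝ) ^ 2 ≤ (P.m : ℝ) ^ max 2 (4 / (q - 2)) := by
        rw [← Real.rpow_natCast]
        exact Real.rpow_le_rpow_of_exponent_le hm (by simp)
      have e2 : (P.n : ℝ) ^ 4 ≤ (P.n : ℝ) ^ max 4 ((2 * q - 2) / (q - 2)) := by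
        rw [← Real.rpow_natCast]
        exact Real.rpow_le_rpow_of_exponent_le hn (by simp)
      gcongr
    T₁_le := hT₁ }

end Setup

end PrivateCNN

/-! ### Probability of a typical sample and the conclusion -/

namespace PrivateCNN

namespace Setup

variable {P : Setup} {q κ θ G Z : ℝ} {k N : ℕ}

lemma mul_exp_neg_le {x y d : ℝ} (hd : 0 < d) (h : 3 * d * x ≤ Real.exp y) :
    x * Real.exp (-y) ≤ 1 / (3 * d) := by
  rw [Real.exp_neg, ← div_eq_mul_inv, div_le_div_iff₀ (Real.exp_pos y) (by positivity)]
  linarith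

variable (P) in
lemma three_le_exp_logSize (hκ : 0 < κ) : 3 ≤ Real.exp (P.logSize κ) := by
  obtain ⟨-, -, -, -, -, -, -, p8⟩ := P.le_exp_logSize hκ
  have := inv_pos.2 P.σ₀_pos; have := inv_pos.2 hκ
  have : 0 ≤ ‖P.v‖⁻¹ := inv_nonneg.2 (norm_nonneg _)
  linarith [P.one_le_n, P.d_pos', P.m_pos']

/-- The Gaussian tails of the union bound are negligible, since there are polynomially many. -/
lemma union_tails_le (hκ : 0 < κ) (hT : (P.T : ℝ) ≤ P.Tstar κ k) :
    2 * (P.n + P.n * P.d + P.n * P.n + 2 * (P.m * P.n) + 2 * P.m + (P.T + 1) * P.n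
      + (P.T + 1)) * Real.exp (-((8 + 3 * k) * P.logSize κ) ^ 2 / 2) ≤ 1 / (3 * P.d) := by
  have hL := P.one_le_logSize hκ
  obtain ⟨p1, p2, p3, -, -, -, -, -⟩ := P.le_exp_logSize hκ
  have hTE := hT.trans (P.Tstar_le hκ)
  have hk : (0 : ℝ) ≤ k := Nat.cast_nonneg k
  have hd := P.d_pos'
  have hE3 := P.three_le_exp_logSize hκ
  generalize P.logSize κ = L at *
  rw [neg_div]
  refine mul_exp_neg_le hd ?_
  set E := Real.exp L with hE
  set F := E * Real.exp ((1 + 3 * k) * L) with hF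
  have hE0 : 0 < E := Real.exp_pos _
  have hexp1 : 1 ≤ Real.exp ((1 + 3 * k) * L) := Real.one_le_exp (by positivity)
  have hF1 : 1 ≤ F := one_le_mul_of_one_le_of_one_le (by linarith) hexp1
  have hTF : (P.T : ℝ) + 1 ≤ F := by nlinarith
  have hEF : E ≤ E ^ 2 * F := by
    calc E = E * 1 * 1 := by ring
      _ ≤ E * E * F := by gcongr; linarith
      _ = _ := by ring
  have hE2F : E ^ 2 ≤ E ^ 2 * F := le_mul_of_one_le_right (by positivity) hF1
  have b1 : (P.n : ℝ) * P.d ≤ E ^ 2 := by rw [sq]; gcongr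
  have b2 : (P.n : ℝ) * P.n ≤ E ^ 2 := by rw [sq]; gcongr
  have b3 : (P.m : ℝ) * P.n ≤ E ^ 2 := by rw [sq]; gcongr
  have b4 : ((P.T : ℝ) + 1) * P.n ≤ E ^ 2 * F := by
    calc ((P.T : ℝ) + 1) * P.n ≤ F * E := by gcongr
      _ = 1 * E * F := by ring
      _ ≤ E * E * F := by gcongr; linarith
      _ = _ := by ring
  have b5 : (P.T : ℝ) + 1 ≤ E ^ 2 * F :=
    hTF.trans (le_mul_of_one_le_left (by linarith) (one_le_pow₀ (by linarith)))
  calc 3 * (P.d : ℝ) * (2 * (P.n + P.n * P.d + P.n * P.n + 2 * (P.m * P.n) + 2 * P.m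
        + (P.T + 1) * P.n + (P.T + 1)))
      ≤ 3 * E * (2 * (9 * (E ^ 2 * F))) := by
        gcongr
        linarith
    _ = 54 * (E ^ 3 * F) := by ring
    _ ≤ E ^ 4 * (E ^ 3 * F) := by
        have : (54 : ℝ) ≤ E ^ 4 := by
          calc (54 : ℝ) ≤ 3 ^ 4 := by norm_num
            _ ≤ E ^ 4 := by gcongr
        gcongr
    _ = Real.exp ((9 + 3 * k) * L) := by
        have : (9 + 3 * (k : ℝ)) * L = (8 : ℕ) * L + (1 + 3 * k) * L := by push_cast; ring
        rw [this, Real.exp_add, Real.exp_nat_mul]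
        ring
    _ ≤ Real.exp (((8 + 3 * k) * L) ^ 2 / 2) := by
        refine Real.exp_le_exp.2 ?_
        have e1 : 8 * ((8 + 3 * k) * L) ≤ ((8 + 3 * k) * L) ^ 2 := by
          rw [sq]
          gcongr
          nlinarith
        nlinarith

/-- At the confidence level `(8 + 3 k) * logSize` a sample is typical with probability at least
`1 - 1 / d`. -/
lemma Calibrated.law_not_typical (hκ : 0 < κ)
    (h : P.Calibrated q ((8 + 3 * k) * P.logSize κ) θ G Z N) (hT : (P.T : ℝ) ≤ P.Tstar κ k)
    (hm : 6 / gaussTail ^ 2 * Real.log P.d ≤ P.m) :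
    P.law.real {ω | ¬ P.Typical ((8 + 3 * k) * P.logSize κ) ω} ≤ 1 / P.d := by
  have hL := P.one_le_logSize hκ
  obtain ⟨p1, p2, p3, -, -, -, -, -⟩ := P.le_exp_logSize hκ
  have hE3 := P.three_le_exp_logSize hκ
  set L := P.logSize κ with hLdef
  have hp := gaussTail_pos
  have hk : (0 : ℝ) ≤ k := Nat.cast_nonneg k
  have hd := P.d_pos'; have hn := P.one_le_n; have hm1 := P.one_le_m
  have hZ := h.Z_pos
  have hZd : Z ^ 3 * P.n ^ 4 ≤ P.d := by
    refine le_trans ?_ h.dim_le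
    have e1 := h.pow_le (k := 3) (by omega)
    have e2 : (P.n : ℝ) ^ 4 ≤ P.m ^ 2 * P.n ^ 4 :=
      le_mul_of_one_le_left (by positivity) (one_le_pow₀ hm1)
    gcongr
  have hn4 : (1 : ℝ) ≤ P.n ^ 4 := one_le_pow₀ hn
  have hZ3d : Z ^ 3 ≤ P.d := (le_mul_of_one_le_right (by positivity) hn4).trans hZd
  have hnd : (P.n : ℝ) ≤ P.d := by
    refine le_trans ?_ hZd
    calc (P.n : ℝ) ≤ 1 * P.n ^ 4 := by rw [one_mul]; exact le_self_pow₀ hn (by norm_num)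
      _ ≤ Z ^ 3 * P.n ^ 4 := by
        have := one_le_pow₀ (n := 3) h.one_le_Z
        gcongr
  have hd6 : (6 : ℝ) ≤ P.d := by
    have e1 := le_self_pow₀ h.one_le_Z (n := 3) (by norm_num)
    linarith [h.Z_ge]
  have hζ : L ≤ (8 + 3 * k) * L := by nlinarith
  have hpZ : 2 * L ≤ gaussTail * Z := by linarith [h.ζ_le]
  -- the lower bounds for the norms of the data noises
  have h1 : P.n * Real.exp (-(gaussTail ^ 2 * P.d / 2)) ≤ 1 / (3 * P.d) := by
    refine mul_exp_neg_le hd ?_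
    have e1 : 3 * L ≤ gaussTail ^ 2 * P.d / 2 := by
      have e2 : 4 * L * 1000 ≤ gaussTail ^ 2 * P.d := by
        calc 4 * L * 1000 ≤ (2 * L) * (2 * L) * Z := by
              have := h.Z_ge
              have : 4 * L ≤ (2 * L) * (2 * L) := by nlinarith
              gcongr
          _ ≤ (gaussTail * Z) * (gaussTail * Z) * Z := by gcongr
          _ = gaussTail ^ 2 * Z ^ 3 := by ring
          _ ≤ _ := by gcongr
      linarith
    calc 3 * (P.d : ℝ) * P.n ≤ Real.exp L * Real.exp L * Real.exp L := by gcongr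
      _ = Real.exp (3 * L) := by rw [← Real.exp_add, ← Real.exp_add]; ring_nf
      _ ≤ _ := Real.exp_le_exp.2 e1
  -- the counts of seeds
  have h2 : 2 * P.n * Real.exp (-(gaussTail ^ 2 * P.m / 2)) ≤ 1 / (3 * P.d) := by
    refine mul_exp_neg_le hd ?_
    have e1 : 3 * Real.log P.d ≤ gaussTail ^ 2 * P.m / 2 := by
      rw [div_mul_eq_mul_div, div_le_iff₀ (by positivity)] at hm
      linarith
    calc 3 * (P.d : ℝ) * (2 * P.n) = 6 * P.n * P.d := by ring
      _ ≤ P.d * P.d * P.d := by gcongr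
      _ = Real.exp (3 * Real.log P.d) := by
          rw [show (3 : ℝ) * Real.log P.d = (3 : ℕ) * Real.log P.d by norm_num, Real.exp_nat_mul,
            Real.exp_log hd]
          ring
      _ ≤ _ := Real.exp_le_exp.2 e1
  have h3 := union_tails_le hκ hT
  have hdζ : ((8 + 3 * k) * L) ^ 2 ≤ gaussTail / 4 * P.d := by
    calc ((8 + 3 * k) * L) ^ 2 ≤ (gaussTail * Z / 2) ^ 2 := by
          have := h.ζ_le
          gcongr
          linarith
      _ = gaussTail / 4 * (gaussTail * Z ^ 2) := by ring
      _ ≤ gaussTail / 4 * (Z * Z ^ 2) := by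
          have := gaussTail_le_one; have := h.one_le_Z
          gcongr
          linarith
      _ = gaussTail / 4 * Z ^ 3 := by ring
      _ ≤ _ := by gcongr
  refine (law_not_typical_le h.ζ_nonneg hdζ).trans ?_
  have e : 1 / (P.d : ℝ) = 1 / (3 * P.d) + 1 / (3 * P.d) + 1 / (3 * P.d) := by field_simp; norm_num
  rw [e]
  exact add_le_add (add_le_add h1 h2) h3

/-- The width condition in the form needed for the concentration of the counts of seeds. -/
lemma NoiseMemorization.width_ge {A : ℝ} {b : ℕ} (hq : 2 < q) (hκ : 0 < κ)
    (h : P.NoiseMemorization q κ (sepConst q κ A k ^ sepPow q) ((b + 2) * sepPow q))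
    (hd : 3 ≤ P.d) : 6 / gaussTail ^ 2 * Real.log P.d ≤ P.m := by
  have hp := gaussTail_pos
  refine le_trans ?_ h.width
  obtain ⟨z1, -⟩ := sepConst_bounds hq hκ A k le_rfl 0 rfl
  rw [one_pow, mul_one] at z1
  have e0 : (1000 : ℝ) ≤ 1000 / gaussTail := by
    rw [le_div_iff₀ hp]; linarith [gaussTail_le_one]
  have e1 : 6 / gaussTail ^ 2 ≤ sepConst q κ A k ^ sepPow q := by
    calc 6 / gaussTail ^ 2 ≤ (1000 / gaussTail) ^ 2 := by rw [div_pow]; gcongr; norm_num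
      _ ≤ sepConst q κ A k ^ 2 := by gcongr
      _ ≤ _ := pow_le_pow_right₀ (by linarith) (by unfold sepPow; omega)
  have e2 : 1 ≤ Real.log P.d := by
    rw [Real.le_log_iff_exp_le P.d_pos']
    have : (3 : ℝ) ≤ P.d := by exact_mod_cast hd
    linarith [Real.exp_one_lt_d9]
  have e3 : Real.log P.d ≤ Real.log P.d ^ ((b + 2) * sepPow q) :=
    le_self_pow₀ e2 (Nat.mul_ne_zero (by omega) (by unfold sepPow; omega))
  have e4 : 0 ≤ 6 / gaussTail ^ 2 := by positivity
  exact mul_le_mul e1 e3 (by linarith) (e4.trans e1)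

lemma logistic_le_exp_neg (x : ℝ) : logistic x ≤ Real.exp (-x) := by
  have := Real.log_le_sub_one_of_pos (x := 1 + Real.exp (-x)) (by positivity)
  unfold logistic
  linarith

/-- A sample that is fitted up to `level q κ` contributes a loss of at most `κ / (2 q - 1)`. -/
lemma logistic_le_of_level (hq : 2 < q) (hκ : 0 < κ) {x : ℝ}
    (hx : (level q κ - 1 / 4) ^ q - 1 ≤ x) : logistic x ≤ κ / (2 * q - 1) := by
  have hM : 0 < (2 * q - 1) / κ := div_pos (by linarith) hκ
  have h1 : (2 * q - 1) / κ ≤ x := by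
    have h2 : level q κ - 1 / 4 ≤ (level q κ - 1 / 4) ^ q := by
      have := two_le_level hq hκ
      calc level q κ - 1 / 4 = (level q κ - 1 / 4) ^ (1 : ℝ) := (Real.rpow_one _).symm
        _ ≤ _ := Real.rpow_le_rpow_of_exponent_le (by linarith) (by linarith)
    have h3 : level q κ = (2 * q - 1) / κ + 2 := rfl
    linarith
  refine (logistic_le_exp_neg x).trans ?_
  rw [Real.exp_neg, ← inv_div]
  exact inv_anti₀ hM (by linarith [Real.add_one_le_exp x])

/-- The empirical risk is at most the largest loss of a sample. -/
lemma risk_le {c : ℝ} (ω : P.Sample) (W : Weights P.d P.m)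
    (h : ∀ i, logistic (sgn (ω.1 i) * net q W (sgn (ω.1 i) • P.v, ω.2.1 i)) ≤ c) :
    P.risk q ω W ≤ c := by
  have hn := P.n_pos'
  unfold risk empRisk
  calc _ ≤ 1 / (P.n : ℝ) * ∑ _i : Fin P.n, c := by
        gcongr with i
        exact h i
    _ = c := by simp; field_simp

end Setup

end PrivateCNN

end

theorem corollary4p11 (q : ℝ) (hq : 2 < q) :
    ∃ c : ℝ, 0 < c ∧
    ∀ (κ : ℝ), 0 < κ → ∀ (A : ℝ) (b k : ℕ),
    ∃ (C : ℝ) (K : ℕ) (C' : ℝ) (K' : ℕ), 0 < C ∧ 0 < C' ∧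
    ∀ P : PrivateCNN.Setup,
      P.NoiseMemorization q κ C K →
      P.sens ≤ A * P.logSize κ ^ b →
      P.T₁ q c ≤ P.T →
      (P.T : ℝ) ≤ P.TpStar κ k →
      ∃ E : Set P.Sample, MeasurableSet E ∧ 1 - 1 / (P.d : ℝ) ≤ P.law.real E ∧
        ∀ ω ∈ E,
          ∃ (Γ : Bool → Fin P.m → ℕ → ℝ) (Φ : Bool → Fin P.m → Fin P.n → ℕ → ℝ),
            -- `Γ` and `Φ` are the unique coefficients of the signal-noise decomposition
            PrivateCNN.IsDecomposition P.v ω.2.1 P.η ω.2.2.2 (P.iter q ω) Γ Φ ∧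
            (∀ Γ₂ Φ₂,
              PrivateCNN.IsDecomposition P.v ω.2.1 P.η ω.2.2.2 (P.iter q ω) Γ₂ Φ₂ →
                Γ₂ = Γ ∧ Φ₂ = Φ) ∧
            -- every data noise has been memorized at the end of the first stage
            (∀ i, ∃ j r, 2 ≤ Φ j r i (P.T₁ q c)) ∧
            -- signal learning stays small
            ((P.m : ℝ) ≤ (P.n : ℝ) ^ (1 / q) * P.ε →
              ∀ t ∈ Finset.Icc (P.T₁ q c) P.T, ∀ j r, |Γ j r t| ≤ P.σ₀ * ‖P.v‖) ∧
            -- cumulative training loss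
            (∀ t ∈ Finset.Icc (P.T₁ q c) P.T,
              ∑ s ∈ Finset.Icc (P.T₁ q c) t, P.risk q ω (P.iter q ω s) ≤
                PrivateCNN.frobDistSq (P.iter q ω (P.T₁ q c))
                    (PrivateCNN.refWeights q κ ω.1 ω.2.1 (P.iter q ω 0)) / ((2 * q - 1) * P.η)
                + ((t : ℝ) - P.T₁ q c + 1) * κ / (2 * q - 1)
                + ((t : ℝ) - P.T₁ q c + 1) *
                  ((P.η * P.d * P.σz ^ 2 + C' * P.logSize κ ^ K' *
                    (P.σz * (P.m : ℝ) ^ 2 * (P.n : ℝ) ^ (1 / 2 : ℝ) * P.ξnorm⁻¹))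
                    / (2 * q - 1))) := by
  open PrivateCNN PrivateCNN.Setup in
  refine ⟨stageConst q, stageConst_pos (by linarith), fun κ hκ A b k => ?_⟩
  have hS : 0 < sepConst q κ A k := by
    obtain ⟨z1, -⟩ := sepConst_bounds hq hκ A k le_rfl 0 rfl
    rw [one_pow, mul_one] at z1
    have := gaussTail_pos
    exact lt_of_lt_of_le (by positivity) z1
  refine ⟨sepConst q κ A k ^ sepPow q, (b + 2) * sepPow q, 1, 0, by positivity, one_pos,
    fun P hP hsens hT₁ hT => ?_⟩
  have h := hP.calibrated hq hκ hsens hT₁ hT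
  have hd : 3 ≤ P.d := by
    have e1 := h.dim_le; have e2 := h.pow_le (k := 1) (by omega); have e3 := h.Z_ge
    have e4 : (1 : ℝ) ≤ P.m ^ 2 * P.n ^ 4 :=
      one_le_mul_of_one_le_of_one_le (one_le_pow₀ P.one_le_m) (one_le_pow₀ P.one_le_n)
    rw [pow_one] at e2
    have e5 : (3 : ℝ) ≤ P.d := by nlinarith
    exact_mod_cast e5
  have hbad := h.law_not_typical hκ (hT.trans (min_le_left _ _)) (hP.width_ge hq hκ hd)
  set bad := {ω | ¬ P.Typical ((8 + 3 * k) * P.logSize κ) ω} with hbaddef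
  refine ⟨(toMeasurable P.law bad)ᶜ, (measurableSet_toMeasurable _ _).compl, ?_, fun ω hω => ?_⟩
  · rw [probReal_compl_eq_one_sub (measurableSet_toMeasurable _ _), measureReal_def,
      measure_toMeasurable, ← measureReal_def]
    linarith
  · have hty : P.Typical ((8 + 3 * k) * P.logSize κ) ω := by
      by_contra hc
      exact hω (subset_toMeasurable _ _ hc)
    obtain ⟨Γ, Φ, hdec, huniq, hmem, hsig, hfit⟩ := h.conclusion hty
    refine ⟨Γ, Φ, hdec, huniq, hmem, fun _ t ht => hsig t (Finset.mem_Icc.1 ht).2,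
      fun t ht => ?_⟩
    obtain ⟨ht1, ht2⟩ := Finset.mem_Icc.1 ht
    have hq1 : 0 < 2 * q - 1 := by linarith
    have hη := P.η_pos; have hX := P.ξnorm_pos; have hσz := P.σz_nonneg
    have hcard : ((Finset.Icc (P.T₁ q (stageConst q)) t).card : ℝ)
        = (t : ℝ) - P.T₁ q (stageConst q) + 1 := by
      rw [Nat.card_Icc, Nat.cast_sub (by omega)]
      push_cast
      ring
    have hlen : 0 ≤ (t : ℝ) - P.T₁ q (stageConst q) + 1 := hcard ▸ Nat.cast_nonneg _
    -- every loss is at most `κ / (2 q - 1)`, and the other terms of the bound are nonnegative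
    have hsum : ∑ s ∈ Finset.Icc (P.T₁ q (stageConst q)) t, P.risk q ω (P.iter q ω s)
        ≤ ((t : ℝ) - P.T₁ q (stageConst q) + 1) * κ / (2 * q - 1) := by
      calc _ ≤ ∑ _s ∈ Finset.Icc (P.T₁ q (stageConst q)) t, κ / (2 * q - 1) := by
            refine Finset.sum_le_sum fun s hs => risk_le ω _ fun i => ?_
            obtain ⟨hs1, hs2⟩ := Finset.mem_Icc.1 hs
            exact logistic_le_of_level hq hκ (hfit s (Finset.mem_Icc.2 ⟨hs1, hs2.trans ht2⟩) i)
        _ = _ := by rw [Finset.sum_const, nsmul_eq_mul, hcard]; ring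
    have hfrob : 0 ≤ frobDistSq (P.iter q ω (P.T₁ q (stageConst q)))
        (refWeights q κ ω.1 ω.2.1 (P.iter q ω 0)) / ((2 * q - 1) * P.η) :=
      div_nonneg (Finset.sum_nonneg fun j _ => Finset.sum_nonneg fun r _ => sq_nonneg _)
        (by positivity)
    have hlast : 0 ≤ ((t : ℝ) - P.T₁ q (stageConst q) + 1) *
        ((P.η * P.d * P.σz ^ 2 + 1 * P.logSize κ ^ 0 *
          (P.σz * (P.m : ℝ) ^ 2 * (P.n : ℝ) ^ (1 / 2 : ℝ) * P.ξnorm⁻¹)) / (2 * q - 1)) := by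
      positivity
    linarith
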